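/- **Setting.** Let $X=(X_t)_{t\ge 0}$ be an upwards skip-free L\'evy chain on a probability space $(\Omega,\mathcal F,\mathbb F,\mathsf P)$: a L\'evy process started from $0$ with c\`adl\`ag paths, adapted to the filtration $\mathbb F$ and with independent increments relative to $\mathbb F$, which is compound Poisson with L\'evy measure $\lambda$ (a finite measure with $\lambda(\{0\})=0$ and $\mathsf E[e^{ipX_t}]=\exp\{t\int(e^{ipx}-1)\lambda(dx)\}$ for $p\in\mathbb R$, $t\ge0$), and such that for some $h>0$, $\mathrm{supp}(\lambda)\subset h\mathbb Z$ and $\mathrm{supp}(\lambda|_{(0,\infty)})=\{h\}$. For $\beta\ge0$ let $\psi(\beta)=\int(e^{\beta x}-1)\lambda(dx)$; let $\Phi(0)$ be the largest root of $\psi$ on $[0,\infty)$ and $\Phi:[0,\infty)\to[\Phi(0),\infty)$ the inverse of the bijection $\psi:[\Phi(0),\infty)\to[0,\infty)$. For $x\ge0$ let $T_x^-=\inf\{t\ge0: X_t<-x\}$, and let $T_h=\inf\{t\ge 0:X_t\ge h\}$ ($\inf\emptyset=\infty$). **Scale functions.** Let $D_1=\sup\{-X_s: 0\le s<T_h\}\in[0,\infty]$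 be the depth reached by $X$ before it attains the new maximum $h$, and for $x\ge 0$ let $$W(x)=\frac{1}{h\lambda(\{h\})}\prod_{r=1}^{\lfloor x/h\rfloor}\frac1{\mathsf P(D_1\le (r-1)h)} .$$ For $c\ge0$ let $\mathsf P_c$ be the unique measure on the space of c\`adl\`ag paths (with $X$ the coordinate process, $\mathsf P$ its law, $(\mathcal F_t)$ the natural filtration and the $\sigma$-algebra generated by the coordinates) with $\mathsf P_c(\Lambda)=\mathsf E[e^{cX_t-\psi(c)t}\mathbf 1_\Lambda]$ for all $\Lambda\in\mathcal F_t$, $t\ge0$. Let $W_c$ be defined as $W$, but for $X$ under $\mathsf P_c$, whose L\'evy measure is $\lambda_c(dx)=e^{cx}\lambda(dx)$. For $q\ge0$ and $x\ge0$ put $$W^{(q)}(x)=e^{\Phi(q)\lfloor 1+x/h\rfloor h}\,W_{\Phi(q)}(x),\qquad Z^{(q)}(x)=1+q\int_0^{\lfloor x/h\rfloor h}W^{(q)}(z)\,dz .$$ **Theorem.** 1. For every $q>0$ and $x\ge0$, $$\mathsf E\big[e^{-qT_x^-}\mathbf 1_{\{T_x^-<\infty\}}\big]=Z^{(q)}(x)-\frac{qh}{e^{\Phi(q)h}-1}W^{(q)}(x).$$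 2. The limit $W(+\infty)=\lim_{x\to\infty}W(x)$ exists in $(0,+\infty]$, and for every $x\ge0$, $\mathsf P(T_x^-<\infty)=1-W(x)/W(+\infty)$ (where $a/\infty=0$). 3. For every $q\ge0$ and $\beta>\Phi(q)$, $$\int_0^\infty e^{-\beta x}Z^{(q)}(x)\,dx=\frac1\beta\Big(1+\frac q{\psi(\beta)-q}\Big),$$ the integral converging absolutely. 4. The normalisations of the scale functions are those for which $$\int_0^\infty e^{-\beta x}W(x)\,dx=\frac{e^{\beta h}-1}{\beta h\,\psi(\beta)}\quad(\beta>\Phi(0)),\qquad \int_0^\infty e^{-\beta x}W^{(q)}(x)\,dx=\frac{e^{\beta h}-1}{\beta h(\psi(\beta)-q)}\quad(q\ge0,\ \beta>\Phi(q)),$$ these integrals converging absolutely. -/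

import Mathlib

open MeasureTheory ProbabilityTheory Filter Topology Set
open scoped ENNReal NNReal

noncomputable section

namespace SkipFree

/-- Right-continuous with (finite) left limits at every time. -/
def IsCadlag (f : ℝ≥0 → ℝ) : Prop :=
  ∀ t, ContinuousWithinAt f (Ici t) t ∧ ∃ l : ℝ, Tendsto f (𝓝[<] t) (𝓝 l)

/-- A Lévy process with all paths càdlàg, adapted to the filtration `𝓕` and with increments that
are stationary and independent of the past in the sense of `𝓕`. -/
structure IsLevyProcess {Ω : Type*} {m : MeasurableSpace Ω} (𝓕 : Filtration ℝ≥0 m)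
    (P : Measure Ω) (X : ℝ≥0 → Ω → ℝ) : Prop where
  adapted : ∀ t, Measurable[𝓕 t] (X t)
  cadlag : ∀ ω, IsCadlag (fun t => X t ω)
  zero : ∀ᵐ ω ∂P, X 0 ω = 0
  stationary : ∀ s t, IdentDistrib (fun ω => X (s + t) ω - X s ω) (X t) P P
  indep : ∀ s t, Indep (𝓕 s)
    (MeasurableSpace.comap (fun ω => X (s + t) ω - X s ω) inferInstance) P

/-- A compound Poisson process with Lévy measure `lam` (a nonzero finite measure without mass
at `0`), characterised by its characteristic function. -/
structure IsCompoundPoisson {Ω : Type*} {m : MeasurableSpace Ω} (𝓕 : Filtration ℝ≥0 m)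
    (P : Measure Ω) (X : ℝ≥0 → Ω → ℝ) (lam : Measure ℝ) : Prop
    extends IsLevyProcess 𝓕 P X where
  finite : IsFiniteMeasure lam
  ne_zero : lam ≠ 0
  no_mass_zero : lam {0} = 0
  charFun_eq : ∀ (t : ℝ≥0) (p : ℝ),
    ∫ ω, Complex.exp (Complex.I * p * X t ω) ∂P =
      Complex.exp ((t : ℝ) * ∫ x, (Complex.exp (Complex.I * p * x) - 1) ∂lam)

/-- An upwards skip-free Lévy chain on `hℤ`, with Lévy measure `lam`. -/
structure IsUpwardsSkipFreeLevyChain {Ω : Type*} {m : MeasurableSpace Ω} (𝓕 : Filtration ℝ≥0 m)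
    (P : Measure Ω) (X : ℝ≥0 → Ω → ℝ) (lam : Measure ℝ) (h : ℝ) : Prop
    extends IsCompoundPoisson 𝓕 P X lam where
  h_pos : 0 < h
  support_subset : lam.support ⊆ {x | ∃ k : ℤ, x = h * k}
  support_pos : (lam.restrict (Ioi 0)).support = {h}

/-- The Laplace exponent `ψ(β) = ∫ (e^{βx} - 1) λ(dx)`, for real `β ≥ 0`. -/
def psi (lam : Measure ℝ) (β : ℝ) : ℝ := ∫ x, (Real.exp (β * x) - 1) ∂lam

/-- `Φ(0)`: the largest root of `ψ` on `[0,∞)`. -/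
def phiZero (lam : Measure ℝ) : ℝ := sSup {β : ℝ | 0 ≤ β ∧ psi lam β = 0}

/-- `Φ : [0,∞) → [Φ(0),∞)`, the inverse of the bijection `ψ : [Φ(0),∞) → [0,∞)`. -/
def phi (lam : Measure ℝ) (q : ℝ) : ℝ := Function.invFunOn (psi lam) (Ici (phiZero lam)) q

/-- The canonical space of càdlàg paths. -/
abbrev Path : Type := {ω : ℝ≥0 → ℝ // IsCadlag ω}

/-- The σ-algebra `F_t` on path space, generated by the evaluations at times `s ≤ t`. (The
ambient σ-algebra of `Path` is the one generated by all evaluations.) -/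
abbrev pathSigma (t : ℝ≥0) : MeasurableSpace Path :=
  ⨆ s : ℝ≥0, ⨆ _ : s ≤ t, MeasurableSpace.comap (fun ω : Path => ω.1 s) inferInstance

/-- The law of a process with càdlàg paths, as a measure on path space. -/
def pathLaw {Ω : Type*} {m : MeasurableSpace Ω} (P : Measure Ω) (X : ℝ≥0 → Ω → ℝ)
    (hX : ∀ ω, IsCadlag (fun t => X t ω)) : Measure Path :=
  P.map (fun ω => (⟨fun t => X t ω, hX ω⟩ : Path))

/-- `ν` is the exponential change of measure of `μ` with parameter `c`:
`ν(Λ) = E_μ[exp(c X_t - ψ(c) t) 1_Λ]` for all `t ≥ 0` and `Λ ∈ F_t`. -/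
def IsExpChange (lam : Measure ℝ) (μ : Measure Path) (c : ℝ) (ν : Measure Path) : Prop :=
  ∀ (t : ℝ≥0) (Λ : Set Path), MeasurableSet[pathSigma t] Λ →
    ν Λ = ∫⁻ ω in Λ, ENNReal.ofReal (Real.exp (c * ω.1 t - psi lam c * t)) ∂μ

/-- The measure `P_c` on path space: the (unique) `ν` with `IsExpChange lam μ c ν`. -/
def expChange (lam : Measure ℝ) (μ : Measure Path) (c : ℝ) : Measure Path :=
  Classical.epsilon fun ν => IsExpChange lam μ c ν

/-- `T_x = inf {t ≥ 0 : ω t ≥ x}`, equal to `∞` if `x` is never reached. -/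
def firstEntrance (x : ℝ) (ω : ℝ≥0 → ℝ) : ℝ≥0∞ := ⨅ (t : ℝ≥0) (_ : x ≤ ω t), (t : ℝ≥0∞)

/-- `T_x⁻ = inf {t ≥ 0 : ω t < -x}`, equal to `∞` if the path never goes below `-x`. -/
def firstPassageBelow (x : ℝ) (ω : ℝ≥0 → ℝ) : ℝ≥0∞ := ⨅ (t : ℝ≥0) (_ : ω t < -x), (t : ℝ≥0∞)

/-- `D₁`: the depth (in `[0,∞]`, for a path from `0`) of the path below its starting maximum `0`
before it attains the new maximum `h`. -/
def depth (h : ℝ) (ω : ℝ≥0 → ℝ) : EReal :=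
  ⨆ (s : ℝ≥0) (_ : (s : ℝ≥0∞) < firstEntrance h ω), ((-ω s : ℝ) : EReal)

/-- The scale function `W` on `[0,∞)` of the chain with step `h`, Lévy measure `lam` and law `μ`:
proportional to `1 / ∏_{r=1}^{⌊x/h⌋} P(D₁ ≤ (r-1)h)`, and normalised by `W(0) = 1/(h λ({h}))`. -/
def scaleW (h : ℝ) (lam : Measure ℝ) (μ : Measure Path) (x : ℝ) : ℝ :=
  (1 / (h * lam.real {h})) /
    ∏ r ∈ Finset.range ⌊x / h⌋₊, μ.real {ω : Path | depth h ω.1 ≤ ((r * h : ℝ) : EReal)}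

/-- The Lévy measure `λ_c(dx) = e^{cx} λ(dx)` of the chain under `P_c`. -/
def expLevy (lam : Measure ℝ) (c : ℝ) : Measure ℝ :=
  lam.withDensity fun x => ENNReal.ofReal (Real.exp (c * x))

/-- `W_c`: the scale function `W` of the chain under `P_c`. -/
def scaleWTilted (h : ℝ) (lam : Measure ℝ) (μ : Measure Path) (c x : ℝ) : ℝ :=
  scaleW h (expLevy lam c) (expChange lam μ c) x

/-- `W^{(q)}(x) = e^{Φ(q) ⌊1 + x/h⌋ h} W_{Φ(q)}(x)`, for `x ≥ 0`. -/
def scaleWq (h : ℝ) (lam : Measure ℝ) (μ : Measure Path) (q x : ℝ) : ℝ :=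
  Real.exp (phi lam q * ⌊1 + x / h⌋ * h) * scaleWTilted h lam μ (phi lam q) x

/-- `Z^{(q)}(x) = 1 + q ∫_0^{⌊x/h⌋h} W^{(q)}(z) dz`, for `x ≥ 0`. -/
def scaleZq (h : ℝ) (lam : Measure ℝ) (μ : Measure Path) (q x : ℝ) : ℝ :=
  1 + q * ∫ z in (0 : ℝ)..(⌊x / h⌋ * h), scaleWq h lam μ q z

/-- The Laplace transform of `f : [0,∞) → ℝ` converges absolutely at `β`, with value `v`. -/
def HasLaplace (f : ℝ → ℝ) (β v : ℝ) : Prop :=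
  IntegrableOn (fun x => Real.exp (-β * x) * f x) (Ioi 0) ∧
    ∫ x in Ioi (0 : ℝ), Real.exp (-β * x) * f x = v

end SkipFree

end

/-! Write mᵢ for the mass of `lam` at (1 - i)h, i ≥ 0, and Λ for its total mass. Everything rests on
one sequence w^{(q)} (`scaleSeq`), the solution of the convolution recursion ∑_{i+l=j+1} mᵢ wₗ =
(Λ+q) wⱼ with w₀ = 1/(h m₀). Placed on the lattice with index 0 at the bottom of a strip and 0 below
it, it satisfies L w = q w in the strip, where L is the generator. Upward jumps have size h, so the
recursion is triangular, with m₀ > 0 on the diagonal.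

Dynkin's formula (`IsChain.integral_exitValue`) then solves the two-sided exit problem. Start at 0
in a strip with r levels below 0 and top Nh. The discounted probability of leaving above is
w_r/w_{N+r}. With Z_j = 1 + qh ∑_{l<j} w_l, which solves the same equation but equals 1 below the
strip, that of leaving below is Z_r - Z_{N+r} w_r/w_{N+r}. For q > 0 this comes from a time grid and
a second-order short-time estimate of the compound Poisson semigroup; q = 0 follows by continuity.

With q = 0 and N = 1 this gives P(D₁ ≤ rh) = w_r/w_{r+1}, so the product defining W telescopes to
w^{(0)} (`IsChain.scaleW_eq`). For W^{(q)}, the tilt by c = Φ(q) raises the total mass to Λ+q, and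
multiplication by e^{ch(j+1)} carries the undiscounted sequence of the tilted measure to w^{(q)}
(`scaleSeq_tilt`). Using this requires that P_c exists and makes X a chain with Lévy measure λ_c
(`exists_isExpChange`, `of_isExpChange`); P_c is built by concatenating independent tilted unit-time
blocks.

First passage below -x is the limit N → ∞ of exit below. For q > 0 the constant is lim Z_j/w_j =
qh/(e^{Φ(q)h} - 1), because w_j/w_{j+1} → e^{-Φ(q)h}; for q = 0, Z ≡ 1 and w^{(0)} is monotone. The
Laplace transforms are generating functions of w and Z, read off from the recursion, since the scale
functions are step functions. -/

namespace SkipFree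

/-! ### Skip-free Lévy measures, the exponent ψ and its inverse Φ -/

/-- A finite measure on `{h, 0, -h, -2h, …}` charging `h`. -/
structure IsSkipFreeMeasure (lam : Measure ℝ) (h : ℝ) : Prop where
  finite : IsFiniteMeasure lam
  h_pos : 0 < h
  mass_pos : 0 < lam.real {h}
  ae_mem : ∀ᵐ x ∂lam, ∃ i : ℕ, x = (1 - (i : ℝ)) * h

/-- The mass at `(1 - i) h`. -/
noncomputable def mass (lam : Measure ℝ) (h : ℝ) (i : ℕ) : ℝ := lam.real {(1 - (i : ℝ)) * h}

lemma mass_nonneg (lam : Measure ℝ) (h : ℝ) (i : ℕ) : 0 ≤ mass lam h i := measureReal_nonneg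

lemma isSkipFreeMeasure_of_support {lam : Measure ℝ} {h : ℝ} (hfin : IsFiniteMeasure lam)
    (hh : 0 < h) (hsupp : lam.support ⊆ {x | ∃ k : ℤ, x = h * k})
    (hpos : (lam.restrict (Ioi 0)).support = {h}) : IsSkipFreeMeasure lam h := by
  have h1 : ∀ᵐ x ∂lam, x ∈ lam.support := Measure.support_mem_ae
  have h2 : ∀ᵐ x ∂(lam.restrict (Ioi 0)), x = h := by
    have : ∀ᵐ x ∂(lam.restrict (Ioi 0)), x ∈ (lam.restrict (Ioi 0)).support :=
      Measure.support_mem_ae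
    rw [hpos] at this
    exact this
  have h3 := (ae_restrict_iff' measurableSet_Ioi).1 h2
  refine ⟨hfin, hh, ?_, ?_⟩
  · rw [measureReal_def, ENNReal.toReal_pos_iff]
    refine ⟨pos_iff_ne_zero.2 fun h0 => ?_, measure_lt_top _ _⟩
    -- The restriction is concentrated at h; were h not charged it would vanish, and its support
    -- would be empty.
    have h4 : lam.restrict (Ioi 0) = 0 := by
      have h5 : ∀ᵐ x ∂(lam.restrict (Ioi 0)), x ≠ h := by
        refine ae_restrict_of_ae ?_
        rw [ae_iff]
        simpa using h0
      rw [← ae_eq_bot, ← Filter.eventually_false_iff_eq_bot]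
      filter_upwards [h2, h5] with x hx hx'
      exact hx' hx
    rw [h4, Measure.support_zero] at hpos
    exact (singleton_ne_empty h) hpos.symm
  · filter_upwards [h1, h3] with x hx hx'
    obtain ⟨k, rfl⟩ := hsupp hx
    rcases le_or_gt (h * (k : ℝ)) 0 with hk | hk
    · have hk' : k ≤ 0 := by
        by_contra hc
        have : (0 : ℝ) < k := by exact_mod_cast not_le.1 hc
        nlinarith [mul_pos hh this]
      refine ⟨(1 - k).toNat, ?_⟩
      have : (((1 - k).toNat : ℕ) : ℝ) = 1 - k := by
        have := Int.toNat_of_nonneg (show 0 ≤ 1 - k by omega)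
        exact_mod_cast congrArg (Int.cast : ℤ → ℝ) this
      rw [this]; ring
    · exact ⟨0, by rw [hx' hk]; simp⟩

namespace IsSkipFreeMeasure

variable {lam : Measure ℝ} {h : ℝ}

/-- A countable carrier makes the measure a sum of atoms; every integral against `lam` thereby
becomes a series over the masses. -/
lemma eq_sum (H : IsSkipFreeMeasure lam h) :
    lam = Measure.sum fun i : ℕ =>
      lam {(1 - (i : ℝ)) * h} • Measure.dirac ((1 - (i : ℝ)) * h) := by
  have hh := H.h_pos
  ext s hs
  have hinj : Function.Injective fun i : ℕ => (1 - (i : ℝ)) * h := fun i j hij => by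
    have := mul_right_cancel₀ hh.ne' hij
    have : (i : ℝ) = j := by linarith
    exact_mod_cast this
  have h1 : lam s = lam (⋃ i : ℕ, s ∩ {(1 - (i : ℝ)) * h}) := by
    refine measure_congr ?_
    filter_upwards [H.ae_mem] with x hx
    obtain ⟨i, hi⟩ := hx
    refine propext ⟨fun hxs => mem_iUnion.2 ⟨i, hxs, hi⟩, fun hxs => ?_⟩
    obtain ⟨j, hj⟩ := mem_iUnion.1 hxs
    exact hj.1
  rw [h1, measure_iUnion]
  · rw [Measure.sum_apply _ hs]
    refine tsum_congr fun i => ?_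
    rw [Measure.smul_apply, Measure.dirac_apply' _ hs, smul_eq_mul]
    by_cases hi : (1 - (i : ℝ)) * h ∈ s
    · rw [inter_eq_right.2 (singleton_subset_iff.2 hi), indicator_of_mem hi]; simp
    · have : s ∩ {(1 - (i : ℝ)) * h} = ∅ := by
        ext y; simp only [mem_inter_iff, mem_singleton_iff, mem_empty_iff_false, iff_false]
        rintro ⟨hy, rfl⟩; exact hi hy
      rw [this, indicator_of_notMem hi]; simp
  · intro i j hij
    refine disjoint_left.2 fun y hy hy' => hij (hinj ?_)
    exact (mem_singleton_iff.1 hy.2).symm.trans (mem_singleton_iff.1 hy'.2)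
  · exact fun i => hs.inter (measurableSet_singleton _)

lemma hasSum_integral (H : IsSkipFreeMeasure lam h) {f : ℝ → ℝ} (hf : Integrable f lam) :
    HasSum (fun i : ℕ => mass lam h i * f ((1 - (i : ℝ)) * h)) (∫ x, f x ∂lam) := by
  have := H.finite
  rw [H.eq_sum] at hf
  have h1 := hasSum_integral_sum_dirac (fun i => measure_ne_top lam _) hf.summable_of_dirac
  rw [← H.eq_sum] at h1
  exact h1

lemma summable_mass (H : IsSkipFreeMeasure lam h) : Summable (mass lam h) := by
  have := H.finite
  simpa using (H.hasSum_integral (integrable_const (1 : ℝ))).summable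

lemma tsum_mass (H : IsSkipFreeMeasure lam h) : ∑' i, mass lam h i = lam.real univ := by
  have := H.finite
  simpa using (H.hasSum_integral (integrable_const (1 : ℝ))).tsum_eq

lemma mass_zero (lam : Measure ℝ) (h : ℝ) : mass lam h 0 = lam.real {h} := by simp [mass]

lemma mass_zero_pos (H : IsSkipFreeMeasure lam h) : 0 < mass lam h 0 := by
  rw [mass_zero]; exact H.mass_pos

lemma ae_le (H : IsSkipFreeMeasure lam h) : ∀ᵐ x ∂lam, x ≤ h := by
  filter_upwards [H.ae_mem] with x hx
  obtain ⟨i, rfl⟩ := hx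
  nlinarith [H.h_pos, (Nat.cast_nonneg i : (0 : ℝ) ≤ i)]

lemma ae_exp_le (H : IsSkipFreeMeasure lam h) {β : ℝ} (hβ : 0 ≤ β) :
    ∀ᵐ x ∂lam, ‖Real.exp (β * x)‖ ≤ Real.exp (β * h) := by
  filter_upwards [H.ae_le] with x hx
  rw [Real.norm_eq_abs, abs_of_pos (Real.exp_pos _)]
  exact Real.exp_le_exp.2 (mul_le_mul_of_nonneg_left hx hβ)

lemma integrable_exp (H : IsSkipFreeMeasure lam h) {β : ℝ} (hβ : 0 ≤ β) :
    Integrable (fun x => Real.exp (β * x)) lam := by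
  have := H.finite
  exact Integrable.of_bound (by fun_prop) _ (H.ae_exp_le hβ)

lemma psi_eq (H : IsSkipFreeMeasure lam h) {β : ℝ} (hβ : 0 ≤ β) :
    psi lam β = ∫ x, Real.exp (β * x) ∂lam - lam.real univ := by
  have := H.finite
  rw [psi, integral_sub (H.integrable_exp hβ) (integrable_const _)]
  simp

lemma psi_zero (lam : Measure ℝ) : psi lam 0 = 0 := by simp [psi]

lemma continuousOn_psi (H : IsSkipFreeMeasure lam h) : ContinuousOn (psi lam) (Ici 0) := by
  have := H.finite
  intro b hb
  have h1 : ContinuousWithinAt (fun β => ∫ x, Real.exp (β * x) ∂lam) (Ici 0) b := by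
    refine continuousWithinAt_of_dominated (bound := fun _ => Real.exp ((b + 1) * h))
      (Eventually.of_forall fun β => by fun_prop) ?_ (integrable_const _)
      (Eventually.of_forall fun x => by fun_prop)
    have h2 : ∀ᶠ β in 𝓝[Ici 0] b, β ≤ b + 1 :=
      mem_nhdsWithin_of_mem_nhds (Iic_mem_nhds (by linarith))
    filter_upwards [h2, self_mem_nhdsWithin] with β hβ hβ0
    filter_upwards [H.ae_exp_le hβ0] with x hx
    exact hx.trans (Real.exp_le_exp.2 (mul_le_mul_of_nonneg_right hβ H.h_pos.le))
  exact (h1.sub continuousWithinAt_const).congr (fun β hβ => H.psi_eq hβ) (H.psi_eq hb)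

/-- The atom at h alone forces at least linear growth, through e^y ≥ y. Hence the roots of ψ are
bounded and ψ takes every value q ≥ 0 on [Φ(0), ∞). -/
lemma psi_lower_bound (H : IsSkipFreeMeasure lam h) {β : ℝ} (hβ : 0 ≤ β) :
    lam.real {h} * (β * h) - lam.real univ ≤ psi lam β := by
  have := H.finite
  rw [H.psi_eq hβ]
  have h1 : lam.real {h} * Real.exp (β * h) ≤ ∫ x, Real.exp (β * x) ∂lam := by
    have h2 := (H.hasSum_integral (H.integrable_exp hβ))
    have h3 := le_hasSum h2 0 fun j _ => mul_nonneg (mass_nonneg _ _ _) (Real.exp_pos _).le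
    simpa [mass] using h3
  have h4 : lam.real {h} * (β * h) ≤ lam.real {h} * Real.exp (β * h) :=
    mul_le_mul_of_nonneg_left (by linarith [Real.add_one_le_exp (β * h)]) measureReal_nonneg
  linarith

lemma exists_psi_gt (H : IsSkipFreeMeasure lam h) (q : ℝ) (b : ℝ) :
    ∃ B, b ≤ B ∧ 0 ≤ B ∧ ∀ β, B ≤ β → q < psi lam β := by
  have hph := mul_pos H.mass_pos H.h_pos
  refine ⟨max (max b 0) ((q + 1 + lam.real univ) / (lam.real {h} * h)),
    (le_max_left _ _).trans (le_max_left _ _), (le_max_right _ _).trans (le_max_left _ _),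
    fun β hβ => ?_⟩
  have h0 : 0 ≤ β := ((le_max_right _ _).trans (le_max_left _ _)).trans hβ
  have h1 := H.psi_lower_bound h0
  have h2 := (div_le_iff₀ hph).1 ((le_max_right _ _).trans hβ)
  nlinarith

/-- Convexity of `psi`, compared with its value `0` at `0`. -/
lemma psi_mul_le (H : IsSkipFreeMeasure lam h) {θ b : ℝ} (hθ : 0 ≤ θ) (hθ1 : θ ≤ 1)
    (hb : 0 ≤ b) : psi lam (θ * b) ≤ θ * psi lam b := by
  have := H.finite
  have hi : ∀ {β : ℝ}, 0 ≤ β → Integrable (fun x => Real.exp (β * x) - 1) lam := fun hβ =>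
    (H.integrable_exp hβ).sub (integrable_const _)
  rw [psi, psi, ← integral_const_mul]
  refine integral_mono (hi (mul_nonneg hθ hb)) ((hi hb).const_mul θ) fun x => ?_
  have h1 := convexOn_exp.2 (mem_univ (b * x)) (mem_univ 0) hθ (sub_nonneg.2 hθ1) (by ring)
  simp only [smul_eq_mul, mul_zero, add_zero, Real.exp_zero, mul_one] at h1
  have h2 : θ * b * x = θ * (b * x) := by ring
  simp only [h2]
  linarith

lemma phiZero_mem (H : IsSkipFreeMeasure lam h) : 0 ≤ phiZero lam ∧ psi lam (phiZero lam) = 0 := by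
  have hne : {β : ℝ | 0 ≤ β ∧ psi lam β = 0}.Nonempty := ⟨0, le_rfl, psi_zero lam⟩
  have hbdd : BddAbove {β : ℝ | 0 ≤ β ∧ psi lam β = 0} := by
    obtain ⟨B, -, -, hB⟩ := H.exists_psi_gt 0 0
    exact ⟨B, fun β hβ => le_of_not_ge fun hc => (hB β hc).ne' hβ.2⟩
  have hcl : IsClosed {β : ℝ | 0 ≤ β ∧ psi lam β = 0} := by
    have : {β : ℝ | 0 ≤ β ∧ psi lam β = 0} = Ici 0 ∩ psi lam ⁻¹' {0} := rfl
    rw [this]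
    exact H.continuousOn_psi.preimage_isClosed_of_isClosed isClosed_Ici isClosed_singleton
  exact hcl.csSup_mem hne hbdd

lemma phiZero_ge (H : IsSkipFreeMeasure lam h) {β : ℝ} (h0 : 0 ≤ β) (h1 : psi lam β = 0) :
    β ≤ phiZero lam := by
  obtain ⟨B, -, -, hB⟩ := H.exists_psi_gt 0 0
  exact le_csSup ⟨B, fun β hβ => le_of_not_ge fun hc => (hB β hc).ne' hβ.2⟩ ⟨h0, h1⟩

/-- A value ≤ 0 beyond Φ(0) would, by the intermediate value theorem against the growth of ψ,
produce a larger root. -/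
lemma psi_pos (H : IsSkipFreeMeasure lam h) {β : ℝ} (hβ : phiZero lam < β) : 0 < psi lam β := by
  have h0 := H.phiZero_mem.1
  by_contra hc
  obtain ⟨B, hB1, hB0, hB⟩ := H.exists_psi_gt 0 β
  obtain ⟨x, hx, hx0⟩ := intermediate_value_Icc hB1
    (H.continuousOn_psi.mono fun y hy => h0.trans (hβ.le.trans hy.1))
    ⟨not_lt.1 hc, (hB B le_rfl).le⟩
  exact absurd (H.phiZero_ge (h0.trans (hβ.le.trans hx.1)) hx0) (not_le.2 (hβ.trans_le hx.1))

/-- Convexity and ψ(0) = 0 give ψ(a) ≤ (a/b) ψ(b), and ψ(b) > 0 makes this strictly less than ψ(b).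
-/
lemma psi_strictMono (H : IsSkipFreeMeasure lam h) {a b : ℝ} (ha : phiZero lam ≤ a) (hab : a < b) :
    psi lam a < psi lam b := by
  have h0 := H.phiZero_mem.1.trans ha
  have hb := H.psi_pos (ha.trans_lt hab)
  have hb0 : 0 < b := h0.trans_lt hab
  have h1 := H.psi_mul_le (div_nonneg h0 hb0.le) ((div_le_one hb0).2 hab.le) hb0.le
  rw [div_mul_cancel₀ _ hb0.ne'] at h1
  refine h1.trans_lt ?_
  exact mul_lt_of_lt_one_left hb ((div_lt_one hb0).2 hab)

lemma phi_mem (H : IsSkipFreeMeasure lam h) {q : ℝ} (hq : 0 ≤ q) :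
    phiZero lam ≤ phi lam q ∧ psi lam (phi lam q) = q := by
  have hex : ∃ a ∈ Ici (phiZero lam), psi lam a = q := by
    obtain ⟨B, hB1, hB0, hB⟩ := H.exists_psi_gt q (phiZero lam)
    obtain ⟨x, hx, hx0⟩ := intermediate_value_Icc hB1
      (H.continuousOn_psi.mono fun y hy => H.phiZero_mem.1.trans hy.1)
      ⟨H.phiZero_mem.2.trans_le hq, (hB B le_rfl).le⟩
    exact ⟨x, hx.1, hx0⟩
  exact ⟨Function.invFunOn_mem hex, Function.invFunOn_eq hex⟩

lemma phi_nonneg (H : IsSkipFreeMeasure lam h) {q : ℝ} (hq : 0 ≤ q) : 0 ≤ phi lam q :=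
  H.phiZero_mem.1.trans (H.phi_mem hq).1

lemma psi_phi (H : IsSkipFreeMeasure lam h) {q : ℝ} (hq : 0 ≤ q) : psi lam (phi lam q) = q :=
  (H.phi_mem hq).2

lemma phi_pos (H : IsSkipFreeMeasure lam h) {q : ℝ} (hq : 0 < q) : 0 < phi lam q := by
  refine (H.phi_nonneg hq.le).lt_of_ne fun h0 => ?_
  have := H.psi_phi hq.le
  rw [← h0, psi_zero] at this
  exact hq.ne this

lemma lt_psi (H : IsSkipFreeMeasure lam h) {q β : ℝ} (hq : 0 ≤ q) (hβ : phi lam q < β) :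
    q < psi lam β := by
  have := H.psi_strictMono (H.phi_mem hq).1 hβ
  rwa [H.psi_phi hq] at this

/-- `psi` in terms of the generating function of the masses. -/
lemma hasSum_mass_pow (H : IsSkipFreeMeasure lam h) {β : ℝ} (hβ : 0 ≤ β) :
    HasSum (fun i => mass lam h i * Real.exp (-β * h) ^ i)
      (Real.exp (-β * h) * (psi lam β + lam.real univ)) := by
  have h1 := (H.hasSum_integral (H.integrable_exp hβ)).mul_left (Real.exp (-β * h))
  rw [H.psi_eq hβ, sub_add_cancel]
  refine h1.congr_fun fun i => ?_
  rw [← Real.exp_nat_mul, mul_left_comm (Real.exp _), ← Real.exp_add]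
  congr 2
  ring

/-- For c ≥ 0 the density is at most e^{ch} on the carrier, so tilting stays inside the class and
all results on chains apply under P_c. -/
lemma withDensity_exp (H : IsSkipFreeMeasure lam h) {c : ℝ} (hc : 0 ≤ c) :
    IsSkipFreeMeasure (expLevy lam c) h := by
  have hfin := H.finite
  have hfin' : IsFiniteMeasure (expLevy lam c) :=
    isFiniteMeasure_withDensity_ofReal (H.integrable_exp hc).2
  refine ⟨hfin', H.h_pos, ?_, (withDensity_absolutelyContinuous _ _).ae_le H.ae_mem⟩
  rw [expLevy, measureReal_def, withDensity_apply _ (measurableSet_singleton _),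
    lintegral_singleton, ENNReal.toReal_mul, ENNReal.toReal_ofReal (Real.exp_pos _).le]
  exact mul_pos (Real.exp_pos _) H.mass_pos

end IsSkipFreeMeasure

lemma expLevy_real_singleton (lam : Measure ℝ) (c x : ℝ) :
    (expLevy lam c).real {x} = Real.exp (c * x) * lam.real {x} := by
  rw [expLevy, measureReal_def, withDensity_apply _ (measurableSet_singleton _),
    lintegral_singleton, ENNReal.toReal_mul, ENNReal.toReal_ofReal (Real.exp_pos _).le]
  rfl

/-- At c = Φ(q) the total mass becomes Λ + q: this is how tilting absorbs the discount rate. -/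
lemma IsSkipFreeMeasure.expLevy_real_univ {lam : Measure ℝ} {h : ℝ} (H : IsSkipFreeMeasure lam h)
    {c : ℝ} (hc : 0 ≤ c) : (expLevy lam c).real univ = psi lam c + lam.real univ := by
  rw [expLevy, measureReal_def, withDensity_apply _ MeasurableSet.univ, setLIntegral_univ,
    ← ofReal_integral_eq_lintegral_ofReal (H.integrable_exp hc)
      (ae_of_all _ fun _ => (Real.exp_pos _).le),
    ENNReal.toReal_ofReal (integral_nonneg fun _ => (Real.exp_pos _).le), H.psi_eq hc]
  ring

end SkipFree

/-! ### The scale sequence: recursion, monotonicity, growth, tilting -/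

namespace SkipFree

/-- The solution `w` of `∑_{i+l=j+1} mᵢ wₗ = (Λ+q) wⱼ`, `w₀ = 1/(h m₀)`. -/
noncomputable def scaleSeq (lam : Measure ℝ) (h q : ℝ) : ℕ → ℝ
  | 0 => 1 / (h * mass lam h 0)
  | j + 1 => ((lam.real univ + q) * scaleSeq lam h q j -
      ∑ k : Fin (j + 1), mass lam h (j - k + 1) * scaleSeq lam h q k) / mass lam h 0

lemma scaleSeq_zero (lam : Measure ℝ) (h q : ℝ) :
    scaleSeq lam h q 0 = 1 / (h * mass lam h 0) := by rw [scaleSeq]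

/-- The convolution of the masses with `u`, at `j + 1`. -/
lemma sum_antidiagonal_mass_succ (m u : ℕ → ℝ) (j : ℕ) :
    ∑ x ∈ Finset.HasAntidiagonal.antidiagonal (j + 1), m x.1 * u x.2 =
      m 0 * u (j + 1) + ∑ k ∈ Finset.range (j + 1), m (j - k + 1) * u k := by
  rw [Finset.Nat.sum_antidiagonal_succ, ← Finset.Nat.sum_antidiagonal_swap,
    Finset.Nat.sum_antidiagonal_eq_sum_range_succ_mk]
  rfl

namespace IsSkipFreeMeasure

variable {lam : Measure ℝ} {h : ℝ}

lemma scaleSeq_rec (H : IsSkipFreeMeasure lam h) (q : ℝ) (j : ℕ) :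
    ∑ x ∈ Finset.HasAntidiagonal.antidiagonal (j + 1), mass lam h x.1 * scaleSeq lam h q x.2 =
      (lam.real univ + q) * scaleSeq lam h q j := by
  rw [sum_antidiagonal_mass_succ, scaleSeq, Finset.sum_range, mul_div_cancel₀ _ H.mass_zero_pos.ne']
  ring

lemma scaleSeq_unique (H : IsSkipFreeMeasure lam h) {q : ℝ} {u : ℕ → ℝ}
    (h0 : u 0 = 1 / (h * mass lam h 0))
    (hu : ∀ j, ∑ x ∈ Finset.HasAntidiagonal.antidiagonal (j + 1), mass lam h x.1 * u x.2 =
      (lam.real univ + q) * u j) (j : ℕ) : u j = scaleSeq lam h q j := by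
  induction j using Nat.strong_induction_on with
  | _ j ih =>
    rcases j with _ | j
    · rw [h0, scaleSeq_zero]
    · have h1 := hu j
      have h2 := H.scaleSeq_rec q j
      rw [sum_antidiagonal_mass_succ] at h1 h2
      rw [ih j (Nat.lt_succ_self j), Finset.sum_congr rfl fun k hk => by
        rw [ih k (Finset.mem_range.1 hk)]] at h1
      exact mul_left_cancel₀ H.mass_zero_pos.ne' (by linarith)

lemma sum_mass_le (H : IsSkipFreeMeasure lam h) (j : ℕ) :
    mass lam h 0 + ∑ k ∈ Finset.range (j + 1), mass lam h (j - k + 1) ≤ lam.real univ := by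
  rw [← H.tsum_mass]
  have h1 := H.summable_mass.sum_le_tsum (Finset.range (j + 2)) fun i _ => mass_nonneg lam h i
  rw [Finset.sum_range_succ'] at h1
  have h2 := Finset.sum_range_reflect (fun k => mass lam h (k + 1)) (j + 1)
  simp only [Nat.add_sub_cancel] at h2
  linarith

/-- Subsolutions are monotone. -/
lemma mono_of_subsolution (H : IsSkipFreeMeasure lam h) {q : ℝ} (hq : 0 ≤ q) {u : ℕ → ℝ}
    (h0 : 0 ≤ u 0) (hu : ∀ j, (lam.real univ + q) * u j ≤
      ∑ x ∈ Finset.HasAntidiagonal.antidiagonal (j + 1), mass lam h x.1 * u x.2) :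
    Monotone u ∧ ∀ j, 0 ≤ u j := by
  have key : ∀ j, 0 ≤ u j ∧ ∀ k ≤ j, u k ≤ u j := by
    intro j
    induction j with
    | zero => exact ⟨h0, fun k hk => by rw [Nat.le_zero.1 hk]⟩
    | succ j ih =>
      have h1 := hu j
      rw [sum_antidiagonal_mass_succ] at h1
      have h2 : ∑ k ∈ Finset.range (j + 1), mass lam h (j - k + 1) * u k ≤
          (∑ k ∈ Finset.range (j + 1), mass lam h (j - k + 1)) * u j := by
        rw [Finset.sum_mul]
        refine Finset.sum_le_sum fun k hk => mul_le_mul_of_nonneg_left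
          (ih.2 k (Nat.lt_succ_iff.1 (Finset.mem_range.1 hk))) (mass_nonneg _ _ _)
      have h3 := mul_le_mul_of_nonneg_right (H.sum_mass_le j) ih.1
      -- The terms other than m₀ u_{j+1} total at most (Λ - m₀) u_j, so the subsolution inequality
      -- leaves at least m₀ u_j for m₀ u_{j+1}.
      have h4 : mass lam h 0 * u j ≤ mass lam h 0 * u (j + 1) := by
        nlinarith [mul_nonneg hq ih.1]
      have h5 := le_of_mul_le_mul_left h4 H.mass_zero_pos
      refine ⟨ih.1.trans h5, fun k hk => ?_⟩
      rcases Nat.lt_or_ge k (j + 1) with hlt | hge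
      · exact (ih.2 k (Nat.lt_succ_iff.1 hlt)).trans h5
      · rw [le_antisymm hk hge]
  exact ⟨fun a b hab => (key b).2 a hab, fun j => (key j).1⟩

lemma scaleSeq_zero_pos (H : IsSkipFreeMeasure lam h) (q : ℝ) : 0 < scaleSeq lam h q 0 := by
  rw [scaleSeq_zero]
  exact one_div_pos.2 (mul_pos H.h_pos H.mass_zero_pos)

lemma scaleSeq_mono (H : IsSkipFreeMeasure lam h) {q : ℝ} (hq : 0 ≤ q) :
    Monotone (scaleSeq lam h q) :=
  (H.mono_of_subsolution hq (H.scaleSeq_zero_pos q).le fun j => (H.scaleSeq_rec q j).ge).1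

lemma scaleSeq_pos (H : IsSkipFreeMeasure lam h) {q : ℝ} (hq : 0 ≤ q) (j : ℕ) :
    0 < scaleSeq lam h q j :=
  (H.scaleSeq_zero_pos q).trans_le (H.scaleSeq_mono hq (Nat.zero_le j))

lemma continuous_scaleSeq (lam : Measure ℝ) (h : ℝ) (j : ℕ) :
    Continuous fun q => scaleSeq lam h q j := by
  induction j using Nat.strong_induction_on with
  | _ j ih =>
    rcases j with _ | j
    · simp only [scaleSeq_zero]; exact continuous_const
    · simp only [scaleSeq]
      refine (((continuous_const.add continuous_id).mul (ih j (Nat.lt_succ_self j))).sub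
        (continuous_finsetSum _ fun k _ => continuous_const.mul (ih k.1 k.2))).div_const _

/-- Partial sums of the scale sequence. -/
lemma sum_mass_mul_partialSum (H : IsSkipFreeMeasure lam h) (q : ℝ) (j : ℕ) :
    ∑ x ∈ Finset.HasAntidiagonal.antidiagonal (j + 1),
        mass lam h x.1 * ∑ l ∈ Finset.range x.2, scaleSeq lam h q l =
      1 / h + (lam.real univ + q) * ∑ l ∈ Finset.range j, scaleSeq lam h q l := by
  -- Raising the index by one adds a convolution of the masses with w itself, so the claim is the
  -- recursion summed, started from m₀ w₀ = 1/h.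
  have hstep : ∀ n, ∑ x ∈ Finset.HasAntidiagonal.antidiagonal (n + 1),
        mass lam h x.1 * ∑ l ∈ Finset.range x.2, scaleSeq lam h q l =
      ∑ x ∈ Finset.HasAntidiagonal.antidiagonal n,
        mass lam h x.1 * ∑ l ∈ Finset.range x.2, scaleSeq lam h q l +
      ∑ x ∈ Finset.HasAntidiagonal.antidiagonal n, mass lam h x.1 * scaleSeq lam h q x.2 := by
    intro n
    rw [Finset.Nat.sum_antidiagonal_succ', ← Finset.sum_add_distrib]
    simp only [Finset.range_zero, Finset.sum_empty, mul_zero, zero_add]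
    refine Finset.sum_congr rfl fun x _ => ?_
    rw [Finset.sum_range_succ, mul_add]
  induction j with
  | zero =>
    rw [hstep]
    have := H.mass_zero_pos.ne'
    have := H.h_pos.ne'
    simp [scaleSeq_zero]
    field_simp
  | succ j ih =>
    rw [hstep, ih, H.scaleSeq_rec, Finset.sum_range_succ]
    ring

/-- Exponential growth bound of the scale sequence. -/
lemma scaleSeq_le (H : IsSkipFreeMeasure lam h) {q β : ℝ} (hq : 0 ≤ q) (hβ : 0 < β)
    (hψ : q ≤ psi lam β) (j : ℕ) :
    scaleSeq lam h q j ≤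
      scaleSeq lam h q 0 / (Real.exp (β * h) - 1) * Real.exp (β * h) ^ (j + 1) := by
  set E := Real.exp (β * h) with hE
  have hE0 : 0 < E := Real.exp_pos _
  have hE1 : 1 < E := Real.one_lt_exp_iff.2 (mul_pos hβ H.h_pos)
  set C := scaleSeq lam h q 0 / (E - 1) with hC
  have hC0 : 0 < C := div_pos (H.scaleSeq_zero_pos q) (by linarith)
  have hinv : Real.exp (-β * h) = E⁻¹ := by rw [hE, ← Real.exp_neg]; ring_nf
  have hsum := H.hasSum_mass_pow hβ.le
  rw [hinv] at hsum
  -- Comparison with C(E^{j+1} - 1): the constant C makes the difference vanish at j = 0, and the -1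
  -- makes the exponential vanish at level -1 and be negative below it.
  have hsub := H.mono_of_subsolution hq
    (u := fun j => C * (E ^ (j + 1) - 1) - scaleSeq lam h q j) ?_ ?_
  · have h1 := hsub.2 j
    have h2 : C * (E ^ (j + 1) - 1) ≤ C * E ^ (j + 1) :=
      mul_le_mul_of_nonneg_left (by linarith) hC0.le
    linarith
  · simp only [zero_add, pow_one, hC]
    rw [div_mul_cancel₀ _ (by linarith : E - 1 ≠ 0)]
    simp
  · intro j
    simp only [mul_sub, Finset.sum_sub_distrib, H.scaleSeq_rec]
    have h3 : (lam.real univ + q) * (E ^ (j + 1) - 1) ≤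
        ∑ x ∈ Finset.HasAntidiagonal.antidiagonal (j + 1), mass lam h x.1 * (E ^ (x.2 + 1) - 1) := by
      have e1 : ∑ x ∈ Finset.HasAntidiagonal.antidiagonal (j + 1), mass lam h x.1 * (E ^ (x.2 + 1) - 1) =
          ∑ i ∈ Finset.range (j + 2), mass lam h i * (E ^ (j + 2) * E⁻¹ ^ i - 1) := by
        rw [Finset.Nat.sum_antidiagonal_eq_sum_range_succ_mk]
        refine Finset.sum_congr rfl fun i hi => ?_
        have hi' : i ≤ j + 1 := Nat.lt_succ_iff.1 (Finset.mem_range.1 hi)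
        congr 2
        rw [inv_pow, ← div_eq_mul_inv, eq_div_iff (pow_ne_zero _ hE0.ne'), ← pow_add]
        congr 1
        simp only
        omega
      have e2 : HasSum (fun i => mass lam h i * (E ^ (j + 2) * E⁻¹ ^ i - 1))
          (E ^ (j + 2) * (E⁻¹ * (psi lam β + lam.real univ)) - lam.real univ) := by
        have e3 := (hsum.mul_left (E ^ (j + 2))).sub (H.tsum_mass ▸ H.summable_mass.hasSum)
        refine e3.congr_fun fun i => ?_
        ring
      -- The tail i ≥ j + 2 sits at levels ≤ -1, where the comparison function is ≤ 0; dropping it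
      -- only increases the sum.
      have e4 : E ^ (j + 2) * (E⁻¹ * (psi lam β + lam.real univ)) - lam.real univ ≤
          ∑ i ∈ Finset.range (j + 2), mass lam h i * (E ^ (j + 2) * E⁻¹ ^ i - 1) := by
        rw [← e2.tsum_eq, ← e2.summable.sum_add_tsum_nat_add (j + 2)]
        refine add_le_of_nonpos_right (tsum_nonpos fun i => ?_)
        refine mul_nonpos_of_nonneg_of_nonpos (mass_nonneg _ _ _) ?_
        rw [inv_pow, ← div_eq_mul_inv, sub_nonpos, div_le_one (pow_pos hE0 _)]
        exact pow_le_pow_right₀ hE1.le (by omega)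
      rw [e1]
      refine le_trans ?_ e4
      have e5 : E ^ (j + 2) * (E⁻¹ * (psi lam β + lam.real univ)) =
          E ^ (j + 1) * (psi lam β + lam.real univ) := by
        rw [pow_succ E (j + 1)]
        field_simp
      rw [e5]
      nlinarith [mul_nonneg (pow_pos hE0 (j + 1)).le (sub_nonneg.2 hψ)]
    have h4 : ∑ x ∈ Finset.HasAntidiagonal.antidiagonal (j + 1), mass lam h x.1 * (C * (E ^ (x.2 + 1) - 1)) =
        C * ∑ x ∈ Finset.HasAntidiagonal.antidiagonal (j + 1), mass lam h x.1 * (E ^ (x.2 + 1) - 1) := by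
      rw [Finset.mul_sum]
      exact Finset.sum_congr rfl fun x _ => by ring
    have h5 := mul_le_mul_of_nonneg_left h3 hC0.le
    simp only [mul_sub, Finset.sum_sub_distrib] at h4 h5 ⊢
    linarith

/-- Tilting the Lévy measure. -/
lemma mass_expLevy (lam : Measure ℝ) (h c : ℝ) (i : ℕ) :
    mass (expLevy lam c) h i = Real.exp (c * ((1 - (i : ℝ)) * h)) * mass lam h i :=
  expLevy_real_singleton _ _ _

/-- The tilt multiplies mᵢ by e^{c(1-i)h}. For i + l = j + 1 this combines with e^{ch(l+1)} to a
factor depending on j only, so the rescaled tilted sequence solves the q-recursion with the right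
initial value. -/
lemma scaleSeq_tilt (H : IsSkipFreeMeasure lam h) {q : ℝ} (hq : 0 ≤ q) (j : ℕ) :
    Real.exp (phi lam q * h) ^ (j + 1) * scaleSeq (expLevy lam (phi lam q)) h 0 j =
      scaleSeq lam h q j := by
  set c := phi lam q with hc
  have hc0 : 0 ≤ c := H.phi_nonneg hq
  have H' := H.withDensity_exp hc0
  refine H.scaleSeq_unique (u := fun j => Real.exp (c * h) ^ (j + 1) *
    scaleSeq (expLevy lam c) h 0 j) ?_ (fun j => ?_) j
  · simp only [scaleSeq_zero, mass_expLevy]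
    have := H.mass_zero_pos.ne'
    have := H.h_pos.ne'
    have := (Real.exp_pos (c * h)).ne'
    simp only [zero_add, pow_one, Nat.cast_zero, sub_zero, one_mul]
    field_simp
  · have h1 := H'.scaleSeq_rec 0 j
    rw [H.expLevy_real_univ hc0, H.psi_phi hq] at h1
    have h2 : ∑ x ∈ Finset.HasAntidiagonal.antidiagonal (j + 1), mass lam h x.1 *
        (Real.exp (c * h) ^ (x.2 + 1) * scaleSeq (expLevy lam c) h 0 x.2) =
        Real.exp (c * h) ^ (j + 1) * ∑ x ∈ Finset.HasAntidiagonal.antidiagonal (j + 1),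
          mass (expLevy lam c) h x.1 * scaleSeq (expLevy lam c) h 0 x.2 := by
      rw [Finset.mul_sum]
      refine Finset.sum_congr rfl fun x hx => ?_
      rw [mass_expLevy, ← Real.exp_nat_mul, ← Real.exp_nat_mul]
      have h3 : ((x.2 + 1 : ℕ) : ℝ) * (c * h) =
          ((j + 1 : ℕ) : ℝ) * (c * h) + c * ((1 - (x.1 : ℝ)) * h) := by
        have h4 : ((x.1 + x.2 : ℕ) : ℝ) = ((j + 1 : ℕ) : ℝ) := by
          rw [Finset.HasAntidiagonal.mem_antidiagonal.1 hx]
        push_cast at h4 ⊢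
        linear_combination (c * h) * h4
      rw [h3, Real.exp_add]
      ring
    rw [h2, h1]
    ring

end IsSkipFreeMeasure

end SkipFree

/-! ### Generating functions, asymptotics of the sequences, Laplace transforms of step functions -/

namespace SkipFree

namespace IsSkipFreeMeasure

variable {lam : Measure ℝ} {h : ℝ}

lemma exp_neg_mul_lt_one (H : IsSkipFreeMeasure lam h) {β : ℝ} (hβ : 0 < β) :
    Real.exp (-β * h) < 1 :=
  Real.exp_lt_one_iff.2 (by nlinarith [mul_pos hβ H.h_pos])

/-- The growth bound at some b strictly between Φ(q) and β gives a convergent geometric majorant. -/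
lemma summable_scaleSeq (H : IsSkipFreeMeasure lam h) {q β : ℝ} (hq : 0 ≤ q)
    (hβ : phi lam q < β) : Summable fun j => scaleSeq lam h q j * Real.exp (-β * h) ^ j := by
  obtain ⟨b, hb1, hb2⟩ := exists_between hβ
  have hb0 : 0 < b := (H.phi_nonneg hq).trans_lt hb1
  have hlt : Real.exp (b * h) * Real.exp (-β * h) < 1 := by
    rw [← Real.exp_add]
    exact Real.exp_lt_one_iff.2 (by nlinarith [mul_pos (sub_pos.2 hb2) H.h_pos])
  have hg := (summable_geometric_of_lt_one (by positivity) hlt).mul_left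
    (scaleSeq lam h q 0 / (Real.exp (b * h) - 1) * Real.exp (b * h))
  refine Summable.of_nonneg_of_le
    (fun j => mul_nonneg (H.scaleSeq_pos hq j).le (by positivity)) (fun j => ?_) hg
  refine (mul_le_mul_of_nonneg_right (H.scaleSeq_le hq hb0 (H.lt_psi hq hb1).le j)
    (by positivity)).trans_eq ?_
  rw [mul_pow, pow_succ]
  ring

/-- The generating function of the scale sequence. -/
lemma hasSum_scaleSeq (H : IsSkipFreeMeasure lam h) {q β : ℝ} (hq : 0 ≤ q)
    (hβ : phi lam q < β) :
    HasSum (fun j => scaleSeq lam h q j * Real.exp (-β * h) ^ j)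
      (Real.exp (β * h) / (h * (psi lam β - q))) := by
  have hβ0 : 0 < β := (H.phi_nonneg hq).trans_lt hβ
  have hS := H.summable_scaleSeq hq hβ
  have hM := H.hasSum_mass_pow hβ0.le
  have hinv : Real.exp (-β * h) = (Real.exp (β * h))⁻¹ := by rw [← Real.exp_neg]; ring_nf
  set s := Real.exp (-β * h) with hs
  have hs0 : 0 < s := Real.exp_pos _
  set G := ∑' j, scaleSeq lam h q j * s ^ j with hG
  have hMn : Summable fun i => ‖mass lam h i * s ^ i‖ := hM.summable.norm
  have hC := summable_norm_sum_mul_antidiagonal_of_summable_norm hMn hS.norm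
  have hP := tsum_mul_tsum_eq_tsum_sum_antidiagonal_of_summable_norm hMn hS.norm
  have hterm : ∀ n, ∑ x ∈ Finset.HasAntidiagonal.antidiagonal n,
      mass lam h x.1 * s ^ x.1 * (scaleSeq lam h q x.2 * s ^ x.2) =
      s ^ n * ∑ x ∈ Finset.HasAntidiagonal.antidiagonal n,
        mass lam h x.1 * scaleSeq lam h q x.2 := by
    intro n
    rw [Finset.mul_sum]
    refine Finset.sum_congr rfl fun x hx => ?_
    rw [← Finset.HasAntidiagonal.mem_antidiagonal.1 hx, pow_add]
    ring
  -- In the Cauchy product the recursion governs every coefficient except the zeroth, m₀ w₀ = 1/h.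
  -- Since the masses generate s(ψ(β) + Λ), the Λ terms cancel.
  rw [hM.tsum_eq, (hC.of_norm).tsum_eq_zero_add] at hP
  simp only [hterm, H.scaleSeq_rec] at hP
  have h2 : ∑' j, s ^ (j + 1) * ((lam.real univ + q) * scaleSeq lam h q j) =
      s * (lam.real univ + q) * G := by
    rw [hG, ← tsum_mul_left]
    exact tsum_congr fun j => by ring
  rw [h2] at hP
  simp only [pow_zero, Finset.Nat.antidiagonal_zero, Finset.sum_singleton, one_mul] at hP
  rw [scaleSeq_zero] at hP
  have h3 : s * (psi lam β - q) * G = 1 / h := by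
    have : mass lam h 0 * (1 / (h * mass lam h 0)) = 1 / h := by
      have := H.mass_zero_pos.ne'
      field_simp
    rw [this] at hP
    linarith
  have h4 : G = Real.exp (β * h) / (h * (psi lam β - q)) := by
    have h5 : psi lam β - q ≠ 0 := (sub_pos.2 (H.lt_psi hq hβ)).ne'
    have h6 := H.h_pos.ne'
    have h7 := (Real.exp_pos (β * h)).ne'
    rw [hinv] at h3
    field_simp at h3 ⊢
    linarith
  rw [← h4]
  exact hS.hasSum

/-- The sequence `1 + q h ∑_{i<j} wᵢ`. -/
noncomputable def _root_.SkipFree.scaleSeqZ (lam : Measure ℝ) (h q : ℝ) (j : ℕ) : ℝ :=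
  1 + q * h * ∑ l ∈ Finset.range j, scaleSeq lam h q l

/-- Partial summation multiplies a generating function by 1/(1 - s); the further factor s comes from
summing over l < j rather than l ≤ j. -/
lemma hasSum_scaleSeqZ (H : IsSkipFreeMeasure lam h) {q β : ℝ} (hq : 0 ≤ q)
    (hβ : phi lam q < β) :
    HasSum (fun j => scaleSeqZ lam h q j * Real.exp (-β * h) ^ j)
      ((1 - Real.exp (-β * h))⁻¹ * (1 + q / (psi lam β - q))) := by
  have hβ0 : 0 < β := (H.phi_nonneg hq).trans_lt hβ
  have hS := H.hasSum_scaleSeq hq hβ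
  have hs1 := H.exp_neg_mul_lt_one hβ0
  have hinv : Real.exp (β * h) = (Real.exp (-β * h))⁻¹ := by rw [← Real.exp_neg]; ring_nf
  rw [hinv] at hS
  set s := Real.exp (-β * h) with hs
  have hs0 : 0 < s := Real.exp_pos _
  have hgeo := hasSum_geometric_of_lt_one hs0.le hs1
  have hgn : Summable fun i => ‖s ^ i‖ := hgeo.summable.norm
  have hC := (summable_norm_sum_mul_antidiagonal_of_summable_norm hS.summable.norm hgn).of_norm
  have hP := tsum_mul_tsum_eq_tsum_sum_antidiagonal_of_summable_norm hS.summable.norm hgn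
  have hterm : ∀ n, ∑ x ∈ Finset.HasAntidiagonal.antidiagonal n,
      scaleSeq lam h q x.1 * s ^ x.1 * s ^ x.2 =
      s ^ n * ∑ l ∈ Finset.range (n + 1), scaleSeq lam h q l := by
    intro n
    rw [Finset.Nat.sum_antidiagonal_eq_sum_range_succ_mk, Finset.mul_sum]
    refine Finset.sum_congr rfl fun x hx => ?_
    have : s ^ n = s ^ x * s ^ (n - x) := by
      rw [← pow_add]; congr 1
      have := Finset.mem_range.1 hx
      omega
    rw [this]; ring
  simp only [hterm] at hC hP
  rw [hS.tsum_eq, hgeo.tsum_eq] at hP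
  have h1 : HasSum (fun j => s ^ j * ∑ l ∈ Finset.range j, scaleSeq lam h q l)
      (s * (s⁻¹ / (h * (psi lam β - q)) * (1 - s)⁻¹)) := by
    rw [hP, hasSum_nat_add_iff' (f := fun j => s ^ j * ∑ l ∈ Finset.range j, scaleSeq lam h q l) 1
      |>.symm]
    simp only [Finset.range_one, Finset.sum_singleton, Finset.range_zero, Finset.sum_empty,
      mul_zero, sub_zero]
    refine (hC.hasSum.mul_left s).congr_fun fun j => ?_
    ring
  have h2 := hgeo.add (h1.mul_left (q * h))
  convert h2 using 1
  · ext j; rw [scaleSeqZ]; ring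
  · have h5 : psi lam β - q ≠ 0 := (sub_pos.2 (H.lt_psi hq hβ)).ne'
    have h6 := H.h_pos.ne'
    have h7 : 1 - s ≠ 0 := by linarith
    field_simp

/-- After division by E^{j+1} the sequence is the tilted undiscounted one, which is increasing, and
bounded by the growth estimate at β = Φ(q) itself. It has a positive limit, so its successive ratios
tend to 1. -/
lemma tendsto_scaleSeq_ratio (H : IsSkipFreeMeasure lam h) {q : ℝ} (hq : 0 < q) :
    Tendsto (fun j => scaleSeq lam h q j / scaleSeq lam h q (j + 1)) atTop
      (𝓝 (Real.exp (phi lam q * h))⁻¹) := by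
  set c := phi lam q with hc
  have hc0 : 0 < c := H.phi_pos hq
  set E := Real.exp (c * h) with hE
  have hE0 : 0 < E := Real.exp_pos _
  have hE1 : 1 < E := Real.one_lt_exp_iff.2 (mul_pos hc0 H.h_pos)
  have H' := H.withDensity_exp hc0.le
  have htilt : ∀ j, E ^ (j + 1) * scaleSeq (expLevy lam c) h 0 j = scaleSeq lam h q j :=
    H.scaleSeq_tilt hq.le
  set u := scaleSeq (expLevy lam c) h 0 with hu
  have hmono : Monotone u := H'.scaleSeq_mono le_rfl
  have hpos : ∀ j, 0 < u j := H'.scaleSeq_pos le_rfl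
  have hbdd : BddAbove (range u) := by
    refine ⟨scaleSeq lam h q 0 / (E - 1), ?_⟩
    rintro _ ⟨j, rfl⟩
    have h1 := H.scaleSeq_le hq.le hc0 (H.psi_phi hq.le).ge j
    rw [← htilt j, mul_comm] at h1
    exact le_of_mul_le_mul_right h1 (pow_pos hE0 _)
  have hlim := tendsto_atTop_ciSup hmono hbdd
  have hne : (⨆ j, u j) ≠ 0 := ((hpos 0).trans_le (le_ciSup hbdd 0)).ne'
  have h2 : Tendsto (fun j => u j / u (j + 1)) atTop (𝓝 1) := by
    have := hlim.div (hlim.comp (tendsto_add_atTop_nat 1)) hne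
    rwa [div_self hne] at this
  have h3 := h2.const_mul E⁻¹
  rw [mul_one] at h3
  refine h3.congr fun j => ?_
  rw [← htilt, ← htilt, pow_succ E (j + 1)]
  have := (hpos (j + 1)).ne'
  field_simp

lemma tendsto_scaleSeq_atTop (H : IsSkipFreeMeasure lam h) {q : ℝ} (hq : 0 < q) :
    Tendsto (scaleSeq lam h q) atTop atTop := by
  have hc0 : 0 < phi lam q := H.phi_pos hq
  have hE1 : 1 < Real.exp (phi lam q * h) := Real.one_lt_exp_iff.2 (mul_pos hc0 H.h_pos)
  have H' := H.withDensity_exp hc0.le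
  refine tendsto_atTop_mono (f := fun j => Real.exp (phi lam q * h) ^ (j + 1) *
    scaleSeq (expLevy lam (phi lam q)) h 0 0) (fun j => ?_) ?_
  · rw [← H.scaleSeq_tilt hq.le]
    exact mul_le_mul_of_nonneg_left (H'.scaleSeq_mono le_rfl (Nat.zero_le j)) (by positivity)
  · exact ((tendsto_pow_atTop_atTop_of_one_lt hE1).comp (tendsto_add_atTop_nat 1)).atTop_mul_const
      (H'.scaleSeq_zero_pos 0)

end IsSkipFreeMeasure

/-- If `b_{n+1} = (b_n + 1) a_n` and `a_n → a < 1` then `b_n → a / (1 - a)`. -/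
lemma tendsto_of_affine_recursion {a b : ℕ → ℝ} {A : ℝ} (hA0 : 0 ≤ A) (hA1 : A < 1)
    (ha : Tendsto a atTop (𝓝 A)) (hb : ∀ n, b (n + 1) = (b n + 1) * a n) :
    Tendsto b atTop (𝓝 (A / (1 - A))) := by
  set B := A / (1 - A) with hB
  have hBA : (B + 1) * A = B := by
    have : 1 - A ≠ 0 := by linarith
    rw [hB]; field_simp; ring
  obtain ⟨r, hr1, hr2⟩ := exists_between hA1
  have hr0 : 0 ≤ r := hA0.trans hr1.le
  have hev : ∀ᶠ n in atTop, |a n| ≤ r := by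
    have : Tendsto (fun n => |a n|) atTop (𝓝 |A|) := ha.abs
    rw [abs_of_nonneg hA0] at this
    exact (this.eventually (gt_mem_nhds hr1)).mono fun n hn => hn.le
  -- B is the fixed point of b ↦ (b + 1)A, so the error is multiplied by a_n, eventually at most r <
  -- 1, up to a vanishing forcing term. Forcing below (ε/2)(1 - r) accumulates to at most ε/2.
  have hd : ∀ n, b (n + 1) - B = (b n - B) * a n + (B + 1) * (a n - A) := fun n => by
    rw [hb]; linear_combination hBA
  rw [Metric.tendsto_atTop]
  intro ε hε
  have hε' : 0 < ε / 2 * (1 - r) := by have : 0 < 1 - r := by linarith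
                                       positivity
  have hsmall : ∀ᶠ n in atTop, |(B + 1) * (a n - A)| < ε / 2 * (1 - r) := by
    have : Tendsto (fun n => |(B + 1) * (a n - A)|) atTop (𝓝 |(B + 1) * (A - A)|) :=
      ((ha.sub_const A).const_mul _).abs
    rw [sub_self, mul_zero, abs_zero] at this
    exact this.eventually (gt_mem_nhds hε')
  obtain ⟨N, hN⟩ := eventually_atTop.1 (hev.and hsmall)
  have key : ∀ k, |b (N + k) - B| ≤ r ^ k * |b N - B| + ε / 2 := by
    intro k
    induction k with
    | zero => simp; linarith
    | succ k ih =>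
      obtain ⟨h1, h2⟩ := hN (N + k) (by omega)
      rw [← add_assoc, hd]
      refine (abs_add_le _ _).trans ?_
      rw [abs_mul]
      have h3 : |b (N + k) - B| * |a (N + k)| ≤ (r ^ k * |b N - B| + ε / 2) * r :=
        mul_le_mul ih h1 (abs_nonneg _) (by positivity)
      rw [pow_succ]
      nlinarith
  have hlim : Tendsto (fun k => r ^ k * |b N - B|) atTop (𝓝 0) := by
    simpa using (tendsto_pow_atTop_nhds_zero_of_lt_one hr0 hr2).mul_const (|b N - B|)
  obtain ⟨K, hK⟩ := eventually_atTop.1 (hlim.eventually (gt_mem_nhds (half_pos hε)))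
  refine ⟨N + K, fun n hn => ?_⟩
  obtain ⟨k, rfl⟩ := Nat.exists_eq_add_of_le (show N ≤ n by omega)
  rw [Real.dist_eq]
  have := hK k (by omega)
  have := key k
  linarith

/-- The ratios b_n = (∑_{l<n} w_l)/w_n satisfy b_{n+1} = (b_n + 1) w_n/w_{n+1}, hence tend to 1/(E -
1); the leading 1 of Z disappears because w_n → ∞. -/
lemma IsSkipFreeMeasure.tendsto_scaleSeqZ_ratio {lam : Measure ℝ} {h : ℝ}
    (H : IsSkipFreeMeasure lam h) {q : ℝ} (hq : 0 < q) :
    Tendsto (fun j => scaleSeqZ lam h q j / scaleSeq lam h q j) atTop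
      (𝓝 (q * h / (Real.exp (phi lam q * h) - 1))) := by
  have hc0 : 0 < phi lam q := H.phi_pos hq
  set E := Real.exp (phi lam q * h) with hE
  have hE0 : 0 < E := Real.exp_pos _
  have hE1 : 1 < E := Real.one_lt_exp_iff.2 (mul_pos hc0 H.h_pos)
  have h1 := tendsto_of_affine_recursion
    (b := fun n => (∑ l ∈ Finset.range n, scaleSeq lam h q l) / scaleSeq lam h q n)
    (inv_nonneg.2 hE0.le) (inv_lt_one_of_one_lt₀ hE1) (H.tendsto_scaleSeq_ratio hq) (fun n => by
      have := (H.scaleSeq_pos hq.le n).ne'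
      have := (H.scaleSeq_pos hq.le (n + 1)).ne'
      rw [Finset.sum_range_succ]
      field_simp)
  have h2 := ((H.tendsto_scaleSeq_atTop hq).inv_tendsto_atTop).add (h1.const_mul (q * h))
  have h3 : 0 + q * h * (E⁻¹ / (1 - E⁻¹)) = q * h / (E - 1) := by
    have : E - 1 ≠ 0 := by linarith
    have h4 : 1 - E⁻¹ = (E - 1) / E := by field_simp
    rw [h4]; field_simp; ring
  rw [h3] at h2
  refine h2.congr fun j => ?_
  rw [scaleSeqZ, Pi.inv_apply]
  ring

lemma integral_exp_neg_mul_interval {β : ℝ} (hβ : β ≠ 0) (a b : ℝ) :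
    ∫ x in a..b, Real.exp (-β * x) = (Real.exp (-β * a) - Real.exp (-β * b)) / β := by
  have := intervalIntegral.integral_comp_mul_left (fun x => Real.exp x) (neg_ne_zero.2 hβ)
    (a := a) (b := b)
  rw [this, integral_exp, smul_eq_mul]
  field_simp
  ring

/-- The Laplace transform of a step function. -/
lemma hasLaplace_step {h β S : ℝ} (hh : 0 < h) (hβ : 0 < β) {f : ℝ → ℝ} {u : ℕ → ℝ}
    (hf : ∀ j : ℕ, ∀ x ∈ Ico ((j : ℝ) * h) ((j + 1 : ℝ) * h), f x = u j)
    (hu0 : ∀ j, 0 ≤ u j) (hu : HasSum (fun j => u j * Real.exp (-β * h) ^ j) S) :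
    HasLaplace f β ((1 - Real.exp (-β * h)) / β * S) := by
  set s := fun j : ℕ => Ico ((j : ℝ) * h) ((j + 1 : ℝ) * h) with hs
  have hunion : ⋃ j, s j = Ici 0 := by
    ext x
    simp only [hs, mem_iUnion, mem_Ico, mem_Ici]
    constructor
    · rintro ⟨j, hj, -⟩
      exact (mul_nonneg (Nat.cast_nonneg j) hh.le).trans hj
    · intro hx
      refine ⟨⌊x / h⌋₊, ?_, ?_⟩
      · exact (le_div_iff₀ hh).1 (Nat.floor_le (div_nonneg hx hh.le))
      · exact (div_lt_iff₀ hh).1 (Nat.lt_floor_add_one _)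
  have hdisj : Pairwise (Function.onFun Disjoint s) := by
    have hmono : Monotone fun j : ℕ => (j : ℝ) * h := fun a b hab =>
      mul_le_mul_of_nonneg_right (Nat.cast_le.2 hab) hh.le
    have := hmono.pairwise_disjoint_on_Ico_succ
    simpa [hs, Function.onFun, Order.succ_eq_add_one] using this
  have hle : ∀ j : ℕ, (j : ℝ) * h ≤ (j + 1 : ℝ) * h := fun j => by nlinarith
  have hint : ∀ j, IntegrableOn (fun x => Real.exp (-β * x) * f x) (s j) := fun j =>
    IntegrableOn.congr_fun ((Continuous.integrableOn_Icc (by fun_prop :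
      Continuous fun x => Real.exp (-β * x) * u j)).mono_set Ico_subset_Icc_self)
      (fun x hx => by simp only [hf j x hx]) measurableSet_Ico
  have hval : ∀ j, ∫ x in s j, Real.exp (-β * x) * f x =
      (1 - Real.exp (-β * h)) / β * (u j * Real.exp (-β * h) ^ j) := by
    intro j
    rw [setIntegral_congr_fun measurableSet_Ico (g := fun x => Real.exp (-β * x) * u j)
      (fun x hx => by simp only [hf j x hx]), integral_mul_const, integral_Ico_eq_integral_Ioc,
      ← intervalIntegral.integral_of_le (hle j),
      integral_exp_neg_mul_interval hβ.ne', ← Real.exp_nat_mul]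
    rw [show -β * ((j + 1 : ℝ) * h) = -β * h + j * (-β * h) by ring, Real.exp_add,
      show -β * ((j : ℝ) * h) = j * (-β * h) by ring]
    field_simp
  have hnorm : ∀ j, ∫ x in s j, ‖Real.exp (-β * x) * f x‖ = ∫ x in s j, Real.exp (-β * x) * f x :=
    fun j => setIntegral_congr_fun measurableSet_Ico fun x hx => by
      simp only [hf j x hx]
      rw [Real.norm_eq_abs, abs_of_nonneg (mul_nonneg (Real.exp_pos _).le (hu0 j))]
  have hI : IntegrableOn (fun x => Real.exp (-β * x) * f x) (⋃ j, s j) := by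
    refine integrableOn_iUnion_of_summable_integral_norm hint ?_
    simp only [hnorm, hval]
    exact hu.summable.mul_left _
  have hsum := hasSum_integral_iUnion (s := s) (fun j => measurableSet_Ico) hdisj hI
  simp only [hval] at hsum
  rw [hunion] at hI hsum
  refine ⟨hI.mono_set Ioi_subset_Ici_self, ?_⟩
  rw [← integral_Ici_eq_integral_Ioi]
  exact hsum.unique (hu.mul_left _)

end SkipFree

/-! ### Compound Poisson laws: characteristic function, tilting, short-time expansion -/

namespace SkipFree

/-- Convolution powers of a measure. -/
noncomputable def convPow (lam : Measure ℝ) : ℕ → Measure ℝ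
  | 0 => Measure.dirac 0
  | n + 1 => lam ∗ convPow lam n

/-- The weights of the Poisson law with parameter `a t`, without the factor `a ^ n`. -/
noncomputable def cpWeight (a : ℝ) (t : ℝ≥0) (n : ℕ) : ℝ :=
  Real.exp (-a * t) * ((t : ℝ) ^ n / n.factorial)

/-- The compound Poisson law at time `t` with Lévy measure `lam`. -/
noncomputable def cpLaw (lam : Measure ℝ) (t : ℝ≥0) : Measure ℝ :=
  Measure.sum fun n => ENNReal.ofReal (cpWeight (lam.real univ) t n) • convPow lam n

lemma cpWeight_nonneg (a : ℝ) (t : ℝ≥0) (n : ℕ) : 0 ≤ cpWeight a t n := by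
  unfold cpWeight; positivity

instance (lam : Measure ℝ) [IsFiniteMeasure lam] (n : ℕ) : IsFiniteMeasure (convPow lam n) := by
  induction n with
  | zero => rw [convPow]; infer_instance
  | succ n ih => rw [convPow]; infer_instance

lemma convPow_univ (lam : Measure ℝ) [IsFiniteMeasure lam] (n : ℕ) :
    convPow lam n univ = lam univ ^ n := by
  induction n with
  | zero => simp [convPow]
  | succ n ih =>
    rw [convPow, Measure.conv, Measure.map_apply (by fun_prop) MeasurableSet.univ, preimage_univ,
      ← univ_prod_univ, Measure.prod_prod, ih, pow_succ']

lemma convPow_real_univ (lam : Measure ℝ) [IsFiniteMeasure lam] (n : ℕ) :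
    (convPow lam n).real univ = lam.real univ ^ n := by
  rw [measureReal_def, convPow_univ, ENNReal.toReal_pow, measureReal_def]

lemma hasSum_cpWeight (a : ℝ) (t : ℝ≥0) : HasSum (fun n => cpWeight a t n * a ^ n) 1 := by
  have h1 := (NormedSpace.expSeries_div_hasSum_exp (a * (t : ℝ))).mul_left (Real.exp (-a * t))
  rw [← Real.exp_eq_exp_ℝ, ← Real.exp_add, show -a * (t : ℝ) + a * t = 0 by ring,
    Real.exp_zero] at h1
  refine h1.congr_fun fun n => ?_
  rw [cpWeight, mul_pow]
  ring

instance isProbabilityMeasure_cpLaw (lam : Measure ℝ) [IsFiniteMeasure lam] (t : ℝ≥0) :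
    IsProbabilityMeasure (cpLaw lam t) := by
  refine ⟨?_⟩
  rw [cpLaw, Measure.sum_apply _ MeasurableSet.univ]
  simp only [Measure.smul_apply, smul_eq_mul, convPow_univ]
  have h1 : ∀ n, ENNReal.ofReal (cpWeight (lam.real univ) t n) * lam univ ^ n =
      ENNReal.ofReal (cpWeight (lam.real univ) t n * lam.real univ ^ n) := fun n => by
    rw [ENNReal.ofReal_mul (cpWeight_nonneg _ _ _), ENNReal.ofReal_pow measureReal_nonneg,
      ofReal_measureReal]
  simp only [h1]
  have h2 := hasSum_cpWeight (lam.real univ) t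
  rw [← ENNReal.ofReal_tsum_of_nonneg
    (fun n => mul_nonneg (cpWeight_nonneg _ _ _) (pow_nonneg measureReal_nonneg _)) h2.summable,
    h2.tsum_eq, ENNReal.ofReal_one]

lemma integrable_exp_I (μ : Measure ℝ) [IsFiniteMeasure μ] (p : ℝ) :
    Integrable (fun x : ℝ => Complex.exp (p * x * Complex.I)) μ := by
  refine Integrable.of_bound (Continuous.aestronglyMeasurable (by fun_prop)) 1
    (ae_of_all _ fun x => ?_)
  rw [← Complex.ofReal_mul, Complex.norm_exp_ofReal_mul_I]

lemma charFun_convPow (lam : Measure ℝ) [IsFiniteMeasure lam] (n : ℕ) (p : ℝ) :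
    charFun (convPow lam n) p = charFun lam p ^ n := by
  induction n with
  | zero => simp [convPow]
  | succ n ih => rw [convPow, charFun_conv, ih, pow_succ']

/-- Convolution powers turn into powers of `charFun lam p`, and the Poisson weights sum them to an
exponential. This identifies the one-dimensional laws of X. -/
lemma charFun_cpLaw (lam : Measure ℝ) [IsFiniteMeasure lam] (t : ℝ≥0) (p : ℝ) :
    charFun (cpLaw lam t) p =
      Complex.exp ((t : ℝ) * ∫ x, (Complex.exp (Complex.I * p * x) - 1) ∂lam) := by
  have h1 : HasSum (fun n => (cpWeight (lam.real univ) t n : ℂ) * charFun lam p ^ n)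
      (charFun (cpLaw lam t) p) := by
    have := hasSum_integral_measure (integrable_exp_I (cpLaw lam t) p)
    rw [← cpLaw, ← charFun_apply_real] at this
    refine this.congr_fun fun n => ?_
    rw [integral_smul_measure, ← charFun_apply_real, charFun_convPow,
      ENNReal.toReal_ofReal (cpWeight_nonneg _ _ _), Complex.real_smul]
  have h2 := (NormedSpace.expSeries_div_hasSum_exp ((t : ℂ) * charFun lam p)).mul_left
    (Complex.exp (-(lam.real univ) * t))
  rw [← Complex.exp_eq_exp_ℂ, ← Complex.exp_add] at h2
  have h3 : ∫ x, (Complex.exp (Complex.I * p * x) - 1) ∂lam =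
      charFun lam p - (lam.real univ : ℂ) := by
    have e : ∀ x : ℝ, Complex.exp (Complex.I * p * x) = Complex.exp (p * x * Complex.I) :=
      fun x => by congr 1; ring
    simp only [e]
    rw [integral_sub (integrable_exp_I lam p) (integrable_const _), ← charFun_apply_real]
    simp
  rw [h3]
  have h4 := h1.unique (h2.congr_fun fun n => ?_)
  · rw [h4]; congr 1
    ring
  · rw [cpWeight, mul_pow]
    push_cast
    ring

/-- Tilting a compound Poisson law. -/
lemma lintegral_convPow_exp (lam : Measure ℝ) [IsFiniteMeasure lam] (c : ℝ)
    [IsFiniteMeasure (expLevy lam c)] (n : ℕ) {g : ℝ → ℝ≥0∞} (hg : Measurable g) :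
    ∫⁻ x, g x * ENNReal.ofReal (Real.exp (c * x)) ∂convPow lam n =
      ∫⁻ x, g x ∂convPow (expLevy lam c) n := by
  induction n generalizing g with
  | zero =>
    rw [convPow, convPow, lintegral_dirac' _ (by fun_prop), lintegral_dirac' _ hg]
    simp
  | succ n ih =>
    have hmeas : Measurable fun x => ∫⁻ y, g (x + y) ∂convPow (expLevy lam c) n :=
      Measurable.lintegral_prod_right' (f := fun p : ℝ × ℝ => g (p.1 + p.2)) (by fun_prop)
    have hdens := lintegral_withDensity_eq_lintegral_mul lam
      (f := fun x => ENNReal.ofReal (Real.exp (c * x))) (by fun_prop) hmeas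
    rw [← expLevy] at hdens
    rw [convPow, convPow, Measure.lintegral_conv (by fun_prop), Measure.lintegral_conv hg, hdens]
    refine lintegral_congr fun x => ?_
    rw [Pi.mul_apply, ← ih (by fun_prop), ← lintegral_const_mul _ (by fun_prop)]
    refine lintegral_congr fun y => ?_
    rw [mul_add, Real.exp_add, ENNReal.ofReal_mul (Real.exp_pos _).le]
    ring

/-- The tilt acts on each convolution power separately, and the factor e^{-ψ(c)t} turns the weights
with total mass Λ into those with total mass Λ + ψ(c). -/
lemma IsSkipFreeMeasure.lintegral_cpLaw_exp {lam : Measure ℝ} {h : ℝ}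
    (H : IsSkipFreeMeasure lam h) {c : ℝ} (hc : 0 ≤ c) (t : ℝ≥0) {g : ℝ → ℝ≥0∞}
    (hg : Measurable g) :
    ∫⁻ x, g x * ENNReal.ofReal (Real.exp (c * x - psi lam c * t)) ∂cpLaw lam t =
      ∫⁻ x, g x ∂cpLaw (expLevy lam c) t := by
  have := H.finite
  have := (H.withDensity_exp hc).finite
  rw [cpLaw, cpLaw, lintegral_sum_measure, lintegral_sum_measure]
  refine tsum_congr fun n => ?_
  rw [lintegral_smul_measure, lintegral_smul_measure, ← lintegral_convPow_exp lam c n hg]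
  have h1 : ∀ x, g x * ENNReal.ofReal (Real.exp (c * x - psi lam c * t)) =
      ENNReal.ofReal (Real.exp (-psi lam c * t)) *
        (g x * ENNReal.ofReal (Real.exp (c * x))) := fun x => by
    rw [sub_eq_add_neg, Real.exp_add, ENNReal.ofReal_mul (Real.exp_pos _).le, neg_mul]
    ring
  simp only [h1]
  rw [lintegral_const_mul _ (by fun_prop), smul_eq_mul, smul_eq_mul, ← mul_assoc,
    ← ENNReal.ofReal_mul (cpWeight_nonneg _ _ _), H.expLevy_real_univ hc]
  congr 2
  rw [cpWeight, cpWeight, show -(psi lam c + lam.real univ) * (t : ℝ) =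
    -lam.real univ * t + -psi lam c * t by ring, Real.exp_add]
  ring

/-- The lattice `hℤ`. -/
def lattice (h : ℝ) : Set ℝ := {x | ∃ k : ℤ, x = k * h}

lemma countable_lattice (h : ℝ) : (lattice h).Countable := by
  have : lattice h = range fun k : ℤ => (k : ℝ) * h := by
    ext x; simp [lattice, eq_comm]
  rw [this]; exact countable_range _

lemma measurableSet_lattice (h : ℝ) : MeasurableSet (lattice h) :=
  (countable_lattice h).measurableSet

lemma add_mem_lattice {h x y : ℝ} (hx : x ∈ lattice h) (hy : y ∈ lattice h) :
    x + y ∈ lattice h := by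
  obtain ⟨k, rfl⟩ := hx
  obtain ⟨l, rfl⟩ := hy
  exact ⟨k + l, by push_cast; ring⟩

lemma IsSkipFreeMeasure.ae_mem_lattice {lam : Measure ℝ} {h : ℝ} (H : IsSkipFreeMeasure lam h) :
    ∀ᵐ x ∂lam, x ∈ lattice h := by
  filter_upwards [H.ae_mem] with x hx
  obtain ⟨i, rfl⟩ := hx
  exact ⟨1 - i, by push_cast; ring⟩

lemma IsSkipFreeMeasure.cpLaw_ae_mem_lattice {lam : Measure ℝ} {h : ℝ}
    (H : IsSkipFreeMeasure lam h) (t : ℝ≥0) : ∀ᵐ x ∂cpLaw lam t, x ∈ lattice h := by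
  have := H.finite
  have key : ∀ n, ∀ᵐ x ∂convPow lam n, x ∈ lattice h := by
    intro n
    induction n with
    | zero =>
      rw [convPow]
      refine (ae_dirac_iff (p := (· ∈ lattice h)) (measurableSet_lattice h)).2 ?_
      exact ⟨0, by simp⟩
    | succ n ih =>
      rw [convPow, Measure.conv]
      refine (ae_map_iff (p := (· ∈ lattice h)) (by fun_prop) (measurableSet_lattice h)).2 ?_
      refine (Measure.ae_prod_iff_ae_ae ?_).2 ?_
      · exact (measurableSet_lattice h).preimage (by fun_prop)
      · filter_upwards [H.ae_mem_lattice] with x hx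
        filter_upwards [ih] with y hy
        exact add_mem_lattice hx hy
  rw [cpLaw]
  refine Measure.ae_sum_iff.2 fun n => (Measure.smul_absolutelyContinuous).ae_le (key n)

lemma norm_integral_le_mul {μ : Measure ℝ} [IsFiniteMeasure μ] {f : ℝ → ℝ} {M : ℝ}
    (hf : ∀ x, |f x| ≤ M) : |∫ x, f x ∂μ| ≤ M * μ.real univ :=
  (Real.norm_eq_abs _).ge.trans
    (norm_integral_le_of_norm_le_const (ae_of_all _ fun x => (Real.norm_eq_abs _).le.trans (hf x)))

lemma one_sub_add_mul_exp_neg_le (a : ℝ) (ha : 0 ≤ a) : 1 - (1 + a) * Real.exp (-a) ≤ a ^ 2 := by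
  have := Real.add_one_le_exp (-a)
  nlinarith

/-- The generator of the compound Poisson semigroup, as a second order short time estimate. -/
lemma abs_integral_cpLaw_sub_le (lam : Measure ℝ) [IsFiniteMeasure lam] (t : ℝ≥0) {f : ℝ → ℝ}
    {M : ℝ} (hf : Measurable f) (hM : ∀ x, |f x| ≤ M) (x : ℝ) :
    |∫ y, f (x + y) ∂cpLaw lam t -
        (f x + t * (∫ y, f (x + y) ∂lam - lam.real univ * f x))| ≤
      3 * M * lam.real univ ^ 2 * (t : ℝ) ^ 2 := by
  set Λ := lam.real univ with hΛ
  have hΛ0 : 0 ≤ Λ := measureReal_nonneg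
  have hM0 : 0 ≤ M := (abs_nonneg _).trans (hM 0)
  set c := fun n => ∫ y, f (x + y) ∂convPow lam n with hc
  have hcle : ∀ n, |c n| ≤ M * Λ ^ n := fun n => by
    have := norm_integral_le_mul (μ := convPow lam n) (f := fun y => f (x + y)) fun y => hM _
    rwa [convPow_real_univ] at this
  have hi : ∀ (μ : Measure ℝ) [IsFiniteMeasure μ], Integrable (fun y => f (x + y)) μ :=
    fun μ _ => Integrable.of_bound (hf.comp (measurable_const_add x)).aestronglyMeasurable M
      (ae_of_all _ fun y => hM _)
  have h0 : c 0 = f x := by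
    simp only [hc, convPow]
    rw [integral_dirac]; simp
  have h1 : c 1 = ∫ y, f (x + y) ∂lam := by
    simp only [hc, convPow, Measure.conv_dirac_zero]
  have hsum : HasSum (fun n => cpWeight Λ t n * c n) (∫ y, f (x + y) ∂cpLaw lam t) := by
    have := hasSum_integral_measure (hi (cpLaw lam t))
    rw [← cpLaw] at this
    refine this.congr_fun fun n => ?_
    rw [integral_smul_measure, ENNReal.toReal_ofReal (cpWeight_nonneg _ _ _), smul_eq_mul]
  set a := Λ * (t : ℝ) with ha
  have ha0 : 0 ≤ a := mul_nonneg hΛ0 (NNReal.coe_nonneg t)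
  have hw := hasSum_cpWeight Λ t
  have hw0 : cpWeight Λ t 0 = Real.exp (-a) := by simp [cpWeight, ha]
  have hw1 : cpWeight Λ t 1 = Real.exp (-a) * t := by simp [cpWeight, ha]
  -- To first order in t only zero or one jump matters; two or more jumps have probability at most
  -- a², a = Λt.
  have htail := (hasSum_nat_add_iff' 2).2 hsum
  have hwtail := (hasSum_nat_add_iff' 2).2 hw
  simp only [Finset.sum_range_succ, Finset.sum_range_zero, zero_add, hw0, hw1, h0, h1, pow_zero,
    pow_one, mul_one] at htail hwtail
  have hR : |∫ y, f (x + y) ∂cpLaw lam t -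
      (Real.exp (-a) * f x + Real.exp (-a) * t * ∫ y, f (x + y) ∂lam)| ≤
      M * (1 - (Real.exp (-a) + Real.exp (-a) * t * Λ)) := by
    have h2 := (hwtail.mul_left M)
    rw [← htail.tsum_eq]
    rw [← Real.norm_eq_abs]
    refine tsum_of_norm_bounded h2 fun n => ?_
    rw [Real.norm_eq_abs, abs_mul, abs_of_nonneg (cpWeight_nonneg _ _ _)]
    have := mul_le_mul_of_nonneg_left (hcle (n + 2)) (cpWeight_nonneg Λ t (n + 2))
    linarith
  have hE1 : Real.exp (-a) ≤ 1 := Real.exp_le_one_iff.2 (by linarith)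
  have hE2 := Real.add_one_le_exp (-a)
  have hE3 : Real.exp (-a) - 1 + a ≤ a ^ 2 := by
    have h3 : Real.exp (-a) * (1 + a) ≤ 1 := by
      have := Real.add_one_le_exp a
      have h4 : Real.exp (-a) * Real.exp a = 1 := by rw [← Real.exp_add]; simp
      nlinarith [Real.exp_pos (-a)]
    nlinarith [Real.exp_pos (-a)]
  have hR' : M * (1 - (Real.exp (-a) + Real.exp (-a) * t * Λ)) ≤ M * a ^ 2 := by
    refine mul_le_mul_of_nonneg_left ?_ hM0
    have := one_sub_add_mul_exp_neg_le a ha0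
    have : Real.exp (-a) + Real.exp (-a) * t * Λ = (1 + a) * Real.exp (-a) := by rw [ha]; ring
    linarith
  have hA : |f x * (Real.exp (-a) - 1 + a)| ≤ M * a ^ 2 := by
    rw [abs_mul, abs_of_nonneg (by linarith : 0 ≤ Real.exp (-a) - 1 + a)]
    exact mul_le_mul (hM x) hE3 (by linarith) hM0
  have hB : |(t : ℝ) * (∫ y, f (x + y) ∂lam) * (Real.exp (-a) - 1)| ≤ M * a ^ 2 := by
    rw [abs_mul, abs_mul, abs_of_nonneg (NNReal.coe_nonneg t), abs_of_nonpos (by linarith : Real.exp (-a) - 1 ≤ 0)]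
    have h5 : |∫ y, f (x + y) ∂lam| ≤ M * Λ := norm_integral_le_mul fun y => hM _
    have h6 : (t : ℝ) * |∫ y, f (x + y) ∂lam| ≤ M * a := by
      have := mul_le_mul_of_nonneg_left h5 (NNReal.coe_nonneg t)
      rw [ha]; linarith
    calc _ ≤ M * a * a := mul_le_mul h6 (by linarith) (by linarith) (mul_nonneg hM0 ha0)
      _ = M * a ^ 2 := by ring
  -- Three errors of size at most M a² each: the tail, and the expansions of e^{-a} in the no-jump
  -- and one-jump terms.
  have hfin : ∫ y, f (x + y) ∂cpLaw lam t - (f x + t * (∫ y, f (x + y) ∂lam - Λ * f x)) =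
      (∫ y, f (x + y) ∂cpLaw lam t -
        (Real.exp (-a) * f x + Real.exp (-a) * t * ∫ y, f (x + y) ∂lam)) +
      f x * (Real.exp (-a) - 1 + a) +
      (t : ℝ) * (∫ y, f (x + y) ∂lam) * (Real.exp (-a) - 1) := by
    rw [ha]; ring
  rw [hfin]
  refine ((abs_add_le _ _).trans (add_le_add (abs_add_le _ _) le_rfl)).trans ?_
  have : 3 * M * Λ ^ 2 * (t : ℝ) ^ 2 = M * a ^ 2 + M * a ^ 2 + M * a ^ 2 := by rw [ha]; ring
  rw [this]
  exact add_le_add (add_le_add (hR.trans hR') hA) hB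

/-- One discounted step from a point where `L f = q f`. -/
lemma abs_discounted_step_le (lam : Measure ℝ) [IsFiniteMeasure lam] (t : ℝ≥0) {f : ℝ → ℝ}
    {M q : ℝ} (hq : 0 ≤ q) (hf : Measurable f) (hM : ∀ x, |f x| ≤ M) {x : ℝ}
    (hx : ∫ y, f (x + y) ∂lam = (lam.real univ + q) * f x) :
    |Real.exp (-q * t) * ∫ y, f (x + y) ∂cpLaw lam t - f x| ≤
      M * (3 * lam.real univ ^ 2 + q ^ 2) * (t : ℝ) ^ 2 := by
  have h1 := abs_integral_cpLaw_sub_le lam t hf hM x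
  have ha0 : 0 ≤ q * (t : ℝ) := mul_nonneg hq (NNReal.coe_nonneg t)
  have hE1 : Real.exp (-q * t) ≤ 1 := Real.exp_le_one_iff.2 (by linarith)
  have hE3 : Real.exp (-q * t) * (1 + q * t) ≤ 1 := by
    have := Real.add_one_le_exp (q * t)
    have h4 : Real.exp (-q * t) * Real.exp (q * t) = 1 := by rw [← Real.exp_add]; simp
    nlinarith [Real.exp_pos (-q * t)]
  have h2 := one_sub_add_mul_exp_neg_le _ ha0
  rw [← neg_mul] at h2
  have hM0 : 0 ≤ M := (abs_nonneg _).trans (hM 0)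
  set E := Real.exp (-q * t) with hE
  have hE0 : 0 < E := Real.exp_pos _
  rw [hx] at h1
  set J := ∫ y, f (x + y) ∂cpLaw lam t
  -- By L f = q f at x the first-order value is f(x)(1 + qt), and discounting leaves f(x) up to
  -- order (qt)².
  have e : E * J - f x =
      E * (J - (f x + t * ((lam.real univ + q) * f x - lam.real univ * f x))) +
        f x * (E * (1 + q * t) - 1) := by ring
  rw [e]
  refine (abs_add_le _ _).trans ?_
  rw [abs_mul, abs_mul, abs_of_pos hE0, abs_of_nonpos (by linarith : E * (1 + q * t) - 1 ≤ 0)]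
  have h3 := mul_le_mul hE1 h1 (abs_nonneg _) zero_le_one
  have h4 : |f x| * -(E * (1 + q * t) - 1) ≤ M * (q * t) ^ 2 :=
    mul_le_mul (hM x) (by linarith) (by linarith) hM0
  linarith [h3, h4, mul_pow q (t : ℝ) 2]

end SkipFree

/-! ### Chains on path space, exit functionals and Dynkin's formula -/

namespace SkipFree

lemma measurable_eval (t : ℝ≥0) : Measurable fun ω : Path => ω.1 t :=
  (measurable_pi_apply t).comp measurable_subtype_coe

lemma pathSigma_le (t : ℝ≥0) : pathSigma t ≤ (inferInstance : MeasurableSpace Path) :=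
  iSup₂_le fun s _ => (measurable_eval s).comap_le

lemma pathSigma_mono {s t : ℝ≥0} (hst : s ≤ t) : pathSigma s ≤ pathSigma t :=
  iSup₂_le fun r hr => le_iSup₂_of_le r (hr.trans hst) le_rfl

lemma measurable_eval_pathSigma {s t : ℝ≥0} (hst : s ≤ t) :
    Measurable[pathSigma t] fun ω : Path => ω.1 s :=
  Measurable.of_comap_le (le_iSup₂_of_le (f := fun (r : ℝ≥0) (_ : r ≤ t) =>
    MeasurableSpace.comap (fun ω : Path => ω.1 r) inferInstance) s hst le_rfl)

/-- The coordinate process under `ν` starts at `0` and has stationary independent increments with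
compound Poisson laws. -/
structure IsChain (lam : Measure ℝ) (ν : Measure Path) : Prop where
  prob : IsProbabilityMeasure ν
  zero : ∀ᵐ ω ∂ν, ω.1 0 = 0
  incr : ∀ (s t : ℝ≥0) (A : Set Path), MeasurableSet[pathSigma s] A → ∀ B : Set ℝ,
    MeasurableSet B → ν (A ∩ {ω | ω.1 (s + t) - ω.1 s ∈ B}) = ν A * cpLaw lam t B

/-- Lattice valued paths started at `0`. -/
def IsGood (h : ℝ) (ω : ℝ≥0 → ℝ) : Prop := IsCadlag ω ∧ ω 0 = 0 ∧ ∀ t, ω t ∈ lattice h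

lemma isClosed_lattice {h : ℝ} (hh : 0 < h) : IsClosed (lattice h) := by
  have : lattice h = (fun x : ℝ => x / h) ⁻¹' range ((↑) : ℤ → ℝ) := by
    ext x
    simp only [lattice, mem_ofPred_eq, mem_preimage, mem_range]
    exact ⟨fun ⟨k, hk⟩ => ⟨k, by rw [hk]; field_simp⟩, fun ⟨k, hk⟩ => ⟨k, by rw [hk]; field_simp⟩⟩
  rw [this]
  exact Int.isClosedEmbedding_coe_real.isClosed_range.preimage (by fun_prop)

/-- By right-continuity ω t is a limit of values at points of D to the right of t. -/
lemma IsCadlag.mem_of_dense {ω : ℝ≥0 → ℝ} (hω : IsCadlag ω) {S : Set ℝ} (hS : IsClosed S)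
    {D : Set ℝ≥0} (hD : Dense D) (hDS : ∀ t ∈ D, ω t ∈ S) (t : ℝ≥0) : ω t ∈ S := by
  have h1 : t ∈ closure (Ioi t ∩ D) := by
    have h2 : closure (Ioi t) ⊆ closure (Ioi t ∩ D) :=
      closure_minimal (hD.open_subset_closure_inter isOpen_Ioi) isClosed_closure
    exact h2 (by rw [closure_Ioi]; exact self_mem_Ici)
  have h3 : ContinuousWithinAt ω (Ioi t ∩ D) t :=
    (hω t).1.mono (inter_subset_left.trans Ioi_subset_Ici_self)
  have := h3.mem_closure h1 (t := S) fun s hs => hDS s hs.2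
  rwa [hS.closure_eq] at this

lemma eq_of_mem_lattice {h x y : ℝ} (hh : 0 < h) (hx : x ∈ lattice h) (hy : y ∈ lattice h)
    (hxy : dist x y < h) : x = y := by
  obtain ⟨k, rfl⟩ := hx
  obtain ⟨l, rfl⟩ := hy
  rw [Real.dist_eq, ← sub_mul, abs_mul, abs_of_pos hh] at hxy
  have h1 : |((k - l : ℤ) : ℝ)| < 1 := by
    push_cast
    exact lt_of_mul_lt_mul_right (by linarith) hh.le
  rw [← Int.cast_abs] at h1
  have h2 : |k - l| < 1 := by exact_mod_cast h1
  have h3 : k = l := by have := Int.abs_lt_one_iff.1 h2; omega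
  rw [h3]

/-- Distinct lattice points are at least h apart, so right-continuity forces the path to stay
constant for a while after t. -/
lemma IsGood.eventually_eq {h : ℝ} (hh : 0 < h) {ω : ℝ≥0 → ℝ} (hω : IsGood h ω) (t : ℝ≥0) :
    ∃ u, t < u ∧ ∀ s, t ≤ s → s < u → ω s = ω t := by
  have h1 : ∀ᶠ s in 𝓝[≥] t, dist (ω s) (ω t) < h := (hω.1 t).1 (Metric.ball_mem_nhds _ hh)
  obtain ⟨u, hu, hsub⟩ := (mem_nhdsGE_iff_exists_Ico_subset' (lt_add_one t)).1 h1
  exact ⟨u, hu, fun s hs1 hs2 => eq_of_mem_lattice hh (hω.2.2 s) (hω.2.2 t) (hsub ⟨hs1, hs2⟩)⟩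

/-- The infimum of the exit times is attained because the path is constant just after it. This
dichotomy makes every exit functional explicit. -/
lemma IsGood.exit_cases {h : ℝ} (hh : 0 < h) {ω : ℝ≥0 → ℝ} (hω : IsGood h ω) (R : Set ℝ) :
    (∀ t, ω t ∈ R) ∨ ∃ T, ω T ∉ R ∧ ∀ s < T, ω s ∈ R := by
  by_cases hall : ∀ t, ω t ∈ R
  · exact Or.inl hall
  · push Not at hall
    refine Or.inr ⟨sInf {t | ω t ∉ R}, fun hT => ?_, fun s hs => ?_⟩
    · obtain ⟨u, hu, hconst⟩ := hω.eventually_eq hh (sInf {t | ω t ∉ R})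
      refine hu.not_ge (le_csInf hall fun s hs => ?_)
      by_contra hc
      have h1 : sInf {t | ω t ∉ R} ≤ s := csInf_le' hs
      have h2 := hconst s h1 (not_le.1 hc)
      exact hs (by rw [h2]; exact hT)
    · by_contra hc
      exact notMem_of_lt_csInf' hs hc

/-- The first time at which a path is outside `R`. -/
noncomputable def exitTime (R : Set ℝ) (ω : ℝ≥0 → ℝ) : ℝ≥0∞ := ⨅ (t : ℝ≥0) (_ : ω t ∉ R), (t : ℝ≥0∞)

lemma exitTime_eq {R : Set ℝ} {ω : ℝ≥0 → ℝ} {T : ℝ≥0} (hT : ω T ∉ R) (hlt : ∀ s < T, ω s ∈ R) :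
    exitTime R ω = T := by
  refine le_antisymm (iInf₂_le T hT) (le_iInf₂ fun s hs => ?_)
  rw [ENNReal.coe_le_coe]
  by_contra hc
  exact hs (hlt s (not_le.1 hc))

lemma exitTime_eq_top {R : Set ℝ} {ω : ℝ≥0 → ℝ} (hall : ∀ t, ω t ∈ R) : exitTime R ω = ∞ :=
  top_le_iff.1 (le_iInf₂ fun s hs => absurd (hall s) hs)

lemma firstPassageBelow_eq (x : ℝ) (ω : ℝ≥0 → ℝ) :
    firstPassageBelow x ω = exitTime (Ici (-x)) ω := by
  simp [firstPassageBelow, exitTime]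

lemma firstEntrance_eq (x : ℝ) (ω : ℝ≥0 → ℝ) : firstEntrance x ω = exitTime (Iio x) ω := by
  simp [firstEntrance, exitTime]

open Classical in
/-- The discounted value of `f` at the exit from `R`. -/
noncomputable def exitValue (q : ℝ) (f : ℝ → ℝ) (R : Set ℝ) (ω : ℝ≥0 → ℝ) : ℝ :=
  if exitTime R ω < ∞ then
    Real.exp (-q * (exitTime R ω).toReal) * f (ω (exitTime R ω).toNNReal) else 0

lemma exitValue_eq (q : ℝ) (f : ℝ → ℝ) {R : Set ℝ} {ω : ℝ≥0 → ℝ} {T : ℝ≥0} (hT : ω T ∉ R)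
    (hlt : ∀ s < T, ω s ∈ R) : exitValue q f R ω = Real.exp (-q * T) * f (ω T) := by
  rw [exitValue, exitTime_eq hT hlt]
  simp

lemma exitValue_eq_zero (q : ℝ) (f : ℝ → ℝ) {R : Set ℝ} {ω : ℝ≥0 → ℝ} (hall : ∀ t, ω t ∈ R) :
    exitValue q f R ω = 0 := by
  rw [exitValue, exitTime_eq_top hall]
  simp

lemma abs_exitValue_le {q : ℝ} (hq : 0 ≤ q) {f : ℝ → ℝ} {M : ℝ} (hM : ∀ x, |f x| ≤ M)
    (R : Set ℝ) (ω : ℝ≥0 → ℝ) : |exitValue q f R ω| ≤ M := by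
  unfold exitValue
  split_ifs
  · rw [abs_mul, abs_of_pos (Real.exp_pos _)]
    have h1 : Real.exp (-q * (exitTime R ω).toReal) ≤ 1 :=
      Real.exp_le_one_iff.2 (by nlinarith [ENNReal.toReal_nonneg (a := exitTime R ω)])
    have := mul_le_mul h1 (hM (ω (exitTime R ω).toNNReal)) (abs_nonneg _) zero_le_one
    linarith
  · rw [abs_zero]; exact (abs_nonneg _).trans (hM 0)

open Classical in
/-- The discounted value of `f` at the first grid time `k δ` with value outside `R`, or at the
last time considered. -/
noncomputable def gridValue (q : ℝ) (f : ℝ → ℝ) (R : Set ℝ) (δ : ℝ≥0) : ℕ → (ℝ≥0 → ℝ) → ℝ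
  | 0, ω => f (ω 0)
  | k + 1, ω => if ∀ i ≤ k, ω (i * δ) ∈ R then
      Real.exp (-q * ((k : ℝ) + 1) * δ) * f (ω ((k + 1) * δ)) else gridValue q f R δ k ω

lemma gridValue_of_forall (q : ℝ) (f : ℝ → ℝ) {R : Set ℝ} {δ : ℝ≥0} {k : ℕ} {ω : ℝ≥0 → ℝ}
    (hall : ∀ i < k, ω (i * δ) ∈ R) :
    gridValue q f R δ k ω = Real.exp (-q * k * δ) * f (ω (k * δ)) := by
  rcases k with _ | k
  · simp [gridValue]
  · rw [gridValue, if_pos fun i hi => hall i (Nat.lt_succ_of_le hi)]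
    push_cast
    rfl

lemma gridValue_of_exit (q : ℝ) (f : ℝ → ℝ) {R : Set ℝ} {δ : ℝ≥0} {j : ℕ} {ω : ℝ≥0 → ℝ}
    (hall : ∀ i < j, ω (i * δ) ∈ R) (hj : ω (j * δ) ∉ R) {k : ℕ} (hjk : j ≤ k) :
    gridValue q f R δ k ω = Real.exp (-q * j * δ) * f (ω (j * δ)) := by
  induction k, hjk using Nat.le_induction with
  | base => exact gridValue_of_forall q f hall
  | succ k hk ih => rw [gridValue, if_neg fun hc => hj (hc j hk), ih]

lemma abs_gridValue_le {q : ℝ} (hq : 0 ≤ q) {f : ℝ → ℝ} {M : ℝ} (hM : ∀ x, |f x| ≤ M)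
    (R : Set ℝ) (δ : ℝ≥0) (k : ℕ) (ω : ℝ≥0 → ℝ) : |gridValue q f R δ k ω| ≤ M := by
  induction k with
  | zero => exact hM _
  | succ k ih =>
    rw [gridValue]
    split_ifs
    · rw [abs_mul, abs_of_pos (Real.exp_pos _)]
      have h0 : 0 ≤ q * ((k : ℝ) + 1) * δ := by positivity
      have h1 : Real.exp (-q * ((k : ℝ) + 1) * δ) ≤ 1 := Real.exp_le_one_iff.2 (by linarith)
      have := mul_le_mul h1 (hM (ω ((k + 1) * δ))) (abs_nonneg _) zero_le_one
      linarith
    · exact ih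

lemma measurableSet_grid {R : Set ℝ} (hR : MeasurableSet R) (δ : ℝ≥0) (k : ℕ) :
    MeasurableSet[pathSigma (k * δ)] {ω : Path | ∀ i ≤ k, ω.1 (i * δ) ∈ R} := by
  have : {ω : Path | ∀ i ≤ k, ω.1 (i * δ) ∈ R} =
      ⋂ i : ℕ, ⋂ _ : i ≤ k, (fun ω : Path => ω.1 (i * δ)) ⁻¹' R := by ext; simp
  rw [this]
  refine MeasurableSet.iInter fun i => MeasurableSet.iInter fun hi => ?_
  exact measurable_eval_pathSigma (mul_le_mul_left (Nat.cast_le.2 hi) δ) hR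

lemma measurable_gridValue (q : ℝ) {f : ℝ → ℝ} (hf : Measurable f) {R : Set ℝ}
    (hR : MeasurableSet R) (δ : ℝ≥0) (k : ℕ) :
    Measurable fun ω : Path => gridValue q f R δ k ω.1 := by
  induction k with
  | zero => exact hf.comp (measurable_eval 0)
  | succ k ih =>
    simp only [gridValue]
    refine Measurable.ite (pathSigma_le _ _ (measurableSet_grid hR δ k)) ?_ ih
    exact (hf.comp (measurable_eval _)).const_mul _

/-- The grid approximation of the exit value. -/
lemma IsGood.tendsto_gridValue {h : ℝ} (hh : 0 < h) {ω : ℝ≥0 → ℝ} (hω : IsGood h ω) {q : ℝ}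
    (hq : 0 < q) {f : ℝ → ℝ} {M : ℝ} (hM : ∀ x, |f x| ≤ M) (R : Set ℝ) :
    Tendsto (fun n : ℕ => gridValue q f R (1 / ((n : ℝ≥0) + 1) ^ 2) ((n + 1) ^ 3) ω) atTop
      (𝓝 (exitValue q f R ω)) := by
  have hnat : Tendsto (fun n : ℕ => (n : ℝ) + 1) atTop atTop :=
    tendsto_natCast_atTop_atTop.atTop_add tendsto_const_nhds
  rcases hω.exit_cases hh R with hall | ⟨T, hT, hlt⟩
  · rw [exitValue_eq_zero q f hall]
    have h1 : Tendsto (fun n : ℕ => Real.exp (-(q * ((n : ℝ) + 1))) * M) atTop (𝓝 0) := by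
      have := (Real.tendsto_exp_neg_atTop_nhds_zero.comp (hnat.const_mul_atTop hq)).mul_const M
      simpa using this
    refine squeeze_zero_norm (fun n => ?_) h1
    rw [gridValue_of_forall q f fun i _ => hall _, Real.norm_eq_abs, abs_mul,
      abs_of_pos (Real.exp_pos _)]
    -- The grid has mesh (n+1)^{-2} and (n+1)³ steps, so its horizon is n + 1; discounting kills
    -- paths that never exit.
    have e : -q * ((n + 1) ^ 3 : ℕ) * ((1 / ((n : ℝ≥0) + 1) ^ 2 : ℝ≥0) : ℝ) =
        -(q * ((n : ℝ) + 1)) := by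
      have : (n : ℝ) + 1 ≠ 0 := by positivity
      push_cast
      field_simp
    rw [e]
    exact mul_le_mul_of_nonneg_left (hM _) (Real.exp_pos _).le
  · rw [exitValue_eq q f hT hlt]
    obtain ⟨u, hu, hconst⟩ := hω.eventually_eq hh T
    -- The first grid index not before T. Its time tends to T from the right, hence eventually lies
    -- in [T, u), where the path still has its exit value.
    set j : ℕ → ℕ := fun n => ⌈T * ((n : ℝ≥0) + 1) ^ 2⌉₊ with hj
    have hδ : ∀ n : ℕ, (0 : ℝ≥0) < ((n : ℝ≥0) + 1) ^ 2 := fun n => by positivity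
    have hj1 : ∀ n, T ≤ j n * (1 / ((n : ℝ≥0) + 1) ^ 2) := fun n => by
      rw [mul_one_div, le_div_iff₀ (hδ n)]
      exact Nat.le_ceil _
    have hj2 : ∀ n, (j n : ℝ≥0) * (1 / ((n : ℝ≥0) + 1) ^ 2) ≤ T + 1 / ((n : ℝ≥0) + 1) ^ 2 :=
        fun n => by
      rw [mul_one_div, div_le_iff₀ (hδ n), add_mul, one_div, inv_mul_cancel₀ (hδ n).ne']
      exact (Nat.ceil_lt_add_one zero_le).le
    have hlimδ : Tendsto (fun n : ℕ => 1 / ((n : ℝ≥0) + 1) ^ 2) atTop (𝓝 0) := by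
      rw [← NNReal.tendsto_coe]
      push_cast
      have := (tendsto_pow_atTop (n := 2) (by norm_num)).comp hnat
      refine this.inv_tendsto_atTop.congr fun n => ?_
      simp
    have hlimj : Tendsto (fun n => (j n : ℝ≥0) * (1 / ((n : ℝ≥0) + 1) ^ 2)) atTop (𝓝 T) := by
      refine tendsto_of_tendsto_of_tendsto_of_le_of_le tendsto_const_nhds ?_ hj1 hj2
      simpa using hlimδ.const_add T
    have hev : ∀ᶠ n in atTop, (j n : ℝ≥0) * (1 / ((n : ℝ≥0) + 1) ^ 2) < u :=
      hlimj.eventually (gt_mem_nhds hu)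
    have hev2 : ∀ᶠ n : ℕ in atTop, (T : ℝ) ≤ (n : ℝ) + 1 := hnat.eventually_ge_atTop _
    have hlim : Tendsto (fun n => Real.exp (-q * ((j n : ℝ≥0) * (1 / ((n : ℝ≥0) + 1) ^ 2) : ℝ≥0)) *
        f (ω T)) atTop (𝓝 (Real.exp (-q * T) * f (ω T))) :=
      ((Real.continuous_exp.tendsto _).comp
        ((NNReal.tendsto_coe.2 hlimj).const_mul (-q))).mul_const _
    refine hlim.congr' ?_
    filter_upwards [hev, hev2] with n hn hn2
    have hval := hconst _ (hj1 n) hn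
    have hbefore : ∀ i < j n, ω (i * (1 / ((n : ℝ≥0) + 1) ^ 2)) ∈ R := fun i hi => hlt _ (by
      rw [mul_one_div, div_lt_iff₀ (hδ n)]
      exact Nat.lt_ceil.1 hi)
    rw [gridValue_of_exit q f hbefore (by rw [hval]; exact hT) ?_, hval]
    · push_cast
      ring_nf
    · refine Nat.ceil_le.2 ?_
      push_cast
      rw [pow_succ' _ 2]
      exact mul_le_mul_left (by exact_mod_cast hn2) _

namespace IsChain

variable {lam : Measure ℝ} {ν : Measure Path} {h : ℝ}

/-- Each fixed-time value is almost surely in the lattice; a countable dense set of times and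
right-continuity extend this to all times at once. -/
lemma ae_isGood (hν : IsChain lam ν) (H : IsSkipFreeMeasure lam h) :
    ∀ᵐ ω ∂ν, IsGood h ω.1 := by
  have := hν.prob
  obtain ⟨D, hDc, hD⟩ := TopologicalSpace.exists_countable_dense ℝ≥0
  have h1 : ∀ t ∈ D, ∀ᵐ ω ∂ν, ω.1 t ∈ lattice h := by
    intro t _
    have h2 := hν.incr 0 t univ MeasurableSet.univ _ (measurableSet_lattice h).compl
    rw [univ_inter, show cpLaw lam t (lattice h)ᶜ = 0 from H.cpLaw_ae_mem_lattice t,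
      mul_zero] at h2
    have h3 : ∀ᵐ ω ∂ν, ω.1 (0 + t) - ω.1 0 ∈ lattice h := by
      rw [ae_iff]; exact h2
    filter_upwards [h3, hν.zero] with ω hω h0
    simpa [h0] using hω
  filter_upwards [hν.zero, (ae_ball_iff hDc).2 h1] with ω h0 hω
  exact ⟨ω.2, h0, ω.2.mem_of_dense (isClosed_lattice H.h_pos) hD hω⟩

/-- Independence of the past, localised to an event A of F_s and put as a product measure so that
Fubini applies. -/
lemma map_pair (hν : IsChain lam ν) [IsFiniteMeasure lam] (s t : ℝ≥0) {A : Set Path}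
    (hA : MeasurableSet[pathSigma s] A) :
    (ν.restrict A).map (fun ω => (ω.1 s, ω.1 (s + t) - ω.1 s)) =
      ((ν.restrict A).map fun ω => ω.1 s).prod (cpLaw lam t) := by
  have := hν.prob
  have hm : Measurable fun ω : Path => ω.1 (s + t) - ω.1 s :=
    (measurable_eval _).sub (measurable_eval _)
  refine (Measure.prod_eq fun B C hB hC => ?_).symm
  rw [Measure.map_apply ((measurable_eval s).prodMk hm) (hB.prod hC),
    Measure.map_apply (measurable_eval s) hB,
    Measure.restrict_apply (((measurable_eval s).prodMk hm) (hB.prod hC)),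
    Measure.restrict_apply ((measurable_eval s) hB), ← hν.incr s t _
      ((measurable_eval_pathSigma le_rfl hB).inter hA) C hC]
  congr 1
  ext ω
  simp only [mem_inter_iff, mem_preimage, mem_prod, mem_ofPred_eq]
  tauto

lemma setIntegral_step (hν : IsChain lam ν) [IsFiniteMeasure lam] (s t : ℝ≥0) {A : Set Path}
    (hA : MeasurableSet[pathSigma s] A) {f : ℝ → ℝ} (hf : Measurable f) {M : ℝ}
    (hM : ∀ x, |f x| ≤ M) :
    ∫ ω in A, f (ω.1 (s + t)) ∂ν = ∫ ω in A, (∫ y, f (ω.1 s + y) ∂cpLaw lam t) ∂ν := by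
  have := hν.prob
  have hm : Measurable fun ω : Path => ω.1 (s + t) - ω.1 s :=
    (measurable_eval _).sub (measurable_eval _)
  have hmf : Measurable fun p : ℝ × ℝ => f (p.1 + p.2) := by fun_prop
  have h1 : ∫ ω in A, f (ω.1 (s + t)) ∂ν =
      ∫ p, f (p.1 + p.2) ∂((ν.restrict A).map fun ω => (ω.1 s, ω.1 (s + t) - ω.1 s)) := by
    rw [integral_map ((measurable_eval s).prodMk hm).aemeasurable hmf.aestronglyMeasurable]
    simp
  rw [h1, hν.map_pair s t hA, integral_prod _ (Integrable.of_bound hmf.aestronglyMeasurable M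
    (ae_of_all _ fun p => hM _)), integral_map (measurable_eval s).aemeasurable]
  exact (hmf.stronglyMeasurable.integral_prod_right').aestronglyMeasurable

/-- Paths already out of R on the grid do not change. The others make one discounted step from a
lattice point of R, where L f = q f leaves only an error of order δ². -/
lemma abs_integral_gridValue_succ_sub_le (hν : IsChain lam ν) (H : IsSkipFreeMeasure lam h)
    {q : ℝ} (hq : 0 ≤ q) {f : ℝ → ℝ} (hf : Measurable f) {M : ℝ} (hM : ∀ x, |f x| ≤ M)
    {R : Set ℝ} (hR : MeasurableSet R)
    (hL : ∀ x ∈ R, x ∈ lattice h → ∫ y, f (x + y) ∂lam = (lam.real univ + q) * f x)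
    (δ : ℝ≥0) (k : ℕ) :
    |∫ ω, gridValue q f R δ (k + 1) ω.1 ∂ν - ∫ ω, gridValue q f R δ k ω.1 ∂ν| ≤
      M * (3 * lam.real univ ^ 2 + q ^ 2) * (δ : ℝ) ^ 2 := by
  have := hν.prob
  have := H.finite
  have hM0 : 0 ≤ M := (abs_nonneg _).trans (hM 0)
  set G := {ω : Path | ∀ i ≤ k, ω.1 (i * δ) ∈ R} with hG
  have hGm := measurableSet_grid hR δ k
  have hGm' : MeasurableSet G := pathSigma_le _ _ hGm
  have hI : ∀ k, Integrable (fun ω : Path => gridValue q f R δ k ω.1) ν := fun k =>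
    Integrable.of_bound (measurable_gridValue q hf hR δ k).aestronglyMeasurable M
      (ae_of_all _ fun ω => abs_gridValue_le hq hM R δ k ω.1)
  have hIf : ∀ t, Integrable (fun ω : Path => f (ω.1 t)) (ν.restrict G) := fun t =>
    Integrable.of_bound (hf.comp (measurable_eval t)).aestronglyMeasurable M
      (ae_of_all _ fun ω => hM _)
  have hmP : Measurable fun x => ∫ y, f (x + y) ∂cpLaw lam δ :=
    (StronglyMeasurable.integral_prod_right' (f := fun p : ℝ × ℝ => f (p.1 + p.2))
      (by fun_prop : Measurable fun p : ℝ × ℝ => f (p.1 + p.2)).stronglyMeasurable).measurable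
  have hIP : Integrable (fun ω : Path => ∫ y, f (ω.1 (k * δ) + y) ∂cpLaw lam δ) (ν.restrict G) :=
    Integrable.of_bound (hmP.comp (measurable_eval _)).aestronglyMeasurable M
      (ae_of_all _ fun ω => by
        have := norm_integral_le_mul (μ := cpLaw lam δ) (f := fun y => f (ω.1 (k * δ) + y))
          fun y => hM _
        simpa using this)
  have h1 : ∫ ω, gridValue q f R δ (k + 1) ω.1 ∂ν - ∫ ω, gridValue q f R δ k ω.1 ∂ν =
      Real.exp (-q * k * δ) * ∫ ω in G, (Real.exp (-q * δ) *
        (∫ y, f (ω.1 (k * δ) + y) ∂cpLaw lam δ) - f (ω.1 (k * δ))) ∂ν := by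
    rw [integral_sub (hIP.const_mul _) (hIf _), integral_const_mul,
      ← hν.setIntegral_step _ _ hGm hf hM, ← integral_const_mul, ← integral_sub
        ((hIf _).const_mul _) (hIf _), ← integral_const_mul, ← integral_sub (hI _) (hI _),
      ← integral_indicator hGm']
    refine integral_congr_ae (ae_of_all _ fun ω => ?_)
    simp only
    by_cases hω : ω ∈ G
    · rw [indicator_of_mem hω, gridValue, if_pos (show ∀ i ≤ k, ω.1 (i * δ) ∈ R from hω),
        gridValue_of_forall q f fun i hi => hω i hi.le, mul_sub, ← mul_assoc, ← Real.exp_add,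
        add_mul, one_mul]
      congr 3
      ring
    · rw [indicator_of_notMem hω, gridValue, if_neg (show ¬ ∀ i ≤ k, ω.1 (i * δ) ∈ R from hω), sub_self]
  have hexp : Real.exp (-q * k * δ) ≤ 1 := by
    have : 0 ≤ q * k * δ := by positivity
    exact Real.exp_le_one_iff.2 (by linarith)
  set C := M * (3 * lam.real univ ^ 2 + q ^ 2) * (δ : ℝ) ^ 2 with hC
  have hC0 : 0 ≤ C := by positivity
  have h2 : |∫ ω in G, (Real.exp (-q * δ) *
        (∫ y, f (ω.1 (k * δ) + y) ∂cpLaw lam δ) - f (ω.1 (k * δ))) ∂ν| ≤ C := by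
    have h3 : ∀ᵐ ω ∂(ν.restrict G), ‖Real.exp (-q * δ) *
        (∫ y, f (ω.1 (k * δ) + y) ∂cpLaw lam δ) - f (ω.1 (k * δ))‖ ≤ C := by
      rw [ae_restrict_iff' hGm']
      filter_upwards [hν.ae_isGood H] with ω hω hωG
      exact abs_discounted_step_le lam δ hq hf hM (hL _ (hωG k le_rfl) (hω.2.2 _))
    refine (norm_integral_le_of_norm_le_const h3).trans ?_
    refine mul_le_of_le_one_right hC0 ?_
    rw [measureReal_restrict_apply_univ]
    exact measureReal_le_one
  rw [h1, abs_mul, abs_of_pos (Real.exp_pos _)]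
  have := mul_le_mul hexp h2 (abs_nonneg _) zero_le_one
  linarith

/-- The exit time is an infimum over uncountably many times; measurability is inherited from the
grid approximations. -/
lemma aestronglyMeasurable_exitValue (hν : IsChain lam ν) (H : IsSkipFreeMeasure lam h)
    {q : ℝ} (hq : 0 < q) {f : ℝ → ℝ} (hf : Measurable f) {M : ℝ} (hM : ∀ x, |f x| ≤ M)
    {R : Set ℝ} (hR : MeasurableSet R) :
    AEStronglyMeasurable (fun ω : Path => exitValue q f R ω.1) ν :=
  aestronglyMeasurable_of_tendsto_ae atTop
    (fun _ => (measurable_gridValue q hf hR _ _).aestronglyMeasurable)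
    ((hν.ae_isGood H).mono fun _ hω => hω.tendsto_gridValue H.h_pos hq hM R)

lemma integrable_exitValue (hν : IsChain lam ν) (H : IsSkipFreeMeasure lam h)
    {q : ℝ} (hq : 0 < q) {f : ℝ → ℝ} (hf : Measurable f) {M : ℝ} (hM : ∀ x, |f x| ≤ M)
    {R : Set ℝ} (hR : MeasurableSet R) :
    Integrable (fun ω : Path => exitValue q f R ω.1) ν := by
  have := hν.prob
  exact Integrable.of_bound (hν.aestronglyMeasurable_exitValue H hq hf hM hR) M
    (ae_of_all _ fun ω => abs_exitValue_le hq.le hM R ω.1)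

/-- Dynkin's formula at the exit from `R` for a bounded `f` with `L f = q f` on `R`. -/
lemma integral_exitValue (hν : IsChain lam ν) (H : IsSkipFreeMeasure lam h)
    {q : ℝ} (hq : 0 < q) {f : ℝ → ℝ} (hf : Measurable f) {M : ℝ} (hM : ∀ x, |f x| ≤ M)
    {R : Set ℝ} (hR : MeasurableSet R)
    (hL : ∀ x ∈ R, x ∈ lattice h → ∫ y, f (x + y) ∂lam = (lam.real univ + q) * f x) :
    ∫ ω, exitValue q f R ω.1 ∂ν = f 0 := by
  have := hν.prob
  have hlim := tendsto_integral_of_dominated_convergence (μ := ν)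
    (F := fun n (ω : Path) => gridValue q f R (1 / ((n : ℝ≥0) + 1) ^ 2) ((n + 1) ^ 3) ω.1)
    (fun _ => M) (fun _ => (measurable_gridValue q hf hR _ _).aestronglyMeasurable)
    (integrable_const _) (fun n => ae_of_all _ fun ω => abs_gridValue_le hq.le hM R _ _ ω.1)
    ((hν.ae_isGood H).mono fun _ hω => hω.tendsto_gridValue H.h_pos hq hM R)
  refine tendsto_nhds_unique hlim ?_
  set C := M * (3 * lam.real univ ^ 2 + q ^ 2) with hC
  have hstep : ∀ (δ : ℝ≥0) (k : ℕ),
      |∫ ω, gridValue q f R δ k ω.1 ∂ν - f 0| ≤ k * (C * (δ : ℝ) ^ 2) := by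
    intro δ k
    induction k with
    | zero =>
      have : ∫ ω : Path, gridValue q f R δ 0 ω.1 ∂ν = f 0 := by
        have h1 : ∀ᵐ ω ∂ν, gridValue q f R δ 0 ω.1 = f 0 := by
          filter_upwards [hν.zero] with ω hω
          rw [gridValue, hω]
        rw [integral_congr_ae h1]
        simp
      rw [this]; simp
    | succ k ih =>
      have h2 := hν.abs_integral_gridValue_succ_sub_le H hq.le hf hM hR hL δ k
      rw [abs_le] at h2 ih ⊢
      push_cast
      constructor <;> nlinarith [h2.1, h2.2, ih.1, ih.2]
  rw [tendsto_iff_dist_tendsto_zero]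
  have hnat : Tendsto (fun n : ℕ => (n : ℝ) + 1) atTop atTop :=
    tendsto_natCast_atTop_atTop.atTop_add tendsto_const_nhds
  have hbound : Tendsto (fun n : ℕ => C * ((n : ℝ) + 1)⁻¹) atTop (𝓝 0) := by
    simpa using hnat.inv_tendsto_atTop.const_mul C
  refine squeeze_zero (fun _ => dist_nonneg) (fun n => ?_) hbound
  rw [Real.dist_eq]
  -- There are (n+1)³ steps with error C(n+1)^{-4} each: the horizon grows while the total error
  -- vanishes.
  refine (hstep _ _).trans_eq ?_
  have : (n : ℝ) + 1 ≠ 0 := by positivity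
  push_cast
  field_simp

end IsChain

end SkipFree

/-! ### Two-sided exit, the law of the depth, and first passage -/

namespace SkipFree

/-- The interval of lattice levels `-r h, …, (N - 1) h`. -/
def strip (h : ℝ) (r N : ℕ) : Set ℝ := Ico (-(r * h)) (N * h)

lemma measurableSet_strip (h : ℝ) (r N : ℕ) : MeasurableSet (strip h r N) := measurableSet_Ico

/-- A sequence indexed from the bottom of the strip, capped at `K` and extended by `0` below. -/
noncomputable def capFun (h : ℝ) (r K : ℕ) (u : ℕ → ℝ) (x : ℝ) : ℝ :=
  if ⌊x / h⌋ + (r : ℤ) < 0 then 0 else u (min (⌊x / h⌋ + (r : ℤ)).toNat K)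

lemma measurable_capFun (h : ℝ) (r K : ℕ) (u : ℕ → ℝ) : Measurable (capFun h r K u) := by
  have h1 : Measurable fun x : ℝ => ⌊x / h⌋ := Int.measurable_floor.comp (measurable_id.div_const h)
  exact (measurable_from_top (f := fun k : ℤ => if k + (r : ℤ) < 0 then (0 : ℝ)
    else u (min (k + (r : ℤ)).toNat K))).comp h1

lemma abs_capFun_le (h : ℝ) (r K : ℕ) (u : ℕ → ℝ) (x : ℝ) :
    |capFun h r K u x| ≤ ∑ l ∈ Finset.range (K + 1), |u l| := by
  unfold capFun
  split_ifs
  · rw [abs_zero]; exact Finset.sum_nonneg fun _ _ => abs_nonneg _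
  · exact Finset.single_le_sum (f := fun l => |u l|) (fun _ _ => abs_nonneg _)
      (Finset.mem_range.2 (Nat.lt_succ_of_le (min_le_right _ _)))

lemma floor_div_lattice {h : ℝ} (hh : 0 < h) (k : ℤ) : ⌊(k : ℝ) * h / h⌋ = k := by
  rw [mul_div_cancel_right₀ _ hh.ne', Int.floor_intCast]

lemma capFun_lattice {h : ℝ} (hh : 0 < h) (r K : ℕ) (u : ℕ → ℝ) (k : ℤ) :
    capFun h r K u (k * h) = if k + (r : ℤ) < 0 then 0 else u (min (k + (r : ℤ)).toNat K) := by
  rw [capFun, floor_div_lattice hh]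

lemma capFun_zero {h : ℝ} (hh : 0 < h) {r K : ℕ} (hrK : r ≤ K) (u : ℕ → ℝ) :
    capFun h r K u 0 = u r := by
  have h1 := capFun_lattice hh r K u 0
  rw [Int.cast_zero, zero_mul] at h1
  rw [h1, if_neg (by omega)]
  congr 1
  omega

/-- One jump from level J < K rises at most to J + 1 ≤ K, so the cap, there to make the function
bounded, is not felt; the zero extension removes the masses with i > J + 1. -/
lemma IsSkipFreeMeasure.integral_capFun {lam : Measure ℝ} {h : ℝ} (H : IsSkipFreeMeasure lam h)
    {r K J : ℕ} (hJ : J < K) (u : ℕ → ℝ) {k : ℤ} (hk : k + (r : ℤ) = J) :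
    ∫ y, capFun h r K u (k * h + y) ∂lam =
      ∑ x ∈ Finset.HasAntidiagonal.antidiagonal (J + 1), mass lam h x.1 * u x.2 := by
  have := H.finite
  have hI : Integrable (fun y => capFun h r K u (k * h + y)) lam :=
    Integrable.of_bound ((measurable_capFun h r K u).comp
      (measurable_const_add _)).aestronglyMeasurable _ (ae_of_all _ fun y => abs_capFun_le h r K u _)
  have h1 := H.hasSum_integral hI
  have hval : ∀ i : ℕ, capFun h r K u (k * h + (1 - (i : ℝ)) * h) =
      if (J : ℤ) + 1 - i < 0 then 0 else u (min ((J : ℤ) + 1 - i).toNat K) := by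
    intro i
    have e : (k : ℝ) * h + (1 - (i : ℝ)) * h = ((k + 1 - i : ℤ) : ℝ) * h := by push_cast; ring
    rw [e, capFun_lattice H.h_pos, show k + 1 - (i : ℤ) + r = J + 1 - i by omega]
  simp only [hval] at h1
  rw [Finset.Nat.sum_antidiagonal_eq_sum_range_succ_mk]
  refine h1.unique ?_
  have h2 := hasSum_sum_of_ne_finset_zero (L := SummationFilter.unconditional ℕ) (s := Finset.range (J + 1).succ)
    (f := fun i : ℕ => mass lam h i *
      (if (J : ℤ) + 1 - i < 0 then 0 else u (min ((J : ℤ) + 1 - i).toNat K))) (fun i hi => by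
        have : ¬ i < J + 1 + 1 := fun hc => hi (Finset.mem_range.2 hc)
        rw [if_pos (by omega), mul_zero])
  convert h2 using 1
  refine Finset.sum_congr rfl fun i hi => ?_
  have : i < J + 1 + 1 := Finset.mem_range.1 hi
  rw [if_neg (by omega)]
  congr 2
  omega

lemma mem_strip_lattice {h : ℝ} (hh : 0 < h) {r N : ℕ} {k : ℤ} :
    (k : ℝ) * h ∈ strip h r N ↔ -(r : ℤ) ≤ k ∧ k < N := by
  rw [strip, mem_Ico, ← neg_mul, mul_le_mul_iff_left₀ hh, mul_lt_mul_iff_left₀ hh]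
  constructor
  · rintro ⟨h1, h2⟩; exact ⟨by exact_mod_cast h1, by exact_mod_cast h2⟩
  · rintro ⟨h1, h2⟩; exact ⟨by exact_mod_cast h1, by exact_mod_cast h2⟩

/-- The indicator of the levels below the strip. -/
noncomputable def below (h : ℝ) (r : ℕ) : ℝ → ℝ := (Iio (-(r * h))).indicator fun _ => 1

/-- The indicator of the levels above the strip. -/
noncomputable def above (h : ℝ) (N : ℕ) : ℝ → ℝ := (Ici (N * h)).indicator fun _ => 1

lemma abs_indicator_one_le (S : Set ℝ) (x : ℝ) : |S.indicator (fun _ => (1 : ℝ)) x| ≤ 1 := by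
  by_cases hx : x ∈ S <;> simp [hx]

lemma measurable_below (h : ℝ) (r : ℕ) : Measurable (below h r) :=
  measurable_const.indicator measurableSet_Iio

lemma measurable_above (h : ℝ) (N : ℕ) : Measurable (above h N) :=
  measurable_const.indicator measurableSet_Ici

lemma exitValue_congr (q : ℝ) {f g : ℝ → ℝ} {R : Set ℝ} {h : ℝ} (hh : 0 < h) {ω : ℝ≥0 → ℝ}
    (hω : IsGood h ω) (hfg : ∀ x ∈ lattice h, x ∉ R → f x = g x) :
    exitValue q f R ω = exitValue q g R ω := by
  rcases hω.exit_cases hh R with hall | ⟨T, hT, hlt⟩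
  · rw [exitValue_eq_zero q f hall, exitValue_eq_zero q g hall]
  · rw [exitValue_eq q f hT hlt, exitValue_eq q g hT hlt, hfg _ (hω.2.2 T) hT]

lemma exitValue_add (q : ℝ) (f g : ℝ → ℝ) (R : Set ℝ) (ω : ℝ≥0 → ℝ) (a b : ℝ) :
    exitValue q (fun x => a * f x + b * g x) R ω = a * exitValue q f R ω + b * exitValue q g R ω := by
  unfold exitValue
  split_ifs <;> ring

lemma outside_strip {h : ℝ} (hh : 0 < h) {r N : ℕ} {x : ℝ} (hx : x ∉ strip h r N) :
    (x < -(r * h) ∧ below h r x = 1 ∧ above h N x = 0) ∨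
      (N * h ≤ x ∧ below h r x = 0 ∧ above h N x = 1) := by
  have hNr : -((r : ℝ) * h) ≤ N * h := by
    have : (0 : ℝ) ≤ r * h := by positivity
    have : (0 : ℝ) ≤ N * h := by positivity
    linarith
  rcases lt_or_ge x (-(r * h)) with h1 | h1
  · refine Or.inl ⟨h1, indicator_of_mem (show x ∈ Iio _ from h1) _, indicator_of_notMem ?_ _⟩
    exact not_le.2 (h1.trans_le hNr)
  · have h2 : N * h ≤ x := not_lt.1 fun hc => hx ⟨h1, hc⟩
    exact Or.inr ⟨h2, indicator_of_notMem (show x ∉ Iio _ from not_lt.2 h1) _,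
      indicator_of_mem (show x ∈ Ici _ from h2) _⟩

/-- The cap makes the function constant from the top of the strip upwards, so the exact point of
exit above never has to be determined. -/
lemma capFun_outside {h : ℝ} (hh : 0 < h) {r N : ℕ} (u : ℕ → ℝ) {x : ℝ} (hx : x ∈ lattice h)
    (hxs : x ∉ strip h r N) : capFun h r (N + r) u x = u (N + r) * above h N x := by
  obtain ⟨k, rfl⟩ := hx
  rw [capFun_lattice hh]
  rcases outside_strip hh hxs with ⟨h1, h2, h3⟩ | ⟨h1, h2, h3⟩
  · rw [h3, mul_zero, if_pos]
    rw [← neg_mul, mul_lt_mul_iff_left₀ hh] at h1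
    have : k < -(r : ℤ) := by exact_mod_cast h1
    omega
  · rw [mul_le_mul_iff_left₀ hh] at h1
    have h4 : (N : ℤ) ≤ k := by exact_mod_cast h1
    rw [h3, mul_one, if_neg (by omega)]
    congr 1
    omega

namespace IsChain

variable {lam : Measure ℝ} {ν : Measure Path} {h : ℝ}

/-- Dynkin's formula for the capped sequence w: it vanishes below the strip, is w_{N+r} above it and
w_r at the starting point. -/
lemma integral_exit_above (hν : IsChain lam ν) (H : IsSkipFreeMeasure lam h) {q : ℝ} (hq : 0 < q)
    (r N : ℕ) : scaleSeq lam h q (N + r) * ∫ ω, exitValue q (above h N) (strip h r N) ω.1 ∂ν =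
      scaleSeq lam h q r := by
  rw [← integral_const_mul]
  have h1 := hν.integral_exitValue H hq (measurable_capFun h r (N + r) (scaleSeq lam h q))
    (abs_capFun_le h r (N + r) (scaleSeq lam h q)) (R := strip h r N) measurableSet_Ico ?_
  · have h0 : capFun h r (N + r) (scaleSeq lam h q) 0 = scaleSeq lam h q r := by
      exact capFun_zero H.h_pos (Nat.le_add_left r N) _
    rw [← h0, ← h1]
    refine integral_congr_ae ((hν.ae_isGood H).mono fun ω hω => ?_)
    have h2 := exitValue_add q (above h N) 0 (strip h r N) ω.1 (scaleSeq lam h q (N + r)) 0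
    simp only [zero_mul, add_zero] at h2
    simp only
    rw [← h2]
    exact (exitValue_congr q H.h_pos hω fun x hx hxs => capFun_outside H.h_pos _ hx hxs).symm
  · rintro x hx ⟨k, rfl⟩
    obtain ⟨h3, h4⟩ := (mem_strip_lattice H.h_pos).1 hx
    rw [H.integral_capFun (J := (k + r).toNat) (by omega) _ (by omega), H.scaleSeq_rec,
      capFun_lattice H.h_pos, if_neg (by omega)]
    congr 2
    omega

/-- Dynkin's formula for the capped sequence Z. The inhomogeneous term 1/h in the identity for
partial sums is what makes 1 + qhS solve L f = q f, with value 1 rather than 0 below the strip. -/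
lemma integral_exit_below_pos (hν : IsChain lam ν) (H : IsSkipFreeMeasure lam h) {q : ℝ}
    (hq : 0 < q) (r N : ℕ) :
    ∫ ω, exitValue q (below h r) (strip h r N) ω.1 ∂ν +
      scaleSeqZ lam h q (N + r) * ∫ ω, exitValue q (above h N) (strip h r N) ω.1 ∂ν =
      scaleSeqZ lam h q r := by
  have := H.finite
  set S : ℕ → ℝ := fun j => ∑ l ∈ Finset.range j, scaleSeq lam h q l with hS
  set f : ℝ → ℝ := fun x => 1 + q * h * capFun h r (N + r) S x with hf
  have hfm : Measurable f := (measurable_capFun _ _ _ _).const_mul _ |>.const_add _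
  have hfM : ∀ x, |f x| ≤ 1 + q * h * ∑ l ∈ Finset.range (N + r + 1), |S l| := fun x => by
    refine (abs_add_le _ _).trans ?_
    rw [abs_one, abs_mul, abs_of_nonneg (mul_nonneg hq.le H.h_pos.le)]
    have := mul_le_mul_of_nonneg_left (abs_capFun_le h r (N + r) S x) (mul_nonneg hq.le H.h_pos.le)
    linarith
  have h1 := hν.integral_exitValue H hq hfm hfM (R := strip h r N) measurableSet_Ico ?_
  · have h0 : f 0 = scaleSeqZ lam h q r := by
      simp only [hf, capFun_zero H.h_pos (Nat.le_add_left r N), scaleSeqZ, hS]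
    rw [← h0, ← h1, ← integral_const_mul, ← integral_add
      (hν.integrable_exitValue H hq (measurable_below h r) (abs_indicator_one_le _)
        (measurableSet_strip h r N))
      ((hν.integrable_exitValue H hq (measurable_above h N) (abs_indicator_one_le _)
        (measurableSet_strip h r N)).const_mul _)]
    refine integral_congr_ae ((hν.ae_isGood H).mono fun ω hω => ?_)
    have h2 := exitValue_add q (below h r) (above h N) (strip h r N) ω.1 1
      (scaleSeqZ lam h q (N + r))
    simp only [one_mul] at h2 ⊢
    rw [← h2]
    refine exitValue_congr q H.h_pos hω fun x hx hxs => ?_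
    simp only [hf, capFun_outside H.h_pos _ hx hxs]
    rcases outside_strip H.h_pos hxs with ⟨-, e1, e2⟩ | ⟨-, e1, e2⟩
    · rw [e1, e2]; ring
    · rw [e1, e2, scaleSeqZ]; ring
  · rintro x hx ⟨k, rfl⟩
    obtain ⟨h3, h4⟩ := (mem_strip_lattice H.h_pos).1 hx
    have hI : Integrable (fun y => capFun h r (N + r) S (k * h + y)) lam :=
      Integrable.of_bound ((measurable_capFun _ _ _ _).comp
        (measurable_const_add _)).aestronglyMeasurable _ (ae_of_all _ fun y => abs_capFun_le _ _ _ _ _)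
    simp only [hf]
    rw [integral_add (integrable_const _) (hI.const_mul _), integral_const_mul,
      H.integral_capFun (J := (k + r).toNat) (by omega) S (by omega), capFun_lattice H.h_pos,
      if_neg (by omega), H.sum_mass_mul_partialSum,
      show min (k + (r : ℤ)).toNat (N + r) = (k + r).toNat by omega]
    have := H.h_pos.ne'
    simp only [integral_const, smul_eq_mul, mul_one]
    field_simp
    ring

lemma integral_exit_below_of_pos (hν : IsChain lam ν) (H : IsSkipFreeMeasure lam h) {q : ℝ}
    (hq : 0 < q) (r N : ℕ) :
    ∫ ω, exitValue q (below h r) (strip h r N) ω.1 ∂ν =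
      scaleSeqZ lam h q r -
        scaleSeqZ lam h q (N + r) * (scaleSeq lam h q r / scaleSeq lam h q (N + r)) := by
  have h1 := hν.integral_exit_above H hq r N
  have h2 := hν.integral_exit_below_pos H hq r N
  have h3 := (H.scaleSeq_pos hq.le (N + r)).ne'
  rw [← h1, mul_div_cancel_left₀ _ h3]
  linarith

lemma tendsto_exitValue_zero (f : ℝ → ℝ) (R : Set ℝ) (ω : ℝ≥0 → ℝ) :
    Tendsto (fun n : ℕ => exitValue (1 / ((n : ℝ) + 1)) f R ω) atTop (𝓝 (exitValue 0 f R ω)) := by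
  have h1 : Continuous fun q => exitValue q f R ω := by
    unfold exitValue
    split_ifs
    · fun_prop
    · exact continuous_const
  exact (h1.tendsto 0).comp tendsto_one_div_add_atTop_nhds_zero_nat

/-- The two-sided exit problem, for exit below. -/
lemma integral_exit_below (hν : IsChain lam ν) (H : IsSkipFreeMeasure lam h) {q : ℝ}
    (hq : 0 ≤ q) (r N : ℕ) :
    AEStronglyMeasurable (fun ω : Path => exitValue q (below h r) (strip h r N) ω.1) ν ∧
    ∫ ω, exitValue q (below h r) (strip h r N) ω.1 ∂ν =
      scaleSeqZ lam h q r -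
        scaleSeqZ lam h q (N + r) * (scaleSeq lam h q r / scaleSeq lam h q (N + r)) := by
  have := hν.prob
  rcases hq.lt_or_eq with hq | rfl
  · exact ⟨hν.aestronglyMeasurable_exitValue H hq (measurable_below h r) (abs_indicator_one_le _)
      measurableSet_Ico, hν.integral_exit_below_of_pos H hq r N⟩
  -- The grid argument needs discounting at a positive rate; at q = 0 both sides are limits along q
  -- = 1/(n+1).
  · have hpos : ∀ n : ℕ, (0 : ℝ) < 1 / ((n : ℝ) + 1) := fun n => by positivity
    have hm : ∀ n : ℕ, AEStronglyMeasurable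
        (fun ω : Path => exitValue (1 / ((n : ℝ) + 1)) (below h r) (strip h r N) ω.1) ν := fun n =>
      hν.aestronglyMeasurable_exitValue H (hpos n) (measurable_below h r) (abs_indicator_one_le _)
        measurableSet_Ico
    refine ⟨aestronglyMeasurable_of_tendsto_ae atTop hm
      (ae_of_all _ fun ω => tendsto_exitValue_zero _ _ _), ?_⟩
    have h1 := tendsto_integral_of_dominated_convergence (μ := ν) (fun _ => 1) hm
      (integrable_const _) (fun n => ae_of_all _ fun ω =>
        abs_exitValue_le (hpos n).le (abs_indicator_one_le _) _ ω.1)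
      (ae_of_all _ fun ω => tendsto_exitValue_zero (below h r) (strip h r N) ω.1)
    refine tendsto_nhds_unique h1 ?_
    simp only [hν.integral_exit_below_of_pos H (hpos _)]
    have hw : ∀ j, Continuous fun q => scaleSeq lam h q j :=
      IsSkipFreeMeasure.continuous_scaleSeq lam h
    have hz : ∀ j, Continuous fun q => scaleSeqZ lam h q j := fun j =>
      continuous_const.add ((continuous_id.mul continuous_const).mul
        (continuous_finsetSum _ fun l _ => hw l))
    have h2 : ContinuousAt (fun q => scaleSeqZ lam h q r -
        scaleSeqZ lam h q (N + r) * (scaleSeq lam h q r / scaleSeq lam h q (N + r))) 0 :=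
      (hz r).continuousAt.sub ((hz _).continuousAt.mul ((hw r).continuousAt.div (hw _).continuousAt
        (H.scaleSeq_pos le_rfl _).ne'))
    exact h2.tendsto.comp tendsto_one_div_add_atTop_nhds_zero_nat

/-- The law of the depth below the maximum before the next maximum. -/
lemma depth_le_iff {h : ℝ} (hh : 0 < h) {ω : ℝ≥0 → ℝ} (hω : IsGood h ω) (r : ℕ) :
    depth h ω ≤ ((r * h : ℝ) : EReal) ↔ exitValue 0 (below h r) (strip h r 1) ω = 0 := by
  have hdepth : depth h ω ≤ ((r * h : ℝ) : EReal) ↔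
      ∀ s : ℝ≥0, (s : ℝ≥0∞) < exitTime (Iio h) ω → -(r * h) ≤ ω s := by
    rw [depth, iSup₂_le_iff]
    simp only [firstEntrance_eq, EReal.coe_le_coe_iff]
    exact forall₂_congr fun s _ => by rw [neg_le]
  rw [hdepth]
  rcases hω.exit_cases hh (strip h r 1) with hall | ⟨T, hT, hlt⟩
  · rw [exitValue_eq_zero _ _ hall]
    exact ⟨fun _ => rfl, fun _ s _ => (hall s).1⟩
  · rw [exitValue_eq 0 _ hT hlt]
    rcases outside_strip hh hT with ⟨h1, h2, -⟩ | ⟨h1, h2, -⟩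
    · rw [h2]
      refine ⟨fun hs => absurd (hs T ?_) (not_le.2 h1), fun h0 => absurd h0 (by simp)⟩
      -- The supremum defining the depth runs over times strictly before T_h, so T < T_h is needed;
      -- the path remains below the strip on [T, u).
      obtain ⟨u, hu, hconst⟩ := hω.eventually_eq hh T
      refine (ENNReal.coe_lt_coe.2 hu).trans_le (le_iInf₂ fun t ht => ?_)
      rw [ENNReal.coe_le_coe]
      by_contra hc
      refine ht ?_
      rcases lt_or_ge t T with h3 | h3
      · have := (hlt t h3).2
        simpa using this
      · rw [hconst t h3 (not_le.1 hc)]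
        have : (0 : ℝ) ≤ r * h := by positivity
        exact h1.trans (by linarith)
    · rw [h2]
      refine ⟨fun _ => by simp, fun _ s hs => (hlt s ?_).1⟩
      have h3 : exitTime (Iio h) ω ≤ T := iInf₂_le T (by
        simp only [mem_Iio, not_lt]; simpa using h1)
      exact ENNReal.coe_lt_coe.1 (hs.trans_le h3)

lemma exitValue_zero_below (h : ℝ) (r : ℕ) (R : Set ℝ) (ω : ℝ≥0 → ℝ) :
    exitValue 0 (below h r) R ω = 0 ∨ exitValue 0 (below h r) R ω = 1 := by
  unfold exitValue below
  split_ifs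
  · rw [indicator_apply]
    split_ifs <;> simp
  · simp

/-- With N = 1 leaving the strip above means attaining h, so the depth exceeds rh exactly when the
exit is below. At q = 0, where Z ≡ 1, that has probability 1 - w_r/w_{r+1}. -/
lemma measureReal_depth_le (hν : IsChain lam ν) (H : IsSkipFreeMeasure lam h) (r : ℕ) :
    ν.real {ω : Path | depth h ω.1 ≤ ((r * h : ℝ) : EReal)} =
      scaleSeq lam h 0 r / scaleSeq lam h 0 (r + 1) := by
  have := hν.prob
  obtain ⟨hm, hval⟩ := hν.integral_exit_below H le_rfl r 1
  set g : Path → ℝ := fun ω => exitValue 0 (below h r) (strip h r 1) ω.1 with hg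
  set D : Set Path := {ω : Path | depth h ω.1 ≤ ((r * h : ℝ) : EReal)} with hD
  have hind : D.indicator (fun _ => (1 : ℝ)) =ᵐ[ν] fun ω => 1 - g ω := by
    filter_upwards [hν.ae_isGood H] with ω hω
    have h1 := depth_le_iff H.h_pos hω r
    rcases exitValue_zero_below h r (strip h r 1) ω.1 with h2 | h2
    · rw [indicator_of_mem (show ω ∈ D from h1.2 h2)]
      simp only [hg, h2, sub_zero]
    · rw [indicator_of_notMem (show ω ∉ D from fun hc => by
        have := h1.1 hc
        rw [h2] at this
        exact one_ne_zero this)]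
      simp only [hg, h2, sub_self]
  have hmD : NullMeasurableSet D ν := by
    rw [← aemeasurable_indicator_const_iff (b := (1 : ℝ))]
    exact ((aestronglyMeasurable_const.sub hm).congr hind.symm).aemeasurable
  have h3 : ∫ ω, D.indicator (fun _ => (1 : ℝ)) ω ∂ν = ν.real D := by
    rw [integral_indicator₀ hmD]
    simp
  have hgi : Integrable g ν := Integrable.of_bound hm 1 (ae_of_all _ fun ω =>
    abs_exitValue_le le_rfl (abs_indicator_one_le _) _ ω.1)
  rw [← h3, integral_congr_ae hind, integral_sub (integrable_const _) hgi, hval]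
  simp [scaleSeqZ, add_comm]

/-- The scale function is the solution of the recursion. -/
lemma scaleW_eq (hν : IsChain lam ν) (H : IsSkipFreeMeasure lam h) (x : ℝ) :
    scaleW h lam ν x = scaleSeq lam h 0 ⌊x / h⌋₊ := by
  have hprod : ∀ n, ∏ r ∈ Finset.range n,
      ν.real {ω : Path | depth h ω.1 ≤ ((r * h : ℝ) : EReal)} =
      scaleSeq lam h 0 0 / scaleSeq lam h 0 n := by
    intro n
    induction n with
    | zero => simp [div_self (H.scaleSeq_zero_pos 0).ne']
    | succ n ih =>
      rw [Finset.prod_range_succ, ih, hν.measureReal_depth_le H]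
      have := (H.scaleSeq_pos le_rfl n).ne'
      field_simp
  rw [scaleW, hprod, ← IsSkipFreeMeasure.mass_zero, ← scaleSeq_zero lam h 0]
  have := (H.scaleSeq_pos le_rfl ⌊x / h⌋₊).ne'
  have := (H.scaleSeq_zero_pos 0).ne'
  field_simp

end IsChain

/-- Càdlàg paths are bounded on compact intervals. -/
lemma IsCadlag.exists_bound {ω : ℝ≥0 → ℝ} (hω : IsCadlag ω) (T : ℝ≥0) :
    ∃ M : ℝ, ∀ s ≤ T, ω s ≤ M := by
  have key : ∃ M : ℝ, ∀ s ∈ Icc 0 T, ω s ≤ M := by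
    refine isCompact_Icc.induction_on (p := fun S => ∃ M : ℝ, ∀ s ∈ S, ω s ≤ M)
      ⟨0, fun s hs => hs.elim⟩ (fun S S' hSS' ⟨M, hM⟩ => ⟨M, fun s hs => hM s (hSS' hs)⟩)
      (fun S S' ⟨M, hM⟩ ⟨M', hM'⟩ => ⟨max M M', fun s hs => hs.elim
        (fun h => (hM s h).trans (le_max_left _ _)) fun h => (hM' s h).trans (le_max_right _ _)⟩)
      fun t _ => ?_
    obtain ⟨hr, l, hl⟩ := hω t
    have h1 : ∀ᶠ s in 𝓝[≥] t, ω s ≤ max (ω t + 1) (l + 1) :=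
      (hr.eventually (gt_mem_nhds (lt_add_one _))).mono fun s hs => hs.le.trans (le_max_left _ _)
    have h2 : ∀ᶠ s in 𝓝[<] t, ω s ≤ max (ω t + 1) (l + 1) :=
      (hl.eventually (gt_mem_nhds (lt_add_one _))).mono fun s hs => hs.le.trans (le_max_right _ _)
    have h3 : ∀ᶠ s in 𝓝 t, ω s ≤ max (ω t + 1) (l + 1) := by
      rw [← nhdsLT_sup_nhdsGE, eventually_sup]
      exact ⟨h2, h1⟩
    exact ⟨_, mem_nhdsWithin_of_mem_nhds h3, _, fun s hs => hs⟩
  obtain ⟨M, hM⟩ := key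
  exact ⟨M, fun s hs => hM s ⟨zero_le, hs⟩⟩

/-- A lattice value under -⌊x/h⌋h is at most -(⌊x/h⌋ + 1)h, which already lies under -x. -/
lemma IsGood.lt_neg_iff {h : ℝ} (hh : 0 < h) {ω : ℝ≥0 → ℝ} (hω : IsGood h ω) {x : ℝ} (hx : 0 ≤ x)
    (t : ℝ≥0) : ω t < -x ↔ ω t < -(⌊x / h⌋₊ * h) := by
  obtain ⟨k, hk⟩ := hω.2.2 t
  rw [hk]
  constructor
  · intro h1
    refine h1.trans_le (neg_le_neg ?_)
    exact (le_div_iff₀ hh).1 (Nat.floor_le (div_nonneg hx hh.le))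
  · intro h1
    rw [← neg_mul, mul_lt_mul_iff_left₀ hh] at h1
    have h2 : k + 1 ≤ -(⌊x / h⌋₊ : ℤ) := by
      have : k < -(⌊x / h⌋₊ : ℤ) := by exact_mod_cast h1
      omega
    have h3 : (k : ℝ) + 1 ≤ -(⌊x / h⌋₊ : ℝ) := by exact_mod_cast h2
    have h4 := Nat.lt_floor_add_one (x / h)
    have h5 : (k : ℝ) < -(x / h) := by linarith
    calc (k : ℝ) * h < -(x / h) * h := mul_lt_mul_of_pos_right h5 hh
      _ = -x := by field_simp

open Classical in
/-- The discounted indicator of the first passage below `-x` as a limit of two-sided exits. -/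
lemma IsGood.tendsto_exit_below {h : ℝ} (hh : 0 < h) {ω : ℝ≥0 → ℝ} (hω : IsGood h ω) {x : ℝ}
    (hx : 0 ≤ x) (q : ℝ) :
    Tendsto (fun N : ℕ => exitValue q (below h ⌊x / h⌋₊) (strip h ⌊x / h⌋₊ N) ω) atTop
      (𝓝 (if firstPassageBelow x ω < ∞ then
        Real.exp (-q * (firstPassageBelow x ω).toReal) else 0)) := by
  rw [firstPassageBelow_eq]
  set r := ⌊x / h⌋₊ with hr
  have hiff : ∀ t, ω t ∈ Ici (-x) ↔ -(r * h) ≤ ω t := fun t => by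
    rw [mem_Ici, ← not_lt, hω.lt_neg_iff hh hx, not_lt]
  rcases hω.exit_cases hh (Ici (-x)) with hall | ⟨T, hT, hlt⟩
  · rw [exitTime_eq_top hall, if_neg (lt_irrefl _)]
    refine tendsto_const_nhds.congr fun N => ?_
    rcases hω.exit_cases hh (strip h r N) with hall' | ⟨T, hT, hlt⟩
    · rw [exitValue_eq_zero _ _ hall']
    · rw [exitValue_eq _ _ hT hlt, below, indicator_of_notMem, mul_zero]
      exact not_lt.2 ((hiff T).1 (hall T))
  · rw [exitTime_eq hT hlt, if_pos ENNReal.coe_lt_top, ENNReal.coe_toReal]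
    -- Up to time T the path stays under M, so a strip with top above M can only be left below, at T
    -- itself.
    obtain ⟨M, hM⟩ := hω.1.exists_bound T
    have hev : ∀ᶠ N : ℕ in atTop, M < N * h :=
      (tendsto_natCast_atTop_atTop.atTop_mul_const hh).eventually_gt_atTop M
    refine tendsto_const_nhds.congr' (hev.mono fun N hN => ?_)
    have hTlt : ω T < -(r * h) := not_le.1 fun hc => hT ((hiff T).2 hc)
    have hT' : ω T ∉ strip h r N := fun hc => hTlt.not_ge hc.1
    have hlt' : ∀ s < T, ω s ∈ strip h r N := fun s hs =>
      ⟨(hiff s).1 (hlt s hs), (hM s hs.le).trans_lt hN⟩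
    simp only
    rw [exitValue_eq _ _ hT' hlt', below,
      indicator_of_mem (show ω T ∈ Iio _ from hTlt), mul_one]

open Classical in
lemma IsChain.tendsto_first_passage {lam : Measure ℝ} {ν : Measure Path} {h : ℝ}
    (hν : IsChain lam ν) (H : IsSkipFreeMeasure lam h) {q x : ℝ} (hq : 0 ≤ q) (hx : 0 ≤ x) :
    AEStronglyMeasurable (fun ω : Path => if firstPassageBelow x ω.1 < ∞ then
        Real.exp (-q * (firstPassageBelow x ω.1).toReal) else 0) ν ∧
    Tendsto (fun N : ℕ => scaleSeqZ lam h q ⌊x / h⌋₊ - scaleSeqZ lam h q (N + ⌊x / h⌋₊) *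
        (scaleSeq lam h q ⌊x / h⌋₊ / scaleSeq lam h q (N + ⌊x / h⌋₊))) atTop
      (𝓝 (∫ ω : Path, if firstPassageBelow x ω.1 < ∞ then
        Real.exp (-q * (firstPassageBelow x ω.1).toReal) else 0 ∂ν)) := by
  have := hν.prob
  have hm := fun N => (hν.integral_exit_below H hq ⌊x / h⌋₊ N).1
  have hlim := (hν.ae_isGood H).mono fun ω hω => hω.tendsto_exit_below H.h_pos hx q
  refine ⟨aestronglyMeasurable_of_tendsto_ae atTop hm hlim, ?_⟩
  have h1 := tendsto_integral_of_dominated_convergence (μ := ν) (fun _ => 1) hm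
      (integrable_const _) (fun n => ae_of_all _ fun ω =>
        abs_exitValue_le hq (abs_indicator_one_le _) _ ω.1) hlim
  exact h1.congr fun N => (hν.integral_exit_below H hq ⌊x / h⌋₊ N).2

end SkipFree

/-! ### Uniqueness in law, the Markov property, and cutting paths into unit blocks -/

namespace SkipFree

namespace IsChain

variable {lam : Measure ℝ} {ν : Measure Path}

lemma lintegral_mul_incr (hν : IsChain lam ν) [IsFiniteMeasure lam] (s t : ℝ≥0) {A : Set Path}
    (hA : MeasurableSet[pathSigma s] A) {g k : ℝ → ℝ≥0∞} (hg : Measurable g) (hk : Measurable k) :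
    ∫⁻ ω in A, g (ω.1 s) * k (ω.1 (s + t) - ω.1 s) ∂ν =
      (∫⁻ ω in A, g (ω.1 s) ∂ν) * ∫⁻ y, k y ∂cpLaw lam t := by
  have := hν.prob
  have hm : Measurable fun ω : Path => ω.1 (s + t) - ω.1 s :=
    (measurable_eval _).sub (measurable_eval _)
  have h1 : ∫⁻ ω in A, g (ω.1 s) * k (ω.1 (s + t) - ω.1 s) ∂ν =
      ∫⁻ p, g p.1 * k p.2 ∂((ν.restrict A).map fun ω => (ω.1 s, ω.1 (s + t) - ω.1 s)) := by
    rw [lintegral_map (by fun_prop) ((measurable_eval s).prodMk hm)]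
  rw [h1, hν.map_pair s t hA, lintegral_prod_mul hg.aemeasurable hk.aemeasurable,
    lintegral_map hg (measurable_eval s)]

lemma setLIntegral_step (hν : IsChain lam ν) [IsFiniteMeasure lam] (s t : ℝ≥0) {A : Set Path}
    (hA : MeasurableSet[pathSigma s] A) {g : ℝ → ℝ≥0∞} (hg : Measurable g) :
    ∫⁻ ω in A, g (ω.1 (s + t)) ∂ν = ∫⁻ ω in A, ∫⁻ y, g (ω.1 s + y) ∂cpLaw lam t ∂ν := by
  have := hν.prob
  have hm : Measurable fun ω : Path => ω.1 (s + t) - ω.1 s :=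
    (measurable_eval _).sub (measurable_eval _)
  have hmg : Measurable fun p : ℝ × ℝ => g (p.1 + p.2) := by fun_prop
  have h1 : ∫⁻ ω in A, g (ω.1 (s + t)) ∂ν =
      ∫⁻ p, g (p.1 + p.2) ∂((ν.restrict A).map fun ω => (ω.1 s, ω.1 (s + t) - ω.1 s)) := by
    rw [lintegral_map hmg ((measurable_eval s).prodMk hm)]
    simp
  rw [h1, hν.map_pair s t hA, lintegral_prod _ hmg.aemeasurable,
    lintegral_map hmg.lintegral_prod_right' (measurable_eval s)]

lemma measurableSet_cylinder (I : Finset ℝ≥0) {B : ℝ≥0 → Set ℝ} (hB : ∀ i, MeasurableSet (B i))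
    {s : ℝ≥0} (hs : ∀ i ∈ I, i ≤ s) :
    MeasurableSet[pathSigma s] {ω : Path | ∀ i ∈ I, ω.1 i ∈ B i} := by
  have : {ω : Path | ∀ i ∈ I, ω.1 i ∈ B i} =
      ⋂ i ∈ I, (fun ω : Path => ω.1 i) ⁻¹' (B i) := by ext; simp
  rw [this]
  exact I.measurableSet_biInter fun i hi => measurable_eval_pathSigma (hs i hi) (hB i)

/-- Induction on the largest time: the increment after it is integrated out. Allowing a test
function at any later time s lets the induction close. -/
lemma cylinder_eq {ν' : Measure Path} (hν : IsChain lam ν) (hν' : IsChain lam ν')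
    [IsFiniteMeasure lam] {B : ℝ≥0 → Set ℝ} (hB : ∀ i, MeasurableSet (B i)) (I : Finset ℝ≥0) :
    ∀ s : ℝ≥0, (∀ i ∈ I, i ≤ s) → ∀ g : ℝ → ℝ≥0∞, Measurable g →
      ∫⁻ ω in {ω : Path | ∀ i ∈ I, ω.1 i ∈ B i}, g (ω.1 s) ∂ν =
        ∫⁻ ω in {ω : Path | ∀ i ∈ I, ω.1 i ∈ B i}, g (ω.1 s) ∂ν' := by
  induction I using Finset.induction_on_max with
  | empty =>
    intro s _ g hg
    have key : ∀ {ν : Measure Path}, IsChain lam ν →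
        ∫⁻ ω in {ω : Path | ∀ i ∈ (∅ : Finset ℝ≥0), ω.1 i ∈ B i}, g (ω.1 s) ∂ν =
        ∫⁻ y, g y ∂cpLaw lam s := by
      intro ν hν
      have := hν.prob
      have h1 := hν.setLIntegral_step 0 s MeasurableSet.univ hg
      have h2 : {ω : Path | ∀ i ∈ (∅ : Finset ℝ≥0), ω.1 i ∈ B i} = univ := by ext; simp
      rw [zero_add] at h1
      rw [h2, h1, setLIntegral_univ]
      have h3 : ∀ᵐ ω ∂ν, ∫⁻ y, g (ω.1 0 + y) ∂cpLaw lam s = ∫⁻ y, g y ∂cpLaw lam s := by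
        filter_upwards [hν.zero] with ω hω
        simp [hω]
      rw [lintegral_congr_ae h3]
      simp
    rw [key hν, key hν']
  | insert t J hJ ih =>
    intro s hs g hg
    have hts : t ≤ s := hs t (Finset.mem_insert_self t J)
    obtain ⟨d, rfl⟩ := exists_add_of_le hts
    have hmg : Measurable fun x => ∫⁻ y, g (x + y) ∂cpLaw lam d :=
      Measurable.lintegral_prod_right' (f := fun p : ℝ × ℝ => g (p.1 + p.2)) (by fun_prop)
    have hJt : ∀ i ∈ J, i ≤ t := fun i hi => (hJ i hi).le
    have hset : {ω : Path | ∀ i ∈ insert t J, ω.1 i ∈ B i} =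
        (fun ω : Path => ω.1 t) ⁻¹' (B t) ∩ {ω : Path | ∀ i ∈ J, ω.1 i ∈ B i} := by
      ext ω; simp
    have key : ∀ {ν : Measure Path}, IsChain lam ν →
        ∫⁻ ω in {ω : Path | ∀ i ∈ insert t J, ω.1 i ∈ B i}, g (ω.1 (t + d)) ∂ν =
        ∫⁻ ω in {ω : Path | ∀ i ∈ J, ω.1 i ∈ B i},
          (B t).indicator (fun x => ∫⁻ y, g (x + y) ∂cpLaw lam d) (ω.1 t) ∂ν := by
      intro ν hν
      rw [hν.setLIntegral_step t d (measurableSet_cylinder _ hB fun i hi => by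
        rcases Finset.mem_insert.1 hi with rfl | hi
        exacts [le_rfl, hJt i hi]) hg, hset,
        ← Measure.restrict_restrict (measurable_eval t (hB t)),
        ← lintegral_indicator (measurable_eval t (hB t))]
      rfl
    rw [key hν, key hν', ih t hJt _ (hmg.indicator (hB t))]

/-- The law of the chain is determined by its Lévy measure. -/
theorem unique {ν' : Measure Path} (hν : IsChain lam ν) (hν' : IsChain lam ν')
    [IsFiniteMeasure lam] : ν = ν' := by
  have := hν.prob
  have := hν'.prob
  have hgen : (inferInstance : MeasurableSpace Path) = MeasurableSpace.generateFrom
      (preimage (Subtype.val : Path → ℝ≥0 → ℝ) ''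
        squareCylinders fun _ : ℝ≥0 => {s : Set ℝ | MeasurableSet s}) := by
    rw [← MeasurableSpace.comap_generateFrom, generateFrom_squareCylinders]
    rfl
  refine ext_of_generate_finite _ hgen
    ((isPiSystem_squareCylinders (fun _ => MeasurableSpace.isPiSystem_measurableSet)
      (fun _ => MeasurableSet.univ)).comap Subtype.val) ?_ (by simp)
  rintro _ ⟨_, ⟨I, B, hB, rfl⟩, rfl⟩
  have hB' : ∀ i, MeasurableSet (B i) := fun i => hB i (mem_univ i)
  have h1 := hν.cylinder_eq hν' hB' I (I.sup id) (fun i hi => Finset.le_sup (f := id) hi)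
    (fun _ => 1) measurable_const
  simp only [lintegral_const, one_mul, Measure.restrict_apply_univ] at h1
  have h2 : Subtype.val ⁻¹' ((I : Set ℝ≥0).pi B) = {ω : Path | ∀ i ∈ I, ω.1 i ∈ B i} := by
    ext ω; simp
  rw [h2, h1]

end IsChain

lemma IsCadlag.comp_mono {f : ℝ≥0 → ℝ} (hf : IsCadlag f) {φ : ℝ≥0 → ℝ≥0} (hφ : Monotone φ)
    (hφc : Continuous φ) : IsCadlag (fun t => f (φ t)) := by
  intro t
  refine ⟨(hf (φ t)).1.comp hφc.continuousWithinAt fun s hs => hφ hs, ?_⟩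
  -- If φ is flat just before t, the left limit is f(φ t); otherwise φ approaches φ t strictly from
  -- the left and the left limit of f is used.
  by_cases hex : ∃ s < t, φ s = φ t
  · obtain ⟨s, hst, hs⟩ := hex
    refine ⟨f (φ t), tendsto_const_nhds.congr' ?_⟩
    filter_upwards [Ioo_mem_nhdsLT hst] with r hr
    rw [le_antisymm (hφ hr.2.le) (hs ▸ hφ hr.1.le)]
  · push Not at hex
    obtain ⟨l, hl⟩ := (hf (φ t)).2
    refine ⟨l, hl.comp (tendsto_nhdsWithin_iff.2 ⟨hφc.continuousWithinAt, ?_⟩)⟩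
    filter_upwards [self_mem_nhdsWithin] with s hs
    exact lt_of_le_of_ne (hφ (le_of_lt hs)) (hex s hs)

lemma IsCadlag.sub {f g : ℝ≥0 → ℝ} (hf : IsCadlag f) (hg : IsCadlag g) :
    IsCadlag (fun t => f t - g t) := fun t =>
  ⟨(hf t).1.sub (hg t).1, by
    obtain ⟨l, hl⟩ := (hf t).2
    obtain ⟨l', hl'⟩ := (hg t).2
    exact ⟨l - l', hl.sub hl'⟩⟩

lemma isCadlag_const (a : ℝ) : IsCadlag fun _ => a := fun _ =>
  ⟨continuousWithinAt_const, a, tendsto_const_nhds⟩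

lemma isCadlag_sum (s : Finset ℕ) {f : ℕ → ℝ≥0 → ℝ} (hf : ∀ k, IsCadlag (f k)) :
    IsCadlag (fun t => ∑ k ∈ s, f k t) := fun t =>
  ⟨tendsto_finsetSum _ fun k _ => (hf k t).1, by
    choose l hl using fun k => (hf k t).2
    exact ⟨_, tendsto_finsetSum _ fun k _ => hl k⟩⟩

lemma IsCadlag.of_local {f : ℝ≥0 → ℝ} (hf : ∀ N : ℕ, ∃ g, IsCadlag g ∧ ∀ t < (N : ℝ≥0), f t = g t) :
    IsCadlag f := by
  intro t
  obtain ⟨N, hN⟩ := exists_nat_gt t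
  obtain ⟨g, hg, hfg⟩ := hf N
  have hev : f =ᶠ[𝓝 t] g := by
    filter_upwards [gt_mem_nhds hN] with s hs using hfg s hs
  refine ⟨(hg t).1.congr_of_eventuallyEq (hev.filter_mono nhdsWithin_le_nhds) (hfg t hN), ?_⟩
  obtain ⟨l, hl⟩ := (hg t).2
  exact ⟨l, hl.congr' (hev.filter_mono nhdsWithin_le_nhds).symm⟩

/-- The path after time `s`, restarted at `0`. -/
def shift (s : ℝ≥0) (ω : Path) : Path :=
  ⟨fun t => ω.1 (s + t) - ω.1 s,
    (ω.2.comp_mono (fun _ _ h => by gcongr) (by fun_prop)).sub (isCadlag_const _)⟩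

lemma measurable_path_of_eval {Ω : Type*} {mΩ : MeasurableSpace Ω} {F : Ω → Path}
    (hF : ∀ t, Measurable fun x => (F x).1 t) : Measurable F :=
  Measurable.subtype_mk (f := fun x => (F x).1) (measurable_pi_lambda _ hF) (h := fun x => (F x).2)

lemma measurable_shift (s : ℝ≥0) : Measurable (shift s) :=
  measurable_path_of_eval fun _ => (measurable_eval _).sub (measurable_eval _)

lemma measurable_shift_pathSigma (s r : ℝ≥0) :
    Measurable[pathSigma (s + r), pathSigma r] (shift s) := by
  rw [measurable_iff_comap_le]
  rw [MeasurableSpace.comap_iSup]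
  refine iSup_le fun t => ?_
  rw [MeasurableSpace.comap_iSup]
  refine iSup_le fun ht => ?_
  rw [MeasurableSpace.comap_comp]
  refine Measurable.comap_le ?_
  exact Measurable.sub (m := pathSigma (s + r))
    (measurable_eval_pathSigma (by gcongr)) (measurable_eval_pathSigma le_self_add)

namespace IsChain

variable {lam : Measure ℝ} {ν : Measure Path}

/-- The Markov property at a fixed time, at the level of paths. -/
lemma markov (hν : IsChain lam ν) [IsFiniteMeasure lam] (s : ℝ≥0) {A : Set Path}
    (hA : MeasurableSet[pathSigma s] A) {B : Set Path} (hB : MeasurableSet B) :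
    ν (A ∩ shift s ⁻¹' B) = ν A * ν B := by
  have := hν.prob
  by_cases h0 : ν A = 0
  · rw [h0, zero_mul]
    exact measure_mono_null inter_subset_left h0
  have hA' : MeasurableSet A := pathSigma_le _ _ hA
  have hval : ∀ C, MeasurableSet C →
      ((ν A)⁻¹ • (ν.restrict A).map (shift s)) C = (ν A)⁻¹ * ν (A ∩ shift s ⁻¹' C) := by
    intro C hC
    rw [Measure.smul_apply, smul_eq_mul, Measure.map_apply (measurable_shift s) hC,
      Measure.restrict_apply (measurable_shift s hC), inter_comm]
  -- Conditionally on A the shifted path is again a chain with the same Lévy measure, so uniqueness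
  -- identifies its law with ν.
  have hchain : IsChain lam ((ν A)⁻¹ • (ν.restrict A).map (shift s)) := by
    refine ⟨⟨?_⟩, ?_, fun r t C hC D hD => ?_⟩
    · rw [hval _ MeasurableSet.univ, preimage_univ, inter_univ,
        ENNReal.inv_mul_cancel h0 (measure_ne_top _ _)]
    · have hm : MeasurableSet {ω : Path | ω.1 0 = 0} :=
        measurable_eval 0 (measurableSet_singleton 0)
      have h2 : ((ν A)⁻¹ • (ν.restrict A).map (shift s)) {ω : Path | ω.1 0 = 0}ᶜ = 0 := by
        rw [hval _ hm.compl]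
        have : shift s ⁻¹' {ω : Path | ω.1 0 = 0}ᶜ = ∅ := by
          ext ω; simp [shift]
        rw [this]; simp
      exact h2
    · have hC' : MeasurableSet C := pathSigma_le _ _ hC
      have hm : Measurable fun ω : Path => ω.1 (r + t) - ω.1 r :=
        (measurable_eval _).sub (measurable_eval _)
      rw [hval (C ∩ {ω | ω.1 (r + t) - ω.1 r ∈ D}) (hC'.inter (hm hD)), hval _ hC', mul_assoc]
      congr 1
      have h3 := hν.incr (s + r) t (A ∩ shift s ⁻¹' C)
        ((pathSigma_mono le_self_add _ hA).inter (measurable_shift_pathSigma s r hC)) D hD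
      rw [← h3]
      congr 1
      ext ω
      simp [shift, and_assoc, add_assoc]
  have heq := hchain.unique hν
  have h4 := hval B hB
  rw [heq] at h4
  rw [h4, ← mul_assoc, ENNReal.mul_inv_cancel h0 (measure_ne_top _ _), one_mul]

lemma map_shift (hν : IsChain lam ν) [IsFiniteMeasure lam] (s : ℝ≥0) : ν.map (shift s) = ν := by
  have := hν.prob
  ext B hB
  rw [Measure.map_apply (measurable_shift s) hB]
  simpa using hν.markov s (A := univ) MeasurableSet.univ hB

lemma lintegral_mul_shift (hν : IsChain lam ν) [IsFiniteMeasure lam] (s : ℝ≥0)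
    {F G : Path → ℝ≥0∞} (hF : Measurable[pathSigma s] F) (hG : Measurable G) :
    ∫⁻ ω, F ω * G (shift s ω) ∂ν = (∫⁻ ω, F ω ∂ν) * ∫⁻ ω, G ω ∂ν := by
  have := hν.prob
  have hind : Indep (pathSigma s) (MeasurableSpace.comap (shift s) inferInstance) ν := by
    rw [Indep_iff]
    rintro A _ hA ⟨B, hB, rfl⟩
    rw [hν.markov s hA hB, ← Measure.map_apply (measurable_shift s) hB, hν.map_shift]
  have hGs : Measurable[MeasurableSpace.comap (shift s) inferInstance] fun ω => G (shift s ω) :=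
    hG.comp (comap_measurable (shift s))
  rw [lintegral_mul_eq_lintegral_mul_lintegral_of_independent_measurableSpace (pathSigma_le s)
    (measurable_shift s).comap_le hind hF hGs]
  congr 1
  rw [← lintegral_map hG (measurable_shift s), hν.map_shift]

end IsChain

/-- The increment path over `[k, k + 1]`, stopped at its end. -/
def block (k : ℕ) (ω : Path) : Path :=
  ⟨fun t => ω.1 (k + min t 1) - ω.1 k,
    (ω.2.comp_mono (fun _ _ h => by gcongr) (by fun_prop)).sub (isCadlag_const _)⟩

lemma block_eq (k : ℕ) (ω : Path) : block k ω = block 0 (shift k ω) := by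
  ext t
  simp [block, shift]

lemma measurable_block_pathSigma {k n : ℕ} (hk : k < n) : Measurable[pathSigma n] (block k) := by
  refine @measurable_path_of_eval _ (pathSigma n) _ fun t => ?_
  have h1 : (k : ℝ≥0) + 1 ≤ n := by exact_mod_cast hk
  exact Measurable.sub (m := pathSigma n)
    (measurable_eval_pathSigma ((add_le_add_right (min_le_right t 1) _).trans h1))
    (measurable_eval_pathSigma (le_self_add.trans h1))

lemma measurable_block (k : ℕ) : Measurable (block k) :=
  (measurable_block_pathSigma (Nat.lt_succ_self k)).mono (pathSigma_le _) le_rfl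

/-- The path with given increments over the successive unit intervals. -/
noncomputable def concat (x : ℕ → Path) : Path :=
  ⟨fun t => ∑ k ∈ Finset.range (⌊t⌋₊ + 1), ((x k).1 (min (t - k) 1) - (x k).1 0),
    -- For t < N the random number of summands may be replaced by N: blocks with k > t contribute 0,
    -- as t - k is truncated to 0 in `ℝ≥0`.
    IsCadlag.of_local fun N => ⟨fun t => ∑ k ∈ Finset.range N,
      ((x k).1 (min (t - k) 1) - (x k).1 0),
      isCadlag_sum _ fun k => ((x k).2.comp_mono
        (fun _ _ h => min_le_min_right _ (tsub_le_tsub_right h _)) (by fun_prop)).sub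
          (isCadlag_const _), fun t ht => by
        refine Finset.sum_subset (fun k hk => ?_) fun k _ hk => ?_
        · have h1 := Nat.lt_succ_iff.1 (Finset.mem_range.1 hk)
          have h2 : (⌊t⌋₊ : ℝ≥0) < N := (Nat.floor_le zero_le).trans_lt ht
          exact Finset.mem_range.2 (h1.trans_lt (by exact_mod_cast h2))
        · have h1 : t < k := (Nat.floor_lt zero_le).1 (by
            have : ¬ k < ⌊t⌋₊ + 1 := fun hc => hk (Finset.mem_range.2 hc)
            omega)
          simp [tsub_eq_zero_of_le h1.le]⟩⟩

lemma concat_eq (x : ℕ → Path) {n : ℕ} {t : ℝ≥0} (ht : t ≤ n) :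
    (concat x).1 t = ∑ k ∈ Finset.range n, ((x k).1 (min (t - k) 1) - (x k).1 0) := by
  have key : ∀ m : ℕ, t ≤ m → ∑ k ∈ Finset.range (m + 1), ((x k).1 (min (t - k) 1) - (x k).1 0) =
      ∑ k ∈ Finset.range m, ((x k).1 (min (t - k) 1) - (x k).1 0) := fun m hm => by
    rw [Finset.sum_range_succ, tsub_eq_zero_of_le hm]
    simp
  have key2 : ∀ m : ℕ, t ≤ m → ∀ d, ∑ k ∈ Finset.range (m + d),
      ((x k).1 (min (t - k) 1) - (x k).1 0) =
      ∑ k ∈ Finset.range m, ((x k).1 (min (t - k) 1) - (x k).1 0) := fun m hm d => by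
    induction d with
    | zero => rfl
    | succ d ih =>
      rw [← ih, ← add_assoc, key (m + d)]
      push_cast
      exact hm.trans le_self_add
  have h1 : t ≤ ((⌊t⌋₊ + 1 : ℕ) : ℝ≥0) := by
    push_cast
    exact (Nat.lt_floor_add_one t).le
  have h2 := key2 _ h1 n
  have h3 := key2 n ht (⌊t⌋₊ + 1)
  rw [add_comm n] at h3
  exact h2.symm.trans h3

/-- The block increments telescope; only the initial value of the path is lost. -/
lemma concat_block (ω : Path) (t : ℝ≥0) :
    (concat fun k => block k ω).1 t = ω.1 t - ω.1 0 := by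
  obtain ⟨n, hn⟩ := exists_nat_ge t
  rw [concat_eq _ hn]
  have h1 : ∀ k : ℕ, (block k ω).1 (min (t - k) 1) - (block k ω).1 0 =
      ω.1 (min t ((k + 1 : ℕ) : ℝ≥0)) - ω.1 (min t (k : ℕ)) := by
    intro k
    rcases le_total t k with h | h
    · rw [tsub_eq_zero_of_le h, min_eq_left h,
        min_eq_left (h.trans (by push_cast; exact le_self_add))]
      simp
    · simp only [block, min_eq_left (min_le_right (t - (k : ℝ≥0)) 1), zero_le, inf_of_le_left,
        add_zero, sub_self, sub_zero]
      rw [min_eq_right h, ← min_add_add_left, add_tsub_cancel_of_le h]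
      push_cast
      rfl
  rw [Finset.sum_congr rfl fun k _ => h1 k,
    Finset.sum_range_sub (fun k : ℕ => ω.1 (min t (k : ℝ≥0)))]
  simp [min_eq_left hn]

lemma measurable_concat : Measurable concat := by
  refine measurable_path_of_eval fun t => ?_
  have h1 : ∀ (k : ℕ) (s : ℝ≥0), Measurable fun x : ℕ → Path => (x k).1 s := fun k s =>
    (measurable_eval s).comp (measurable_pi_apply k)
  simp only [concat]
  exact Finset.measurable_fun_sum _ fun k _ => Measurable.sub (h1 k _) (h1 k _)

end SkipFree

/-! ### The exponential change of measure: the tilted chain and its existence -/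

namespace SkipFree

/-- The density of the exponential change of measure on `F_t`. -/
noncomputable def expDensity (lam : Measure ℝ) (c : ℝ) (t : ℝ≥0) (ω : Path) : ℝ≥0∞ :=
  ENNReal.ofReal (Real.exp (c * ω.1 t - psi lam c * t))

lemma measurable_expDensity_pathSigma (lam : Measure ℝ) (c : ℝ) (t : ℝ≥0) :
    Measurable[pathSigma t] (expDensity lam c t) :=
  (by fun_prop : Measurable fun x : ℝ =>
    ENNReal.ofReal (Real.exp (c * x - psi lam c * t))).comp (measurable_eval_pathSigma le_rfl)

lemma measurable_expDensity (lam : Measure ℝ) (c : ℝ) (t : ℝ≥0) :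
    Measurable (expDensity lam c t) :=
  (measurable_expDensity_pathSigma lam c t).mono (pathSigma_le t) le_rfl

lemma expDensity_add (lam : Measure ℝ) (c : ℝ) (s t : ℝ≥0) (ω : Path) :
    expDensity lam c (s + t) ω = expDensity lam c s ω *
      ENNReal.ofReal (Real.exp (c * (ω.1 (s + t) - ω.1 s) - psi lam c * t)) := by
  rw [expDensity, expDensity, ← ENNReal.ofReal_mul (Real.exp_pos _).le, ← Real.exp_add]
  congr 2
  push_cast
  ring

lemma isExpChange_iff {lam : Measure ℝ} {μ ν : Measure Path} {c : ℝ} :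
    IsExpChange lam μ c ν ↔ ∀ (t : ℝ≥0) (Λ : Set Path), MeasurableSet[pathSigma t] Λ →
      ν Λ = ∫⁻ ω in Λ, expDensity lam c t ω ∂μ := Iff.rfl

namespace IsChain

variable {lam : Measure ℝ} {ν μ : Measure Path} {h c : ℝ}

/-- The density at s + t is the one at s times a function of the increment. Independence splits the
integral, and the increment factor integrates to the tilted compound Poisson law. -/
lemma setLIntegral_expDensity_mul (hμ : IsChain lam μ) (H : IsSkipFreeMeasure lam h)
    (hc : 0 ≤ c) (s t : ℝ≥0) {A : Set Path} (hA : MeasurableSet[pathSigma s] A) {B : Set ℝ}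
    (hB : MeasurableSet B) :
    ∫⁻ ω in A ∩ {ω | ω.1 (s + t) - ω.1 s ∈ B}, expDensity lam c (s + t) ω ∂μ =
      (∫⁻ ω in A, expDensity lam c s ω ∂μ) * cpLaw (expLevy lam c) t B := by
  have := H.finite
  have hm : Measurable fun ω : Path => ω.1 (s + t) - ω.1 s :=
    (measurable_eval _).sub (measurable_eval _)
  set k : ℝ → ℝ≥0∞ := fun y => B.indicator (fun _ => 1) y *
    ENNReal.ofReal (Real.exp (c * y - psi lam c * t)) with hk
  have hkm : Measurable k := (measurable_const.indicator hB).mul (by fun_prop)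
  have h1 := hμ.lintegral_mul_incr s t hA
    (g := fun x => ENNReal.ofReal (Real.exp (c * x - psi lam c * s))) (by fun_prop) hkm
  have h2 : ∫⁻ y, k y ∂cpLaw lam t = cpLaw (expLevy lam c) t B := by
    rw [hk, H.lintegral_cpLaw_exp hc t (measurable_const.indicator hB), lintegral_indicator hB]
    simp
  rw [h2] at h1
  change _ = (∫⁻ ω in A, ENNReal.ofReal (Real.exp (c * ω.1 s - psi lam c * s)) ∂μ) * _
  rw [← h1, inter_comm, ← Measure.restrict_restrict (show MeasurableSet
    {ω : Path | ω.1 (s + t) - ω.1 s ∈ B} from hm hB), ← lintegral_indicator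
    (show MeasurableSet {ω : Path | ω.1 (s + t) - ω.1 s ∈ B} from hm hB)]
  refine lintegral_congr fun ω => ?_
  by_cases hω : ω.1 (s + t) - ω.1 s ∈ B
  · rw [indicator_of_mem (show ω ∈ {ω : Path | ω.1 (s + t) - ω.1 s ∈ B} from hω), expDensity_add,
      hk]
    simp only [indicator_of_mem hω, one_mul]
    rfl
  · rw [indicator_of_notMem (show ω ∉ {ω : Path | ω.1 (s + t) - ω.1 s ∈ B} from hω), hk]
    simp only [indicator_of_notMem hω, zero_mul, mul_zero]

/-- The martingale property of the density, which makes the prescriptions on the σ-algebras F_t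
consistent. -/
lemma setLIntegral_expDensity_add (hμ : IsChain lam μ) (H : IsSkipFreeMeasure lam h)
    (hc : 0 ≤ c) (s t : ℝ≥0) {A : Set Path} (hA : MeasurableSet[pathSigma s] A) :
    ∫⁻ ω in A, expDensity lam c (s + t) ω ∂μ = ∫⁻ ω in A, expDensity lam c s ω ∂μ := by
  have := (H.withDensity_exp hc).finite
  have h1 := hμ.setLIntegral_expDensity_mul H hc s t hA MeasurableSet.univ
  simpa using h1

lemma lintegral_expDensity (hμ : IsChain lam μ) (H : IsSkipFreeMeasure lam h)
    (hc : 0 ≤ c) (t : ℝ≥0) : ∫⁻ ω, expDensity lam c t ω ∂μ = 1 := by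
  have := hμ.prob
  have h1 := hμ.setLIntegral_expDensity_add H hc 0 t MeasurableSet.univ
  rw [zero_add, setLIntegral_univ, setLIntegral_univ] at h1
  have h2 : ∀ᵐ ω ∂μ, expDensity lam c 0 ω = 1 := by
    filter_upwards [hμ.zero] with ω hω
    simp [expDensity, hω]
  rw [h1, lintegral_congr_ae h2]
  simp

/-- Under the exponential change of measure the process is a chain with tilted Lévy measure. -/
theorem of_isExpChange (hμ : IsChain lam μ) (H : IsSkipFreeMeasure lam h) (hc : 0 ≤ c)
    (hν : IsExpChange lam μ c ν) : IsChain (expLevy lam c) ν := by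
  rw [isExpChange_iff] at hν
  refine ⟨⟨?_⟩, ?_, fun s t A hA B hB => ?_⟩
  · rw [hν 0 univ MeasurableSet.univ, setLIntegral_univ, hμ.lintegral_expDensity H hc]
  · have hm : MeasurableSet[pathSigma 0] {ω : Path | ω.1 0 = 0}ᶜ :=
      (measurable_eval_pathSigma le_rfl (measurableSet_singleton (0 : ℝ))).compl
    have h1 := hν 0 _ hm
    rw [Measure.restrict_eq_zero.2 (show μ {ω : Path | ω.1 0 = 0}ᶜ = 0 from hμ.zero),
      lintegral_zero_measure] at h1
    exact h1
  · have hm : MeasurableSet[pathSigma (s + t)] {ω : Path | ω.1 (s + t) - ω.1 s ∈ B} :=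
      Measurable.sub (m := pathSigma (s + t)) (measurable_eval_pathSigma le_rfl)
        (measurable_eval_pathSigma le_self_add) hB
    rw [hν (s + t) _ ((pathSigma_mono le_self_add _ hA).inter hm), hν s A hA,
      hμ.setLIntegral_expDensity_mul H hc s t hA hB]

/-- Blocks are independent and identically distributed and the density is multiplicative, so the
last block peels off by the Markov property. -/
lemma lintegral_blocks (hμ : IsChain lam μ) [IsFiniteMeasure lam] {B : ℕ → Set Path}
    (hB : ∀ k, MeasurableSet (B k)) (n : ℕ) :
    ∫⁻ ω, (∏ k ∈ Finset.range n, (B k).indicator 1 (block k ω)) * expDensity lam c n ω ∂μ =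
      (∫⁻ ω, expDensity lam c 0 ω ∂μ) * ∏ k ∈ Finset.range n,
        (∫⁻ ω, (B k).indicator 1 (block 0 ω) * expDensity lam c 1 ω ∂μ) := by
  induction n with
  | zero => simp
  | succ n ih =>
    rw [Finset.prod_range_succ, ← mul_assoc, ← ih, ← hμ.lintegral_mul_shift n
      (F := fun ω => (∏ k ∈ Finset.range n, (B k).indicator 1 (block k ω)) * expDensity lam c n ω)
      (G := fun ω => (B n).indicator 1 (block 0 ω) * expDensity lam c 1 ω)]
    · refine lintegral_congr fun ω => ?_
      rw [← block_eq, Finset.prod_range_succ, Nat.cast_succ, expDensity_add]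
      simp only [expDensity, shift]
      ring
    · refine Measurable.mul (m := pathSigma n) ?_ (measurable_expDensity_pathSigma lam c n)
      refine Finset.measurable_fun_prod (m := pathSigma n) _ fun k hk => ?_
      exact (measurable_one.indicator (hB k)).comp
        (measurable_block_pathSigma (Finset.mem_range.1 hk))
    · exact ((measurable_one.indicator (hB n)).comp (measurable_block 0)).mul
        (measurable_expDensity lam c 1)

/-- Existence of the exponential change of measure on path space. -/
theorem exists_isExpChange (hμ : IsChain lam μ) (H : IsSkipFreeMeasure lam h) (hc : 0 ≤ c) :
    ∃ ν, IsExpChange lam μ c ν := by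
  have := hμ.prob
  have := H.finite
  -- The tilted law of one unit block. P_c will be the law of the concatenation of independent
  -- blocks with law τ.
  set τ : Measure Path := (μ.withDensity (expDensity lam c 1)).map (block 0) with hτ
  have hτval : ∀ B, MeasurableSet B →
      τ B = ∫⁻ ω, B.indicator 1 (block 0 ω) * expDensity lam c 1 ω ∂μ := by
    intro B hB
    rw [hτ, Measure.map_apply (measurable_block 0) hB, withDensity_apply _ (measurable_block 0 hB),
      ← lintegral_indicator (measurable_block 0 hB)]
    refine lintegral_congr fun ω => ?_
    by_cases hω : block 0 ω ∈ B
    · rw [indicator_of_mem (show ω ∈ block 0 ⁻¹' B from hω), indicator_of_mem hω, Pi.one_apply,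
        one_mul]
    · rw [indicator_of_notMem (show ω ∉ block 0 ⁻¹' B from hω), indicator_of_notMem hω, zero_mul]
  have hτp : IsProbabilityMeasure τ := ⟨by
    rw [hτval _ MeasurableSet.univ]
    simpa using hμ.lintegral_expDensity H hc 1⟩
  have hD0 : ∫⁻ ω, expDensity lam c 0 ω ∂μ = 1 := hμ.lintegral_expDensity H hc 0
  set Q := Measure.infinitePi fun _ : ℕ => τ with hQ
  have hblocks : Measurable fun (ω : Path) (k : ℕ) => block k ω :=
    measurable_pi_lambda _ measurable_block
  -- the joint law of the first blocks
  have hlaw : ∀ n : ℕ, Q.map (Finset.range n).restrict =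
      ((μ.withDensity (expDensity lam c n)).map fun ω k => block k ω).map
        (Finset.range n).restrict := by
    intro n
    rw [hQ, Measure.infinitePi_map_restrict]
    refine Measure.pi_eq fun B hB => ?_
    rw [Measure.map_map (Finset.measurable_restrict _) hblocks, Measure.map_apply
      ((Finset.measurable_restrict _).comp hblocks) (MeasurableSet.univ_pi hB)]
    classical
    set B' : ℕ → Set Path := fun k => if hk : k ∈ Finset.range n then B ⟨k, hk⟩ else univ with hB'
    have hB'm : ∀ k, MeasurableSet (B' k) := fun k => by
      simp only [hB']
      split_ifs with hk
      exacts [hB _, MeasurableSet.univ]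
    have h1 : ∏ i, τ (B i) = ∏ k ∈ Finset.range n, τ (B' k) := by
      rw [← Finset.prod_coe_sort (Finset.range n) fun k => τ (B' k)]
      refine Finset.prod_congr rfl fun i _ => ?_
      simp only [hB']
      rw [dif_pos i.2]
    have h2 := hμ.lintegral_blocks (c := c) hB'm n
    simp only [← hτval _ (hB'm _)] at h2
    rw [hD0, one_mul] at h2
    rw [h1, ← h2, withDensity_apply _
      (((Finset.measurable_restrict _).comp hblocks) (MeasurableSet.univ_pi hB)),
      ← lintegral_indicator (((Finset.measurable_restrict _).comp hblocks) (MeasurableSet.univ_pi hB))]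
    refine lintegral_congr fun ω => ?_
    by_cases hω : ∀ k ∈ Finset.range n, block k ω ∈ B' k
    · have hprod : ∏ k ∈ Finset.range n, (B' k).indicator (1 : Path → ℝ≥0∞) (block k ω) = 1 :=
        Finset.prod_eq_one fun k hk => by rw [indicator_of_mem (hω k hk), Pi.one_apply]
      rw [hprod, one_mul, indicator_of_mem]
      simp only [mem_preimage, mem_univ_pi, Function.comp_apply, Finset.restrict]
      intro i
      have := hω i i.2
      simp only [hB'] at this
      rwa [dif_pos i.2] at this
    · rw [indicator_of_notMem]
      · push Not at hω
        obtain ⟨k, hk, hkω⟩ := hω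
        rw [Finset.prod_eq_zero hk (indicator_of_notMem hkω _), zero_mul]
      · simp only [mem_preimage, mem_univ_pi, Function.comp_apply, Finset.restrict]
        intro hc'
        refine hω fun k hk => ?_
        simp only [hB']
        rw [dif_pos hk]
        exact hc' ⟨k, hk⟩
  -- the change of measure at integer times
  have hnat : ∀ (n : ℕ) (Λ : Set Path), MeasurableSet[pathSigma n] Λ →
      Q.map concat Λ = ∫⁻ ω in Λ, expDensity lam c n ω ∂μ := by
    intro n Λ hΛ
    set ρ : Path → Iic (n : ℝ≥0) → ℝ := fun ω t => ω.1 t with hρ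
    have hle : pathSigma n ≤ MeasurableSpace.comap ρ MeasurableSpace.pi := by
      refine iSup₂_le fun s hs => ?_
      have : (fun ω : Path => ω.1 s) = (fun f : Iic (n : ℝ≥0) → ℝ => f ⟨s, hs⟩) ∘ ρ := rfl
      rw [this, ← MeasurableSpace.comap_comp]
      exact MeasurableSpace.comap_mono (measurable_pi_apply _).comap_le
    obtain ⟨Λ', hΛ', rfl⟩ := hle _ hΛ
    -- Sets of F_n depend only on the path over [0, n], which for a concatenation is a function Θ of
    -- the first n blocks.
    set Θ : (Finset.range n → Path) → Iic (n : ℝ≥0) → ℝ := fun x t =>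
      ∑ k, ((x k).1 (min (t.1 - (k : ℕ)) 1) - (x k).1 0) with hΘ
    have hΘm : Measurable Θ := by
      refine measurable_pi_lambda _ fun t => ?_
      have h1 : ∀ (k : Finset.range n) (s : ℝ≥0),
          Measurable fun x : Finset.range n → Path => (x k).1 s := fun k s =>
        (measurable_eval s).comp (measurable_pi_apply k)
      exact Finset.measurable_fun_sum _ fun k _ => Measurable.sub (h1 k _) (h1 k _)
    have hcomp : ∀ x : ℕ → Path, ρ (concat x) = Θ ((Finset.range n).restrict x) := by
      intro x
      ext t
      simp only [hρ, hΘ, Finset.restrict]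
      rw [concat_eq x t.2]
      exact (Finset.sum_coe_sort (Finset.range n)
        fun k => (x k).1 (min (t.1 - (k : ℕ)) 1) - (x k).1 0).symm
    have hm0 : MeasurableSet (ρ ⁻¹' Λ') := pathSigma_le _ _ hΛ
    rw [Measure.map_apply measurable_concat hm0]
    have e1 : concat ⁻¹' (ρ ⁻¹' Λ') = (Finset.range n).restrict ⁻¹' (Θ ⁻¹' Λ') := by
      ext x; simp only [mem_preimage, hcomp]
    rw [e1, ← Measure.map_apply (Finset.measurable_restrict _) (hΘm hΛ'), hlaw,
      Measure.map_apply (Finset.measurable_restrict _) (hΘm hΛ'), ← e1,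
      Measure.map_apply hblocks (measurable_concat hm0), ← withDensity_apply _ hm0]
    refine measure_congr ?_
    -- Reassembling the blocks of ω returns ω only if ω starts at 0, hence almost everywhere.
    have hae : ∀ᵐ ω ∂(μ.withDensity (expDensity lam c n)), ω.1 0 = 0 :=
      (withDensity_absolutelyContinuous _ _).ae_le hμ.zero
    filter_upwards [hae] with ω hω
    have e2 : ρ (concat fun k => block k ω) = ρ ω := by
      ext t
      simp only [hρ]
      rw [concat_block, hω, sub_zero]
    exact propext (show ρ (concat fun k => block k ω) ∈ Λ' ↔ ρ ω ∈ Λ' by rw [e2])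
  refine ⟨Q.map concat, isExpChange_iff.2 fun t Λ hΛ => ?_⟩
  obtain ⟨n, hn⟩ := exists_nat_ge t
  obtain ⟨d, hd⟩ := exists_add_of_le hn
  rw [hnat n Λ (pathSigma_mono hn _ hΛ), hd, hμ.setLIntegral_expDensity_add H hc t d hΛ]

/-- Every ν with the defining property is a tilted chain, so existence suffices to control the
measure chosen by `Classical.epsilon`. -/
theorem isChain_expChange (hμ : IsChain lam μ) (H : IsSkipFreeMeasure lam h) (hc : 0 ≤ c) :
    IsChain (expLevy lam c) (SkipFree.expChange lam μ c) :=
  hμ.of_isExpChange H hc (Classical.epsilon_spec (hμ.exists_isExpChange H hc))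

end IsChain

end SkipFree

/-! ### Transfer from the process to path space, and identification of W^{(q)} and Z^{(q)} -/

namespace SkipFree

lemma IsUpwardsSkipFreeLevyChain.map_eq_cpLaw {Ω : Type*} {m : MeasurableSpace Ω}
    {𝓕 : Filtration ℝ≥0 m} {P : Measure Ω} [IsProbabilityMeasure P] {X : ℝ≥0 → Ω → ℝ}
    {lam : Measure ℝ} {h : ℝ} (hX : IsUpwardsSkipFreeLevyChain 𝓕 P X lam h) (t : ℝ≥0) :
    P.map (X t) = cpLaw lam t := by
  have := hX.finite
  have hm : Measurable (X t) := (hX.adapted t).mono (𝓕.le t) le_rfl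
  have := Measure.isProbabilityMeasure_map (μ := P) hm.aemeasurable
  refine Measure.ext_of_charFun ?_
  ext p
  rw [charFun_cpLaw, ← hX.charFun_eq, charFun_apply_real, integral_map hm.aemeasurable (by fun_prop)]
  refine integral_congr_ae (ae_of_all _ fun ω => ?_)
  simp only
  congr 1
  ring

/-- The law on path space of an upwards skip-free Lévy chain. -/
theorem IsUpwardsSkipFreeLevyChain.isChain_pathLaw {Ω : Type*} {m : MeasurableSpace Ω}
    {𝓕 : Filtration ℝ≥0 m} {P : Measure Ω} [IsProbabilityMeasure P] {X : ℝ≥0 → Ω → ℝ}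
    {lam : Measure ℝ} {h : ℝ} (hX : IsUpwardsSkipFreeLevyChain 𝓕 P X lam h) :
    IsChain lam (pathLaw P X hX.cadlag) := by
  have hm : ∀ t, Measurable (X t) := fun t => (hX.adapted t).mono (𝓕.le t) le_rfl
  set Ξ : Ω → Path := fun ω => ⟨fun t => X t ω, hX.cadlag ω⟩ with hΞ
  have hΞm : Measurable Ξ := measurable_path_of_eval fun t => hm t
  refine ⟨Measure.isProbabilityMeasure_map hΞm.aemeasurable, ?_, fun s t A hA B hB => ?_⟩
  · exact (ae_map_iff hΞm.aemeasurable
      (measurable_eval 0 (measurableSet_singleton 0))).2 hX.zero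
  · have hA' : MeasurableSet[𝓕 s] (Ξ ⁻¹' A) := by
      have : (pathSigma s).comap Ξ ≤ 𝓕 s := by
        simp only [pathSigma, MeasurableSpace.comap_iSup, MeasurableSpace.comap_comp]
        exact iSup₂_le fun r hr => ((hX.adapted r).mono (𝓕.mono hr) le_rfl).comap_le
      exact this _ ⟨A, hA, rfl⟩
    have hAm := pathSigma_le _ _ hA
    have hD : MeasurableSet {ω : Path | ω.1 (s + t) - ω.1 s ∈ B} :=
      ((measurable_eval _).sub (measurable_eval _)) hB
    have h1 := (Indep_iff _ _ _).1 (hX.indep s t) (Ξ ⁻¹' A)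
      ((fun ω => X (s + t) ω - X s ω) ⁻¹' B) hA' ⟨B, hB, rfl⟩
    rw [pathLaw, Measure.map_apply hΞm (hAm.inter hD), Measure.map_apply hΞm hAm]
    refine h1.trans ?_
    rw [← hX.map_eq_cpLaw, ← (hX.stationary s t).map_eq,
      Measure.map_apply (show Measurable fun ω => X (s + t) ω - X s ω from (hm _).sub (hm _)) hB]

variable {lam : Measure ℝ} {μ : Measure Path} {h : ℝ}

/-- Under P_{Φ(q)} the depth formula gives the undiscounted sequence of the tilted measure. Since ⌊1
+ x/h⌋ = ⌊x/h⌋ + 1, the exponential prefactor is exactly the one in `scaleSeq_tilt`. -/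
theorem IsChain.scaleWq_eq (hμ : IsChain lam μ) (H : IsSkipFreeMeasure lam h) {q x : ℝ}
    (hq : 0 ≤ q) (hx : 0 ≤ x) : scaleWq h lam μ q x = scaleSeq lam h q ⌊x / h⌋₊ := by
  have hc := H.phi_nonneg hq
  have hfl : ((⌊1 + x / h⌋ : ℤ) : ℝ) = (⌊x / h⌋₊ + 1 : ℕ) := by
    rw [add_comm, Int.floor_add_one, ← Int.natCast_floor_eq_floor (div_nonneg hx H.h_pos.le)]
    push_cast
    ring
  rw [scaleWq, scaleWTilted, (hμ.isChain_expChange H hc).scaleW_eq (H.withDensity_exp hc),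
    ← H.scaleSeq_tilt hq, hfl, ← Real.exp_nat_mul]
  congr 2
  ring

theorem IsChain.scaleZq_eq (hμ : IsChain lam μ) (H : IsSkipFreeMeasure lam h) {q x : ℝ}
    (hq : 0 ≤ q) (hx : 0 ≤ x) : scaleZq h lam μ q x = scaleSeqZ lam h q ⌊x / h⌋₊ := by
  have hh := H.h_pos
  have key : ∀ j : ℕ, IntervalIntegrable (scaleWq h lam μ q) volume (j * h) ((j + 1 : ℕ) * h) ∧
      ∫ z in (j * h)..((j + 1 : ℕ) * h), scaleWq h lam μ q z = h * scaleSeq lam h q j := by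
    intro j
    have hle : (j : ℝ) * h ≤ (j + 1 : ℕ) * h := by push_cast; nlinarith
    -- Interval integrals live on (jh, (j+1)h], while the step function is constant on [jh, (j+1)h);
    -- the right endpoint is a null set.
    have hae : ∀ᵐ z ∂(volume : Measure ℝ), z ∈ uIoc ((j : ℝ) * h) ((j + 1 : ℕ) * h) →
        scaleSeq lam h q j = scaleWq h lam μ q z := by
      filter_upwards [compl_mem_ae_iff.2 (measure_singleton (((j + 1 : ℕ) : ℝ) * h))] with z hz hz'
      rw [uIoc_of_le hle] at hz'
      have hz0 : 0 ≤ z := (by positivity : (0 : ℝ) ≤ j * h).trans hz'.1.le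
      rw [hμ.scaleWq_eq H hq hz0]
      congr 1
      symm
      rw [Nat.floor_eq_iff (div_nonneg hz0 hh.le), le_div_iff₀ hh, div_lt_iff₀ hh]
      exact ⟨hz'.1.le, lt_of_le_of_ne (by exact_mod_cast hz'.2) (by exact_mod_cast hz)⟩
    refine ⟨(intervalIntegrable_const (c := scaleSeq lam h q j)).congr_ae
      ((ae_restrict_iff' measurableSet_uIoc).2 hae), ?_⟩
    rw [← intervalIntegral.integral_congr_ae hae, intervalIntegral.integral_const, smul_eq_mul]
    push_cast
    ring
  rw [scaleZq, scaleSeqZ, ← Int.natCast_floor_eq_floor (div_nonneg hx hh.le)]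
  have := intervalIntegral.sum_integral_adjacent_intervals (a := fun j : ℕ => (j : ℝ) * h)
    (n := ⌊x / h⌋₊) fun j _ => (key j).1
  simp only [Nat.cast_zero, zero_mul] at this
  rw [Int.cast_natCast, ← this, Finset.sum_congr rfl fun j _ => (key j).2, ← Finset.mul_sum]
  ring

lemma floor_div_of_mem_Ico (hh : 0 < h) {j : ℕ} {x : ℝ}
    (hx : x ∈ Ico ((j : ℝ) * h) ((j + 1 : ℝ) * h)) : 0 ≤ x ∧ ⌊x / h⌋₊ = j := by
  have hx0 : 0 ≤ x := (by positivity : (0 : ℝ) ≤ j * h).trans hx.1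
  refine ⟨hx0, ?_⟩
  rw [Nat.floor_eq_iff (div_nonneg hx0 hh.le), le_div_iff₀ hh, div_lt_iff₀ hh]
  exact hx

lemma IsSkipFreeMeasure.hasLaplace_of_scaleSeq (H : IsSkipFreeMeasure lam h) {q β : ℝ} (hq : 0 ≤ q)
    (hβ : phi lam q < β) {f : ℝ → ℝ} (hf : ∀ x, 0 ≤ x → f x = scaleSeq lam h q ⌊x / h⌋₊) :
    HasLaplace f β ((Real.exp (β * h) - 1) / (β * h * (psi lam β - q))) := by
  have hβ0 : 0 < β := (H.phi_nonneg hq).trans_lt hβ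
  have := hasLaplace_step (f := f) H.h_pos hβ0 (fun j x hx => by
    obtain ⟨h0, h1⟩ := floor_div_of_mem_Ico H.h_pos hx
    rw [hf x h0, h1]) (fun j => (H.scaleSeq_pos hq j).le) (H.hasSum_scaleSeq hq hβ)
  convert this using 1
  have h1 := H.h_pos.ne'
  have h2 := (sub_pos.2 (H.lt_psi hq hβ)).ne'
  rw [neg_mul, Real.exp_neg]
  field_simp

lemma IsSkipFreeMeasure.hasLaplace_of_scaleSeqZ (H : IsSkipFreeMeasure lam h) {q β : ℝ}
    (hq : 0 ≤ q) (hβ : phi lam q < β) {f : ℝ → ℝ}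
    (hf : ∀ x, 0 ≤ x → f x = scaleSeqZ lam h q ⌊x / h⌋₊) :
    HasLaplace f β (1 / β * (1 + q / (psi lam β - q))) := by
  have hβ0 : 0 < β := (H.phi_nonneg hq).trans_lt hβ
  have := hasLaplace_step (f := f) H.h_pos hβ0 (fun j x hx => by
    obtain ⟨h0, h1⟩ := floor_div_of_mem_Ico H.h_pos hx
    rw [hf x h0, h1, scaleSeqZ]) (fun j => add_nonneg zero_le_one (mul_nonneg (mul_nonneg hq H.h_pos.le)
      (Finset.sum_nonneg fun l _ => (H.scaleSeq_pos hq l).le))) (H.hasSum_scaleSeqZ hq hβ)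
  convert this using 1
  have h1 : 1 - Real.exp (-β * h) ≠ 0 := by
    rw [sub_ne_zero, ne_comm, Ne, Real.exp_eq_one_iff, neg_mul, neg_eq_zero]
    exact (mul_pos hβ0 H.h_pos).ne'
  rw [div_mul_eq_mul_div (1 - Real.exp (-β * h)), mul_inv_cancel_left₀ h1, one_div_mul_eq_div]

end SkipFree

/-! ### Limits of the exit formulas and the conclusion -/

namespace SkipFree

/-- The Laplace transform of a first passage time as a limit of ratios of scale functions. -/
theorem IsUpwardsSkipFreeLevyChain.tendsto_integral_first_passage {Ω : Type*}
    {m : MeasurableSpace Ω} {𝓕 : Filtration ℝ≥0 m} {P : Measure Ω} [IsProbabilityMeasure P]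
    {X : ℝ≥0 → Ω → ℝ} {lam : Measure ℝ} {h : ℝ} (hX : IsUpwardsSkipFreeLevyChain 𝓕 P X lam h)
    (H : IsSkipFreeMeasure lam h) {q x : ℝ} (hq : 0 ≤ q) (hx : 0 ≤ x) :
    Tendsto (fun N : ℕ => scaleSeqZ lam h q ⌊x / h⌋₊ - scaleSeqZ lam h q (N + ⌊x / h⌋₊) *
        (scaleSeq lam h q ⌊x / h⌋₊ / scaleSeq lam h q (N + ⌊x / h⌋₊))) atTop
      (𝓝 (∫ ω in {ω | firstPassageBelow x (fun t => X t ω) < ∞},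
        Real.exp (-q * (firstPassageBelow x (fun t => X t ω)).toReal) ∂P)) := by
  classical
  have hm : ∀ t, Measurable (X t) := fun t => (hX.adapted t).mono (𝓕.le t) le_rfl
  set Ξ : Ω → Path := fun ω => ⟨fun t => X t ω, hX.cadlag ω⟩ with hΞ
  have hΞm : Measurable Ξ := measurable_path_of_eval fun t => hm t
  have hc := hX.isChain_pathLaw
  -- At q = 0 the discounted functional is the indicator of the passage event, so its measurability
  -- yields that of the event.
  have hN : NullMeasurableSet {ω | firstPassageBelow x (fun t => X t ω) < ∞} P := by
    have h0 := ((hc.tendsto_first_passage H le_rfl hx).1).comp_measurable hΞm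
    have : {ω | firstPassageBelow x (fun t => X t ω) < ∞} =
        ((fun ω : Path => if firstPassageBelow x ω.1 < ∞ then
          Real.exp (-0 * (firstPassageBelow x ω.1).toReal) else 0) ∘ Ξ) ⁻¹' {1} := by
      ext ω
      by_cases hω : firstPassageBelow x (fun t => X t ω) < ∞ <;> simp [hω, Ξ]
    rw [this]
    exact h0.aemeasurable.nullMeasurableSet_preimage (measurableSet_singleton 1)
  obtain ⟨h1, h2⟩ := hc.tendsto_first_passage H hq hx
  convert h2 using 2
  rw [pathLaw, integral_map hΞm.aemeasurable h1, ← integral_indicator₀ hN]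
  refine integral_congr_ae (ae_of_all _ fun ω => ?_)
  simp only [indicator_apply, mem_ofPred_eq, Ξ]

/-- The scale sequence has a positive, possibly infinite limit. -/
theorem IsSkipFreeMeasure.exists_tendsto_scaleSeq {lam : Measure ℝ} {h : ℝ}
    (H : IsSkipFreeMeasure lam h) :
    ∃ Winf : EReal, 0 < Winf ∧
      Tendsto (fun j : ℕ => (scaleSeq lam h 0 j : EReal)) atTop (𝓝 Winf) ∧
      ∀ (n : ℕ) (p : ℝ), Tendsto (fun N : ℕ => 1 - scaleSeq lam h 0 n / scaleSeq lam h 0 (N + n))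
        atTop (𝓝 p) → (p : EReal) = 1 - (scaleSeq lam h 0 n : EReal) / Winf := by
  have hmono := H.scaleSeq_mono le_rfl
  have hshift := fun n : ℕ => tendsto_add_atTop_nat n
  -- Either w^{(0)} is unbounded, W(+∞) = ∞ and passage below is certain, or it converges to a
  -- finite positive limit.
  rcases tendsto_atTop_of_monotone hmono with hw | ⟨w, hw⟩
  · refine ⟨⊤, EReal.zero_lt_top, EReal.tendsto_coe_nhds_top_iff.2 hw, fun n p hp => ?_⟩
    have := tendsto_nhds_unique hp
      (((hw.comp (hshift n)).const_div_atTop (scaleSeq lam h 0 n)).const_sub 1)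
    rw [this, EReal.div_top]
    simp
  · have hw0 : 0 < w := (H.scaleSeq_pos le_rfl 0).trans_le (hmono.ge_of_tendsto hw 0)
    refine ⟨w, by exact_mod_cast hw0, (continuous_coe_real_ereal.tendsto w).comp hw,
      fun n p hp => ?_⟩
    have := tendsto_nhds_unique hp
      ((tendsto_const_nhds.div (hw.comp (hshift n)) hw0.ne').const_sub 1)
    rw [this]
    push_cast
    rw [EReal.coe_div]

end SkipFree

theorem mainTheorem3 {Ω : Type*} {m : MeasurableSpace Ω} (𝓕 : Filtration ℝ≥0 m)
    (P : Measure Ω) [IsProbabilityMeasure P] (X : ℝ≥0 → Ω → ℝ) (lam : Measure ℝ) (h : ℝ)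
    (hX : SkipFree.IsUpwardsSkipFreeLevyChain 𝓕 P X lam h)
    (μ : Measure SkipFree.Path) (hμ : μ = SkipFree.pathLaw P X hX.cadlag) :
    -- the first passage time below `-x`, for `q > 0`
    (∀ q : ℝ, 0 < q → ∀ x : ℝ, 0 ≤ x →
      ∫ ω in {ω | SkipFree.firstPassageBelow x (fun t => X t ω) < ∞},
          Real.exp (-q * (SkipFree.firstPassageBelow x (fun t => X t ω)).toReal) ∂P =
        SkipFree.scaleZq h lam μ q x -
          q * h / (Real.exp (SkipFree.phi lam q * h) - 1) * SkipFree.scaleWq h lam μ q x) ∧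
    -- the case `q = 0`, with `W(+∞) ∈ (0,∞]` and `a / ∞ = 0`
    (∃ Winf : EReal, 0 < Winf ∧
      Tendsto (fun x : ℝ => (SkipFree.scaleW h lam μ x : EReal)) atTop (𝓝 Winf) ∧
      ∀ x : ℝ, 0 ≤ x →
        ((P.real {ω | SkipFree.firstPassageBelow x (fun t => X t ω) < ∞} : ℝ) : EReal) =
          1 - (SkipFree.scaleW h lam μ x : EReal) / Winf) ∧
    -- the Laplace transform of `Z^{(q)}`
    (∀ q : ℝ, 0 ≤ q → ∀ β : ℝ, SkipFree.phi lam q < β →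
      SkipFree.HasLaplace (SkipFree.scaleZq h lam μ q) β
        (1 / β * (1 + q / (SkipFree.psi lam β - q)))) ∧
    -- the normalisations of `W` and `W^{(q)}` are those with the following Laplace transforms
    (∀ β : ℝ, SkipFree.phi lam 0 < β →
      SkipFree.HasLaplace (SkipFree.scaleW h lam μ) β
        ((Real.exp (β * h) - 1) / (β * h * SkipFree.psi lam β))) ∧
    (∀ q : ℝ, 0 ≤ q → ∀ β : ℝ, SkipFree.phi lam q < β →
      SkipFree.HasLaplace (SkipFree.scaleWq h lam μ q) β
        ((Real.exp (β * h) - 1) / (β * h * (SkipFree.psi lam β - q)))) := by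

  have H : SkipFree.IsSkipFreeMeasure lam h := SkipFree.isSkipFreeMeasure_of_support hX.finite
    hX.h_pos hX.support_subset hX.support_pos
  have hc : SkipFree.IsChain lam μ := hμ ▸ hX.isChain_pathLaw
  refine ⟨fun q hq x hx => ?_, ?_,
    fun q hq β hβ => H.hasLaplace_of_scaleSeqZ hq hβ fun x hx => hc.scaleZq_eq H hq hx,
    fun β hβ => ?_,
    fun q hq β hβ => H.hasLaplace_of_scaleSeq hq hβ fun x hx => hc.scaleWq_eq H hq hx⟩
  · rw [hc.scaleZq_eq H hq.le hx, hc.scaleWq_eq H hq.le hx]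
    refine tendsto_nhds_unique (hX.tendsto_integral_first_passage H hq.le hx) ?_
    -- The exit formula is Z_r - (Z_{N+r}/w_{N+r}) w_r, and the bracketed ratio converges.
    have h1 := (H.tendsto_scaleSeqZ_ratio hq).comp (tendsto_add_atTop_nat ⌊x / h⌋₊)
    refine (tendsto_const_nhds.sub (h1.mul_const (SkipFree.scaleSeq lam h q ⌊x / h⌋₊))).congr
      fun N => ?_
    simp only [Function.comp_apply]
    ring
  · simp only [hc.scaleW_eq H]
    obtain ⟨Winf, hpos, hlim, hval⟩ := H.exists_tendsto_scaleSeq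
    refine ⟨Winf, hpos, hlim.comp ((tendsto_nat_floor_atTop (α := ℝ)).comp
      (tendsto_id.atTop_div_const H.h_pos)), fun x hx => ?_⟩
    have h1 := hX.tendsto_integral_first_passage H le_rfl hx
    simp only [neg_zero, zero_mul, Real.exp_zero, setIntegral_const, smul_eq_mul, mul_one] at h1
    refine hval _ _ (h1.congr fun N => ?_)
    simp only [SkipFree.scaleSeqZ, zero_mul, add_zero, one_mul]
  · have := H.hasLaplace_of_scaleSeq le_rfl hβ fun x _ => hc.scaleW_eq H x
    rwa [sub_zero] at this
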